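/- For a partition $\pi$ of $n$, its rank is its largest part minus its number of parts (the empty partition has rank $0$). Its crank is its largest part if $\pi$ contains no ones, and otherwise the number of parts of $\pi$ larger than $\omega(\pi)$ minus $\omega(\pi)$, where $\omega(\pi)$ is the number of ones of $\pi$ (the empty partition has crank $0$). For $m\in\mathbb Z$ let $N(m,n)$ be the number of partitions of $n$ with rank $m$ and, for $n\ne 1$, let $M(m,n)$ be the number of partitions of $n$ with crank $m$; for $n=1$ put, as is customary, $M(-1,1)=M(1,1)=1$, $M(0,1)=-1$ and $M(m,1)=0$ for all other $m$. For even $j\ge 2$ let $$N_j(n)=\sum_{k\in\mathbb Z}k^jN(k,n),\qquad M_j(n)=\sum_{k\in\mathbb Z}k^jM(k,n).$$ Theorem 5.1. For every integer $n\ge 0$ the following five identities hold: $$N_4(n)=\tfrac23(-3n-1)M_2(n)+\tfrac83M_4(n)+(-12n+1)N_2(n),$$ $$\begin{aligned}N_6(n)={}&\tfrac{2}{33}(324n^2+69n-10)M_2(n)+\tfrac{20}{33}(-45n+4)M_4(n)+\tfrac{18}{11}M_6(n)\\&+(108n^2-24n+1)N_2(n),\end{aligned}$$ $$\begin{aligned}N_8(n)={}&\tfrac{2}{913}(-72972n^3-1728n^2+5667n-289)M_2(n)+\tfrac{280}{913}(732n^2-195n+8)M_4(n)\\&+\tfrac{84}{913}(-196n+15)M_6(n)+\tfrac{1248}{913}M_8(n)+(-864n^3+360n^2-36n+1)N_2(n),\end{aligned}$$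 $$\begin{aligned}N_{10}(n)={}&\tfrac{2}{5951847}(3588144480n^4-805458600n^3-398007108n^2+56257647n-1794592)M_2(n)\\&+\tfrac{140}{5951847}(-72270360n^3+36826920n^2-3625245n+104002)M_4(n)\\&+\tfrac{210}{1983949}(1421544n^2-380744n+13519)M_6(n)+\tfrac{120}{1983949}(-282435n+18796)M_8(n)\\&+\tfrac{2724}{2173}M_{10}(n)+(6480n^4-4320n^3+756n^2-48n+1)N_2(n),\end{aligned}$$ $$\begin{aligned}N_{14}(n)={}&\tfrac{1}{4505033323132497}\bigl(-655918847016750354240n^6+584104439765983424400n^5\\&\quad-88193910587689930464n^4-51255985689606317364n^3+12889219681488512844n^2\\&\quad-1033571808069319887n+23432656561492057\bigr)M_2(n)\\&+\tfrac{364}{4505033323132497}\bigl(2544016408481081520n^5-2986029950270749200n^4\\&\quad+1233083592931144500n^3-185464100558325420n^2+12124758510318780n-229618708346923\bigr)M_4(n)\\&+\tfrac{728}{500559258125833}\bigl(-12932704022040180n^4+11781511098477120n^3-3661921161131415n^2\\&\quad+234233352768436n-7334109150929\bigr)M_6(n)\\&+\tfrac{364}{500559258125833}\bigl(3327634333443960n^3-2184561928177200n^2+464283118670595n\\&\quad-12774042869566\bigr)M_8(n)\\&+\tfrac{2002}{6030834435251}\bigl(-758615153688n^2+404700708960n-24122003839\bigr)M_{10}(n)\\&+\tfrac{25388554464}{2775349487}(n-1)M_{12}(n)+\tfrac{139497552}{120667369}M_{14}(n)\\&+\tfrac{1}{138}\bigl(-107775360n^6+143700480n^5-70752528n^4+14978304n^3-1456488n^2\\&\quad+64320n-1045\bigr)N_2(n)+\tfrac{91}{138}(-36n+13)N_{12}(n).\end{aligned}$$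 -/

import Mathlib

namespace RankCrank

/-- The largest part of a partition; it is `0` for the empty partition. -/
def largestPart {n : ℕ} (p : n.Partition) : ℕ := p.parts.sup

/-- Dyson's rank: the largest part minus the number of parts (`0` for the empty partition). -/
def rank {n : ℕ} (p : n.Partition) : ℤ := (largestPart p : ℤ) - (p.parts.card : ℤ)

/-- The number of ones of a partition. -/
def numOnes {n : ℕ} (p : n.Partition) : ℕ := p.parts.count 1

/-- The Andrews–Garvan crank: the largest part if there are no ones, and otherwise the number of
parts larger than the number of ones minus the number of ones. -/
def crank {n : ℕ} (p : n.Partition) : ℤ :=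
  if numOnes p = 0 then (largestPart p : ℤ)
  else (p.parts.countP (fun a => numOnes p < a) : ℤ) - (numOnes p : ℤ)

/-- `N(m, n)`: the number of partitions of `n` with rank `m`. -/
def N (m : ℤ) (n : ℕ) : ℤ := ((Finset.univ.filter fun p : n.Partition => rank p = m).card : ℤ)

/-- `M(m, n)`: the number of partitions of `n` with crank `m`, with the customary amendment for
`n = 1`, namely `M(-1, 1) = M(1, 1) = 1`, `M(0, 1) = -1` and `M(m, 1) = 0` otherwise, which makes
`∑ M(m, n) z ^ m q ^ n` equal to `∏ (1 - q ^ n) / ((1 - z q ^ n) (1 - z⁻¹ q ^ n))`. -/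
def M (m : ℤ) (n : ℕ) : ℤ :=
  if n = 1 then (if m = 0 then -1 else if m = 1 ∨ m = -1 then 1 else 0)
  else ((Finset.univ.filter fun p : n.Partition => crank p = m).card : ℤ)

/-- The rank moment `N_j(n) = ∑_k k ^ j N(k, n)`, a finitely supported sum over all integers `k`
(see `finite_support_rank`). -/
noncomputable def rankMoment (j n : ℕ) : ℚ := ∑ᶠ k : ℤ, (k : ℚ) ^ j * (N k n : ℚ)

/-- The crank moment `M_j(n) = ∑_k k ^ j M(k, n)`, a finitely supported sum over all integers `k`
(see `finite_support_crank`). -/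
noncomputable def crankMoment (j n : ℕ) : ℚ := ∑ᶠ k : ℤ, (k : ℚ) ^ j * (M k n : ℚ)

theorem finite_support_rank (j n : ℕ) :
    (Function.support fun k : ℤ => (k : ℚ) ^ j * (N k n : ℚ)).Finite := by
  refine (Set.finite_range (rank (n := n))).subset fun k hk => ?_
  by_contra h
  apply hk
  have : N k n = 0 := by
    simp only [N, Nat.cast_eq_zero, Finset.card_eq_zero, Finset.filter_eq_empty_iff]
    exact fun p _ hp => h ⟨p, hp⟩
  simp [this]

theorem finite_support_crank (j n : ℕ) :
    (Function.support fun k : ℤ => (k : ℚ) ^ j * (M k n : ℚ)).Finite := by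
  refine ((Set.finite_range (crank (n := n))).union
    (Set.toFinite ({0, 1, -1} : Set ℤ))).subset fun k hk => ?_
  by_contra h
  apply hk
  have : M k n = 0 := by
    simp only [Set.mem_union, Set.mem_range, Set.mem_insert_iff, Set.mem_singleton_iff,
      not_or, not_exists] at h
    obtain ⟨h1, h2, h3, h4⟩ := h
    unfold M
    split_ifs with h5 h6
    · tauto
    · rfl
    · simp only [Nat.cast_eq_zero, Finset.card_eq_zero, Finset.filter_eq_empty_iff]
      exact fun p _ hp => h1 p hp
  simp [this]

end RankCrank

set_option linter.unusedSimpArgs false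

namespace RankCrank

open PowerSeries
open scoped PowerSeries.WithPiTopology

/-! Write D for q d/dq (`euler`), which multiplies the n-th coefficient by n. The theorem thus
asserts linear relations between derivatives of the series of rank and crank moments. Let P be
`partSeries`, let C(t) be the crank generating function at z = exp t, and let Θ(t) = ∑ (-1)^a
q^(a(a-1)/2) exp((a - 1/2) t). Everything is reduced to the Taylor coefficients of Θ by three facts.

Crank. The functional equation of the crank product, in coefficient form `crankSeries_recurrence`,
forces Θ·C to be a multiple of 2 sinh(t/2) (`egf_crank_mul_theta`). Hence the crank moments divided
by P are polynomials in the normalized moments of Θ.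

Rank. Let B(m) count partitions of rank at most m. Dyson's symmetry gives B(m) + q^(m+2) B(m+3) = P
up to constants at two indices. The operator 3D + m(m+1)/2 is compatible with this recurrence
(`rankLe_recurrence`). Multiplying by Θ^3, which vanishes to third order at t = 0 and so kills the
quadratic inhomogeneity, leaves a single term (`egf_theta_cube_mul_heatFamily`). Comparison with the
crank yields the Atkin–Garvan rank-crank differential equation (`rank_crank_equation`).

Theta. The heat equation expresses D of a theta moment through theta moments (`euler_thetaMom`).
Series `eisTwo`, `eisFour`, `eisSix` are defined so that the first two Ramanujan equations hold by
construction. The third, which closes the ring they generate under D, comes from a bilinear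
relation: weighted self-convolutions of Θ live in a space of rank two (`exists_thetaSq_relation`).

So every series is P times a polynomial in E2, E4, E6, except for one new generator. In the t^r
coefficient of the differential equation (`mom_heatFamily_rankSeries`) the r-th rank moment appears
with factor (r-1)(r-2)/2. For r = 2 this factor vanishes, which gives DP and leaves the second rank
moment free. For r = 4, ..., 14 one solves recursively: a rank moment is a combination of
derivatives of the second one plus P times a polynomial of weight at most r. It remains to write
that polynomial part through derivatives of crank moments.

A count explains the shape of the last identity. In weight 10 there are five monomials in E2, E4, E6
and five derivatives D^(5-j) of the crank moments of order 2j. In weight 12 there are seven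
monomials against six derivatives. In weight 14 there are eight against seven, and the derivative of
the twelfth rank moment supplies the eighth. With explicit coefficients only polynomial identities
have to be checked; algebraic independence of E2, E4, E6 plays no role. -/

/-- A family of power series is locally finite if every coefficient vanishes for all but finitely
many members. -/
def LocFin {ι : Type*} (f : ι → ℚ⟦X⟧) : Prop := ∀ n, {i | coeff n (f i) ≠ 0}.Finite

/-! ### Locally finite families and their sums. -/

section LocFin

variable {ι κ : Type*} {f g : ι → ℚ⟦X⟧}

theorem LocFin.hasSum_coeff (hf : LocFin f) (n : ℕ) :
    HasSum (fun i => coeff n (f i)) (∑ᶠ i, coeff n (f i)) := by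
  have h : (Function.support fun i => coeff n (f i)).Finite := hf n
  rw [finsum_eq_sum _ h]
  apply hasSum_sum_of_ne_finset_zero
  intro b hb
  by_contra h'
  exact hb (h.mem_toFinset.2 h')

theorem LocFin.summable (hf : LocFin f) : Summable f :=
  (PowerSeries.WithPiTopology.summable_iff_summable_coeff ℚ).2 fun n => (hf.hasSum_coeff n).summable

theorem LocFin.coeff_tsum (hf : LocFin f) (n : ℕ) :
    coeff n (∑' i, f i) = ∑ᶠ i, coeff n (f i) :=
  (((PowerSeries.WithPiTopology.hasSum_iff_hasSum_coeff ℚ).1 hf.summable.hasSum) n).unique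
    (hf.hasSum_coeff n)

theorem LocFin.add (hf : LocFin f) (hg : LocFin g) : LocFin fun i => f i + g i := fun n =>
  ((hf n).union (hg n)).subset fun i hi => by
    by_contra h
    simp only [Set.mem_union, Set.mem_ofPred_eq, not_or, not_not] at h
    simp [h.1, h.2] at hi

theorem LocFin.mul_right (hf : LocFin f) (g : ι → ℚ⟦X⟧) : LocFin fun i => f i * g i := fun n => by
  refine ((Finset.range (n + 1)).finite_toSet.biUnion fun k _ => hf k).subset fun i hi => ?_
  by_contra h
  simp only [Set.mem_iUnion, Set.mem_ofPred_eq, not_exists, not_not] at h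
  apply hi
  rw [coeff_mul]
  refine Finset.sum_eq_zero fun p hp => ?_
  have := Finset.HasAntidiagonal.mem_antidiagonal.1 hp
  rw [h p.1 (by simp; omega), zero_mul]

theorem LocFin.mul_left (hf : LocFin f) (g : ι → ℚ⟦X⟧) : LocFin fun i => g i * f i := by
  simpa only [mul_comm] using hf.mul_right g

theorem LocFin.smul (hf : LocFin f) (c : ι → ℚ) : LocFin fun i => c i • f i := by
  simpa only [smul_eq_C_mul] using hf.mul_left fun i => C (c i)

theorem LocFin.neg (hf : LocFin f) : LocFin fun i => -f i := by
  simpa using hf.smul fun _ => -1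

theorem LocFin.sub (hf : LocFin f) (hg : LocFin g) : LocFin fun i => f i - g i := by
  simpa only [sub_eq_add_neg] using hf.add hg.neg

theorem LocFin.comp_injective (hf : LocFin f) {e : κ → ι} (he : Function.Injective e) :
    LocFin fun i => f (e i) := fun n => (hf n).preimage he.injOn

theorem LocFin.prod_mul (hf : LocFin f) {g : κ → ℚ⟦X⟧} (hg : LocFin g) :
    LocFin fun p : ι × κ => f p.1 * g p.2 := fun n => by
  refine ((Finset.range (n + 1)).finite_toSet.biUnion fun k _ =>
    (Finset.range (n + 1)).finite_toSet.biUnion fun l _ => (hf k).prod (hg l)).subset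
      fun i hi => ?_
  by_contra h
  apply hi
  rw [coeff_mul]
  refine Finset.sum_eq_zero fun p hp => ?_
  have hp := Finset.HasAntidiagonal.mem_antidiagonal.1 hp
  simp only [Set.mem_iUnion, Set.mem_prod, Set.mem_ofPred_eq, not_exists, not_and, not_not] at h
  by_cases h0 : coeff p.1 (f i.1) = 0
  · rw [h0, zero_mul]
  · rw [h p.1 (by simp; omega) p.2 (by simp; omega) h0, mul_zero]

end LocFin

/-! ### The Euler operator, convolutions, moments and exponential generating functions. -/

/-- The Euler operator `q d/dq` on power series. -/
noncomputable def euler : Derivation ℚ ℚ⟦X⟧ ℚ⟦X⟧ := (X : ℚ⟦X⟧) • d⁄dX ℚ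

theorem coeff_euler (f : ℚ⟦X⟧) (n : ℕ) : coeff n (euler f) = n * coeff n f := by
  rw [euler, Derivation.smul_apply, smul_eq_mul]
  cases n with
  | zero => simp
  | succ n => rw [coeff_succ_X_mul, coeff_derivative]; push_cast; ring

theorem euler_X_pow (k : ℕ) : euler (X ^ k : ℚ⟦X⟧) = (k : ℚ) • X ^ k := by
  ext n
  rw [coeff_euler, map_smul, coeff_X_pow, smul_eq_mul]
  split_ifs with h <;> simp [h]

theorem LocFin.euler {ι : Type*} {f : ι → ℚ⟦X⟧} (hf : LocFin f) :
    LocFin fun i => euler (f i) := fun n =>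
  (hf n).subset fun i hi h => hi (by rw [coeff_euler, h, mul_zero])

theorem euler_tsum {ι : Type*} {f : ι → ℚ⟦X⟧} (hf : LocFin f) :
    euler (∑' i, f i) = ∑' i, euler (f i) := by
  ext n
  rw [coeff_euler, hf.coeff_tsum, hf.euler.coeff_tsum, mul_finsum]
  simp only [coeff_euler]

/-- The convolution of two families. -/
noncomputable def conv (u v : ℤ → ℚ⟦X⟧) (m : ℤ) : ℚ⟦X⟧ := ∑' a, u a * v (m - a)

/-- The `r`-th moment of a family about `c`. -/
noncomputable def mom (c : ℚ) (r : ℕ) (u : ℤ → ℚ⟦X⟧) : ℚ⟦X⟧ := ∑' a : ℤ, ((a - c : ℚ) ^ r) • u a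

/-- The exponential generating function `∑ u_a exp ((a - c) t)`. -/
noncomputable def egf (c : ℚ) (u : ℤ → ℚ⟦X⟧) : ℚ⟦X⟧⟦X⟧ :=
  PowerSeries.mk fun r => ((r.factorial : ℚ)⁻¹) • mom c r u

/-- The shear of `ℤ × ℤ`, under which convolution sums become product sums. -/
def shear : ℤ × ℤ ≃ ℤ × ℤ where
  toFun p := (p.1 + p.2, p.1)
  invFun p := (p.2, p.1 - p.2)
  left_inv p := by simp
  right_inv p := by simp

theorem LocFin.conv {u v : ℤ → ℚ⟦X⟧} (hu : LocFin u) (hv : LocFin v) : LocFin (conv u v) := by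
  have h := (hu.prod_mul hv).comp_injective shear.symm.injective
  intro n
  refine ((h n).image Prod.fst).subset fun m hm => ?_
  by_contra h'
  apply hm
  have h2 : ∀ a, coeff n (u a * v (m - a)) = 0 := by
    intro a
    by_contra h3
    exact h' ⟨(m, a), h3, rfl⟩
  rw [RankCrank.conv, (hu.mul_right _).coeff_tsum]
  simp [h2]

theorem tsum_smul_conv {u v : ℤ → ℚ⟦X⟧} (hu : LocFin u) (hv : LocFin v) (c : ℤ → ℚ) :
    ∑' m, c m • conv u v m = ∑' p : ℤ × ℤ, c (p.1 + p.2) • (u p.1 * v p.2) := by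
  have h : LocFin fun p : ℤ × ℤ => c (p.1 + p.2) • (u p.1 * v p.2) := (hu.prod_mul hv).smul _
  have h' := h.comp_injective shear.symm.injective
  rw [← shear.symm.tsum_eq]
  rw [h'.summable.tsum_prod']
  · refine tsum_congr fun m => ?_
    simp only [conv]
    rw [← (hu.mul_right fun a => v (m - a)).summable.tsum_const_smul]
    refine tsum_congr fun a => ?_
    simp [shear]
  · intro m
    exact (h'.comp_injective (Prod.mk_right_injective m)).summable

theorem mom_conv {u v : ℤ → ℚ⟦X⟧} (hu : LocFin u) (hv : LocFin v) (c d : ℚ) (r : ℕ) :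
    mom (c + d) r (conv u v) =
      ∑ p ∈ Finset.HasAntidiagonal.antidiagonal r, (r.choose p.1 : ℚ) • (mom c p.1 u * mom d p.2 v) := by
  rw [mom, tsum_smul_conv hu hv fun m => ((m - (c + d) : ℚ)) ^ r]
  have h1 : ∀ p : ℤ × ℤ, ((((p.1 + p.2 : ℤ) : ℚ) - (c + d)) ^ r) • (u p.1 * v p.2) =
      ∑ k ∈ Finset.HasAntidiagonal.antidiagonal r, (r.choose k.1 : ℚ) •
        ((((p.1 : ℚ) - c) ^ k.1 • u p.1) * (((p.2 : ℚ) - d) ^ k.2 • v p.2)) := by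
    intro p
    have h2 : (((p.1 + p.2 : ℤ) : ℚ) - (c + d)) = (p.1 - c) + (p.2 - d) := by push_cast; ring
    rw [h2, (Commute.all _ _).add_pow', Finset.sum_smul]
    refine Finset.sum_congr rfl fun k _ => ?_
    rw [smul_mul_smul_comm, smul_smul, nsmul_eq_mul]
  have hp : ∀ k : ℕ × ℕ, LocFin fun p : ℤ × ℤ =>
      ((((p.1 : ℚ) - c) ^ k.1 • u p.1) * (((p.2 : ℚ) - d) ^ k.2 • v p.2)) := fun k =>
    (hu.smul fun a : ℤ => ((a : ℚ) - c) ^ k.1).prod_mul (hv.smul fun a : ℤ => ((a : ℚ) - d) ^ k.2)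
  simp only [h1]
  rw [Summable.tsum_finsetSum fun k _ => ((hp k).summable.const_smul _)]
  refine Finset.sum_congr rfl fun k _ => ?_
  rw [(hp k).summable.tsum_const_smul, mom, mom,
    (hu.smul fun a : ℤ => ((a : ℚ) - c) ^ k.1).summable.tsum_mul_tsum
      (hv.smul fun a : ℤ => ((a : ℚ) - d) ^ k.2).summable (hp k).summable]

/-- Exponentials turn convolution into multiplication, and the centres add. Through this lemma,
statements about the support of a convolution become product formulas in t. -/
theorem egf_conv {u v : ℤ → ℚ⟦X⟧} (hu : LocFin u) (hv : LocFin v) (c d : ℚ) :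
    egf (c + d) (conv u v) = egf c u * egf d v := by
  ext1 r
  rw [coeff_mul, egf, coeff_mk, mom_conv hu hv, Finset.smul_sum]
  refine Finset.sum_congr rfl fun p hp => ?_
  rw [egf, egf, coeff_mk, coeff_mk, smul_mul_smul_comm, smul_smul]
  congr 1
  have hp := Finset.HasAntidiagonal.mem_antidiagonal.1 hp
  subst hp
  rw [Nat.cast_add_choose]
  have := Nat.factorial_ne_zero
  field_simp

/-! ### Quasi-periodic families and the theta series. -/

/-- The power `q ^ e`, truncated to `1` for negative `e`. -/
noncomputable def qpow (e : ℤ) : ℚ⟦X⟧ := X ^ e.toNat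

theorem qpow_ne_zero (e : ℤ) : qpow e ≠ 0 := pow_ne_zero _ X_ne_zero

theorem qpow_zero : qpow 0 = 1 := by simp [qpow]

theorem qpow_one : qpow 1 = X := by simp [qpow]

/-- Replaces q^a q^b = q^(a+b) for exponents of any sign. A relation F = q^e G is written throughout
as `qpow (-e) * F = qpow e * G`, which avoids Laurent series; exponents are then combined by this
identity after cancelling nonzero factors. -/
theorem qpow_mul_qpow (a b : ℤ) :
    qpow a * qpow b * qpow (-(a + b)) = qpow (-a) * qpow (-b) * qpow (a + b) := by
  simp only [qpow, ← pow_add]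
  congr 1
  omega

theorem qpow_sub_qpow_neg_ne_zero {m : ℤ} (hm : m ≠ 0) : qpow (-m) - qpow m ≠ 0 := by
  intro h
  have h2 : (-m).toNat ≠ m.toNat := by omega
  have h1 := congrArg (coeff m.toNat) h
  simp [qpow, coeff_X_pow, h2.symm] at h1

/-- The transformation law `u (a + k) = ε q ^ a u a`. -/
def QuasiPeriodic (k : ℤ) (ε : ℚ⟦X⟧) (u : ℤ → ℚ⟦X⟧) : Prop :=
  ∀ a, qpow (-a) * u (a + k) = ε * (qpow a * u a)

theorem QuasiPeriodic.mul {k l : ℤ} {ε δ : ℚ⟦X⟧} {u v : ℤ → ℚ⟦X⟧} (hu : QuasiPeriodic k ε u)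
    (hv : QuasiPeriodic l δ v) (a b : ℤ) :
    qpow (-(a + b)) * (u (a + k) * v (b + l)) = ε * δ * (qpow (a + b) * (u a * v b)) := by
  refine mul_left_cancel₀ (mul_ne_zero (qpow_ne_zero (-a)) (qpow_ne_zero (-b))) ?_
  linear_combination qpow (-(a + b)) * qpow (-b) * v (b + l) * hu a +
    qpow (-(a + b)) * ε * qpow a * u a * hv b + ε * δ * u a * v b * qpow_mul_qpow a b

theorem QuasiPeriodic.conv {k l : ℤ} {ε δ : ℚ⟦X⟧} {u v : ℤ → ℚ⟦X⟧} (hu : QuasiPeriodic k ε u)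
    (hv : QuasiPeriodic l δ v) (hf : LocFin u) : QuasiPeriodic (k + l) (ε * δ) (conv u v) := by
  intro m
  have hs : Summable fun a => u (a + k) * v (m + (k + l) - (a + k)) :=
    ((hf.comp_injective (add_left_injective k)).mul_right _).summable
  rw [RankCrank.conv, RankCrank.conv, ← (Equiv.addRight k).tsum_eq]
  simp only [Equiv.coe_addRight]
  rw [← hs.tsum_mul_left, ← (hf.mul_right _).summable.tsum_mul_left,
    ← ((hf.mul_right _).mul_left _).summable.tsum_mul_left]
  refine tsum_congr fun a => ?_
  have h := hu.mul hv a (m - a)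
  rw [add_sub_cancel] at h
  rw [← h]
  congr 3
  ring

/-- If `J` is quasi-periodic, `h` satisfies the dual inhomogeneous recurrence, and `J` annihilates
the inhomogeneity, then the convolution of `J` and `h` is supported at a single point. -/
theorem conv_eq_zero_of_recurrence {k s : ℤ} {J h p : ℤ → ℚ⟦X⟧} (hJ : LocFin J)
    (hqp : QuasiPeriodic k (-1) J)
    (hrec : ∀ m, qpow (-(m + s)) * h m + qpow (m + s) * h (m + k) = qpow (-(m + s)) * p m)
    (hp : ∀ m, conv J p m = 0) {m : ℤ} (hm : m ≠ k - s) : conv J h m = 0 := by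
  have e : ∀ f : ℤ → ℚ⟦X⟧, conv J f m = ∑' a, J (a + k) * f (m - a - k) := by
    intro f
    rw [conv, ← (Equiv.addRight k).tsum_eq]
    refine tsum_congr fun a => ?_
    rw [Equiv.coe_addRight, sub_sub]
  have hs : ∀ f : ℤ → ℚ⟦X⟧, Summable fun a => J (a + k) * f (m - a - k) := fun f =>
    ((hJ.comp_injective (add_left_injective k)).mul_right _).summable
  -- Shift the summation index by k, use J(a+k) = -q^a J(a) and h(b) = p(b) - q^(b+s) h(b+k) with b
  -- = m-a-k. The powers of q combine to q^(m+s-k), independent of a, so the sum reproduces itself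
  -- with that factor.
  have key : qpow (-(m + s - k)) * conv J h m = qpow (m + s - k) * conv J h m := by
    have h1 : qpow (-(m + s - k)) * conv J h m =
        qpow (-(m + s - k)) * conv J p m + qpow (m + s - k) * conv J h m := by
      change _ = _ + qpow (m + s - k) * ∑' a, J a * h (m - a)
      rw [e h, e p, ← (hs h).tsum_mul_left, ← (hs p).tsum_mul_left,
        ← (hJ.mul_right _).summable.tsum_mul_left,
        ← ((hs p).mul_left _).tsum_add ((hJ.mul_right _).summable.mul_left _)]
      refine tsum_congr fun a => ?_
      set b := m - a - k with hb
      refine mul_left_cancel₀ (mul_ne_zero (qpow_ne_zero (-a)) (qpow_ne_zero (-(b + s)))) ?_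
      have h3 := hrec b
      have h4 := qpow_mul_qpow a (b + s)
      have h5 : a + (b + s) = m + s - k := by rw [hb]; ring
      have h6 : b + k = m - a := by rw [hb]; ring
      rw [h5] at h4
      rw [h6] at h3
      linear_combination (qpow (-(m + s - k)) * qpow (-(b + s)) * (h b - p b)) * hqp a -
        qpow (-(m + s - k)) * qpow a * J a * h3 + J a * h (m - a) * h4
    rw [h1, hp, mul_zero, zero_add]
  have h7 : (qpow (-(m + s - k)) - qpow (m + s - k)) * conv J h m = 0 := by
    rw [sub_mul, key, sub_self]
  exact (mul_eq_zero.1 h7).resolve_left (qpow_sub_qpow_neg_ne_zero (by omega))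

/-- The coefficients `(-1) ^ a q ^ (a (a - 1) / 2)` of the theta series. -/
noncomputable def theta (a : ℤ) : ℚ⟦X⟧ :=
  ((-1 : ℚ) ^ a.natAbs) • X ^ (a * (a - 1) / 2).toNat

theorem tri_nonneg (a : ℤ) : 0 ≤ a * (a - 1) / 2 := by
  apply Int.ediv_nonneg _ (by norm_num)
  rcases le_or_gt a 0 with h | h <;> nlinarith

theorem two_mul_tri (a : ℤ) : 2 * (a * (a - 1) / 2) = a * (a - 1) :=
  Int.mul_ediv_cancel' (by
    rcases Int.even_or_odd' a with ⟨b, h | h⟩ <;> rw [h]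
    · exact ⟨b * (2 * b - 1), by ring⟩
    · exact ⟨(2 * b + 1) * b, by ring⟩)

theorem locFin_theta : LocFin theta := fun n => by
  refine (Set.finite_Icc (-(n + 1) : ℤ) (n + 1)).subset fun a ha => ?_
  have h : n = (a * (a - 1) / 2).toNat := by
    by_contra h
    exact ha (by simp [theta, coeff_X_pow, h])
  have h1 := two_mul_tri a
  have h2 := tri_nonneg a
  have h3 : (n : ℤ) = a * (a - 1) / 2 := by omega
  rw [← h3] at h1
  constructor <;> by_contra! <;> nlinarith

theorem neg_one_pow_natAbs_add_one (a : ℤ) :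
    (-1 : ℚ) ^ (a + 1).natAbs = -(-1) ^ a.natAbs := by
  have h : ∀ b : ℤ, (-1 : ℚ) ^ b.natAbs = (-1) ^ b := fun b => by
    obtain ⟨n, rfl | rfl⟩ := b.eq_nat_or_neg
    · simp
    · rw [Int.natAbs_neg, Int.natAbs_natCast, zpow_neg, zpow_natCast, ← inv_pow]
      norm_num
  rw [h, h, zpow_add₀ (by norm_num)]
  simp

theorem quasiPeriodic_theta : QuasiPeriodic 1 (-1) theta := by
  intro a
  rw [theta, theta, neg_one_pow_natAbs_add_one, qpow, qpow, mul_smul_comm, mul_smul_comm,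
    ← pow_add, ← pow_add, neg_smul, neg_one_mul]
  congr 3
  have h1 := two_mul_tri a
  have h2 := two_mul_tri (a + 1)
  have h3 := tri_nonneg a
  have h4 := tri_nonneg (a + 1)
  have h5 : (a + 1) * (a + 1 - 1) = a * (a - 1) + 2 * a := by ring
  omega

theorem theta_one_sub (a : ℤ) : theta (1 - a) = -theta a := by
  have h : (1 - a) * (1 - a - 1) = a * (a - 1) := by ring
  have h2 : (-1 : ℚ) ^ (1 - a).natAbs = -(-1) ^ a.natAbs := by
    rw [show 1 - a = -a + 1 by ring, neg_one_pow_natAbs_add_one, Int.natAbs_neg]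
  rw [theta, theta, h, h2, neg_smul]

/-- The heat equation: a(a-1)/2 = ((a - 1/2)^2 - 1/4)/2, which is also why 1/2 is the natural centre
for the moments. -/
theorem euler_theta (a : ℤ) :
    euler (theta a) = ((((a : ℚ) - 1 / 2) ^ 2 - 1 / 4) / 2) • theta a := by
  rw [theta, Derivation.map_smul, euler_X_pow, smul_comm]
  congr 1
  have h1 := two_mul_tri a
  have h2 := Int.toNat_of_nonneg (tri_nonneg a)
  have h3 : (((a * (a - 1) / 2).toNat : ℤ) : ℚ) * 2 = a * (a - 1) := by
    rw [h2]; exact_mod_cast (by linarith)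
  rw [Int.cast_natCast] at h3
  linear_combination h3 / 2

/-- The convolution cube of the theta coefficients. -/
noncomputable def thetaCube : ℤ → ℚ⟦X⟧ := conv theta (conv theta theta)

theorem locFin_thetaCube : LocFin thetaCube :=
  locFin_theta.conv (locFin_theta.conv locFin_theta)

theorem quasiPeriodic_thetaCube : QuasiPeriodic 3 (-1) thetaCube := by
  have := quasiPeriodic_theta.conv (quasiPeriodic_theta.conv quasiPeriodic_theta locFin_theta)
    locFin_theta
  norm_num at this
  exact this

/-- The moments of the theta series. -/
noncomputable def thetaMom (r : ℕ) : ℚ⟦X⟧ := mom (1 / 2) r theta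

/-- The reflection a ↦ 1 - a fixes the centre 1/2 and changes the sign of the theta coefficients;
equivalently Θ is odd in t. -/
theorem thetaMom_even {r : ℕ} (hr : Even r) : thetaMom r = 0 := by
  have h : thetaMom r = -thetaMom r := by
    conv_lhs => rw [thetaMom, mom, ← (Equiv.subLeft (1 : ℤ)).tsum_eq]
    rw [thetaMom, mom, ← tsum_neg]
    refine tsum_congr fun a => ?_
    rw [Equiv.subLeft_apply, theta_one_sub, smul_neg]
    congr 2
    rw [← hr.neg_pow]
    push_cast
    ring
  ext n
  have h2 := congrArg (coeff n) h
  rw [map_neg] at h2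
  simpa using self_eq_neg.1 h2

theorem euler_thetaMom (r : ℕ) :
    euler (thetaMom r) = (1 / 2 : ℚ) • thetaMom (r + 2) - (1 / 8 : ℚ) • thetaMom r := by
  have hs : ∀ k : ℕ, LocFin fun a : ℤ => ((a - 1 / 2 : ℚ) ^ k) • theta a := fun k =>
    locFin_theta.smul _
  simp only [thetaMom, mom]
  rw [euler_tsum (hs r), ← (hs r).summable.tsum_const_smul, ← (hs (r + 2)).summable.tsum_const_smul,
    ← ((hs (r + 2)).summable.const_smul _).tsum_sub ((hs r).summable.const_smul _)]
  refine tsum_congr fun a => ?_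
  rw [Derivation.map_smul, euler_theta, smul_smul, smul_smul, smul_smul, ← sub_smul]
  congr 1
  ring

/-- Only a = 0 and a = 1 have exponent zero, and each contributes -1/2. In particular the first
moment is a unit, by which the others can be normalized. -/
theorem constantCoeff_thetaMom_one : coeff 0 (thetaMom 1) = -1 := by
  rw [thetaMom, mom, (locFin_theta.smul _).coeff_tsum]
  rw [finsum_eq_sum_of_support_subset (s := {0, 1})]
  · norm_num [theta]
  · intro a ha
    by_contra h
    apply ha
    simp only [Finset.coe_insert, Finset.coe_singleton, Set.mem_insert_iff,
      Set.mem_singleton_iff, not_or] at h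
    have h1 := two_mul_tri a
    have h2 : 0 < a * (a - 1) := by
      rcases lt_or_gt_of_ne h.1 with h3 | h3
      · nlinarith
      · have : 1 < a := by omega
        nlinarith
    have h3 : (a * (a - 1) / 2).toNat ≠ 0 := by omega
    simp [theta, coeff_X_pow, h3.symm]

/-! ### Theta times a crank-type family. -/

/-- If the family `c` satisfies the three-term recurrence of the crank generating functions, its
convolution with the theta coefficients is supported on `{0, 1}`. -/
theorem conv_theta_of_recurrence {c : ℤ → ℚ⟦X⟧}
    (hc : ∀ m, qpow (-m) * c m - qpow m * c m =
      X * (qpow (-m) * c (m - 1)) - X * (qpow m * c (m + 1))) :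
    conv theta c 0 = -conv theta c 1 ∧ ∀ k, k ≠ 0 → k ≠ 1 → conv theta c k = 0 := by
  set W := conv theta c with hW
  -- In plain powers: q(1 - q^k) W(k) = (q^2 - q^k) W(k-1). It combines the quasi-periodicity of
  -- theta with the recurrence of c, term by term in the summation index. The left factor vanishes
  -- only at k = 0 and the right one only at k = 2, which isolates the indices 0 and 1.
  have key : ∀ k, X * (qpow (-k) - qpow k) * W k = (X ^ 2 * qpow (-k) - qpow k) * W (k - 1) := by
    intro k
    have hs : ∀ (d e : ℤ) (y : ℚ⟦X⟧), Summable fun b => y * (theta (b + d) * c (e - b)) :=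
      fun d e y => ((((locFin_theta.comp_injective (add_left_injective d)).mul_right _)).mul_left
        _).summable
    have e0 : ∀ m, W m = ∑' b, theta (b + 0) * c (m - b) := fun m => by simp [hW, conv]
    have e1 : ∀ m, W m = ∑' b, theta (b + 1) * c (m - 1 - b) := by
      intro m
      rw [hW, conv, ← (Equiv.addRight (1 : ℤ)).tsum_eq]
      refine tsum_congr fun b => ?_
      rw [Equiv.coe_addRight]
      congr 2
      ring
    have hz : X * qpow (-k) * W k + qpow k * W (k - 1) - (X ^ 2 * qpow (-k) * W (k - 1) +
        X * qpow k * W k) = 0 := by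
      conv_lhs =>
        enter [1, 1]
        rw [e1 k, ← (by simpa using hs 1 (k - 1) 1 : Summable _).tsum_mul_left]
      conv_lhs =>
        enter [1, 2]
        rw [e0 (k - 1), ← (by simpa using hs 0 (k - 1) 1 : Summable _).tsum_mul_left]
      conv_lhs =>
        enter [2, 1]
        rw [e1 (k - 1), ← (by simpa using hs 1 (k - 1 - 1) 1 : Summable _).tsum_mul_left]
      conv_lhs =>
        enter [2, 2]
        rw [e0 k, ← (by simpa using hs 0 k 1 : Summable _).tsum_mul_left]
      rw [← (hs _ _ _).tsum_add (hs _ _ _), ← (hs _ _ _).tsum_add (hs _ _ _),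
        ← ((hs _ _ _).add (hs _ _ _)).tsum_sub ((hs _ _ _).add (hs _ _ _))]
      refine (tsum_congr fun b => ?_).trans tsum_zero
      rw [add_zero]
      set m := k - 1 - b with hm
      have r1 := quasiPeriodic_theta b
      have r2 := hc m
      have r3 := qpow_mul_qpow b m
      have r4 : X * qpow (-k) * qpow (k - 1) = qpow k * qpow (-(k - 1)) := by
        have := qpow_mul_qpow 1 (k - 1)
        rw [add_sub_cancel, qpow_one, show qpow (-1) = 1 by simp [qpow]] at this
        linear_combination this
      rw [show b + m = k - 1 by rw [hm]; ring] at r3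
      rw [show k - 1 - 1 - b = m - 1 by rw [hm]; ring, show k - b = m + 1 by rw [hm]; ring]
      refine (mul_eq_zero.1 (?_ : qpow (-b) * qpow (-m) * qpow (-(k - 1)) * _ = 0)).resolve_left
        (mul_ne_zero (mul_ne_zero (qpow_ne_zero _) (qpow_ne_zero _)) (qpow_ne_zero _))
      linear_combination (X * qpow (-k) * qpow (-(k - 1)) * qpow (-m) * (c m - X * c (m - 1))) * r1 -
        (X * qpow (-k) * qpow (-(k - 1)) * qpow b * theta b) * r2 -
        (qpow (-b) * qpow (-m) * theta b * (c m - X * c (m + 1))) * r4 -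
        (X * qpow (-k) * theta b * (c m - X * c (m + 1))) * r3
    linear_combination hz
  have hX : ∀ k : ℤ, k ≠ 0 → X * (qpow (-k) - qpow k) ≠ (0 : ℚ⟦X⟧) := fun k hk =>
    mul_ne_zero X_ne_zero (qpow_sub_qpow_neg_ne_zero hk)
  -- Started by k = 0, where the left side of `key` vanishes, and continued downwards.
  have hneg : ∀ n : ℕ, W (-1 - n) = 0 := by
    intro n
    induction n with
    | zero =>
      have h := key 0
      rw [neg_zero, sub_self, mul_zero, zero_mul, qpow_zero] at h
      have h1 : (X ^ 2 * 1 - 1 : ℚ⟦X⟧) ≠ 0 := fun h2 => by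
        simpa using congrArg (coeff 0) h2
      simpa using (mul_eq_zero.1 h.symm).resolve_left h1
    | succ n ih =>
      have h := key (-1 - n)
      rw [ih, mul_zero] at h
      have h1 : (X ^ 2 * qpow (-(-1 - n)) - qpow (-1 - n) : ℚ⟦X⟧) ≠ 0 := fun h2 => by
        have h3 : (-1 - (n : ℤ)).toNat = 0 := by omega
        simpa [qpow, h3] using congrArg (coeff 0) h2
      have h2 := (mul_eq_zero.1 h.symm).resolve_left h1
      rw [← h2]
      congr 1
      push_cast
      ring
  -- Started by k = 2, where the right side of `key` vanishes, and continued upwards.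
  have hpos : ∀ n : ℕ, W (2 + n) = 0 := by
    intro n
    induction n with
    | zero =>
      have h := key 2
      have h1 : (X ^ 2 * qpow (-2) - qpow 2 : ℚ⟦X⟧) = 0 := by simp [qpow]
      rw [h1, zero_mul] at h
      simpa using (mul_eq_zero.1 h).resolve_left (hX 2 (by norm_num))
    | succ n ih =>
      have h := key (2 + (n + 1 : ℕ))
      rw [show (2 + ((n + 1 : ℕ) : ℤ) - 1) = 2 + n by push_cast; ring, ih, mul_zero] at h
      exact (mul_eq_zero.1 h).resolve_left (hX _ (by omega))
  refine ⟨?_, fun k h0 h1 => ?_⟩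
  · have h := key 1
    rw [show qpow (-1) = 1 by simp [qpow], qpow_one, sub_self] at h
    have h1 : X * (1 - X) ≠ (0 : ℚ⟦X⟧) := by
      have := hX 1 one_ne_zero
      rwa [show qpow (-1) = 1 by simp [qpow], qpow_one] at this
    refine mul_left_cancel₀ h1 ?_
    linear_combination h
  · rcases lt_or_ge k 0 with h | h
    · obtain ⟨n, hn⟩ := Int.eq_ofNat_of_zero_le (show 0 ≤ -1 - k by omega)
      have := hneg n
      rwa [← hn, sub_sub_cancel] at this
    · obtain ⟨n, hn⟩ := Int.eq_ofNat_of_zero_le (show 0 ≤ k - 2 by omega)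
      have := hpos n
      rwa [← hn, add_sub_cancel] at this

/-- Integration of a weight function against a locally finite family. -/
noncomputable def integ {ι : Type*} {u : ι → ℚ⟦X⟧} (hu : LocFin u) : (ι → ℚ) →ₗ[ℚ] ℚ⟦X⟧ where
  toFun f := ∑' i, f i • u i
  map_add' f g := by
    rw [← (hu.smul f).summable.tsum_add (hu.smul g).summable]
    simp only [Pi.add_apply, add_smul]
  map_smul' c f := by
    rw [RingHom.id_apply, ← (hu.smul f).summable.tsum_const_smul]
    simp only [Pi.smul_apply, smul_smul, smul_eq_mul]

theorem integ_apply {ι : Type*} {u : ι → ℚ⟦X⟧} (hu : LocFin u) (f : ι → ℚ) :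
    integ hu f = ∑' i, f i • u i := rfl

theorem mom_eq_integ {u : ℤ → ℚ⟦X⟧} (hu : LocFin u) (c : ℚ) (r : ℕ) :
    mom c r u = integ hu fun a : ℤ => ((a : ℚ) - c) ^ r := rfl

/-- The series `exp (c t)`. -/
noncomputable def expSeries (c : ℚ) : ℚ⟦X⟧⟦X⟧ := rescale (algebraMap ℚ ℚ⟦X⟧ c) (exp ℚ⟦X⟧)

theorem coeff_expSeries (c : ℚ) (r : ℕ) :
    coeff r (expSeries c) = algebraMap ℚ ℚ⟦X⟧ (c ^ r / r.factorial) := by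
  rw [expSeries, coeff_rescale, coeff_exp, ← map_pow, ← map_mul, mul_one_div]

theorem expSeries_mul (a b : ℚ) : expSeries a * expSeries b = expSeries (a + b) := by
  rw [expSeries, expSeries, expSeries, map_add, exp_mul_exp_eq_exp_add]

/-- The series `2 sinh (t / 2)`. -/
noncomputable def sinhSeries : ℚ⟦X⟧⟦X⟧ := expSeries (1 / 2) - expSeries (-1 / 2)

theorem coeff_egf (c : ℚ) (u : ℤ → ℚ⟦X⟧) (r : ℕ) :
    coeff r (egf c u) = ((r.factorial : ℚ)⁻¹) • mom c r u := by
  rw [egf, coeff_mk]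

theorem egf_of_support {u : ℤ → ℚ⟦X⟧} (s : Finset ℤ) (hu : ∀ m, m ∉ s → u m = 0) (c : ℚ) :
    egf c u = ∑ m ∈ s, C (u m) * expSeries (m - c) := by
  ext1 r
  rw [coeff_egf, mom, tsum_eq_sum (s := s) fun m hm => by rw [hu m hm, smul_zero], map_sum,
    Finset.smul_sum]
  refine Finset.sum_congr rfl fun m _ => ?_
  rw [coeff_C_mul, coeff_expSeries, smul_smul, Algebra.smul_def, mul_comm, div_eq_inv_mul]

theorem egf_theta_ne_zero : egf (1 / 2) theta ≠ 0 := fun h => by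
  have h1 := congrArg (coeff 1) h
  rw [coeff_egf] at h1
  have h2 := congrArg (coeff 0) h1
  change coeff 0 (_ • thetaMom 1) = _ at h2
  rw [map_smul, constantCoeff_thetaMom_one] at h2
  norm_num at h2

/-- The product formula for the generating function of the crank moments. -/
theorem egf_crank_mul_theta {c : ℤ → ℚ⟦X⟧} (hf : LocFin c)
    (hc : ∀ m, qpow (-m) * c m - qpow m * c m =
      X * (qpow (-m) * c (m - 1)) - X * (qpow m * c (m + 1))) :
    egf (1 / 2) theta * egf 0 c = C (mom 0 0 c * thetaMom 1) * sinhSeries := by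
  obtain ⟨h1, h2⟩ := conv_theta_of_recurrence hc
  set w := conv theta c 1
  have h3 : egf (1 / 2) theta * egf 0 c = C w * sinhSeries := by
    rw [← egf_conv locFin_theta hf, egf_of_support {0, 1}]
    · rw [Finset.sum_pair zero_ne_one, h1, sinhSeries]
      norm_num
      ring
    · intro m hm
      simp only [Finset.mem_insert, Finset.mem_singleton, not_or] at hm
      exact h2 m hm.1 hm.2
  -- The unknown factor w is read off from the coefficient of t: Θ has no constant term, so only the
  -- first theta moment times the zeroth moment of c remains.
  have h4 := congrArg (coeff 1) h3
  rw [coeff_mul, Finset.Nat.antidiagonal_succ] at h4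
  have h5 : mom (1 / 2) 0 theta = 0 := thetaMom_even (by decide)
  simp only [Finset.Nat.antidiagonal_zero, Finset.map_singleton, Finset.sum_cons,
    Finset.sum_singleton, coeff_egf, h5, coeff_C_mul, sinhSeries, map_sub, coeff_expSeries] at h4
  norm_num at h4
  have h6 : (C (1 / 2 : ℚ) + C (1 / 2) : ℚ⟦X⟧) = 1 := by
    rw [← map_add]; norm_num
  rw [h6, mul_one] at h4
  rw [h3, ← h4, mul_comm, thetaMom, mul_comm (mom _ _ _)]
  ring

/-! ### The heat operator and the rank-crank differential equation. -/

/-- The family obtained from `(1 - z) ^ 3` times the image of the cumulative rank series under the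
heat operator, in terms of the rank series itself. -/
noncomputable def heatFamily (N : ℤ → ℚ⟦X⟧) (m : ℤ) : ℚ⟦X⟧ :=
  (3 * euler (N m) + ((m ^ 2 + m) / 2 : ℚ) • N m)
    - 2 * (3 * euler (N (m - 1)) + (((m - 1) ^ 2 + (m - 1)) / 2 : ℚ) • N (m - 1))
    + (3 * euler (N (m - 2)) + (((m - 2) ^ 2 + (m - 2)) / 2 : ℚ) • N (m - 2))
    + (m : ℚ) • N (m - 1) - (m - 2 : ℚ) • N (m - 2)

theorem locFin_heatFamily {N : ℤ → ℚ⟦X⟧} (hN : LocFin N) : LocFin (heatFamily N) := by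
  have h (k : ℤ) := hN.comp_injective (sub_left_injective (b := k))
  have h' (k : ℤ) : LocFin fun m : ℤ => 3 * euler (N (m - k)) +
      (((m - k) ^ 2 + (m - k)) / 2 : ℚ) • N (m - k) :=
    ((h k).euler.mul_left fun _ => 3).add ((h k).smul _)
  have := (((((h' 0).sub ((h' 1).mul_left fun _ => 2)).add (h' 2)).add
    ((h 1).smul fun m => (m : ℚ))).sub ((h 2).smul fun m => (m - 2 : ℚ)))
  change LocFin fun m => heatFamily N m
  simpa [heatFamily] using this

/-- Summation by parts: the shifts of the family are transferred to the weights, so that the moments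
of the heat image become polynomial moments of the rank series and of its derivative. About the
centre 1 the second difference on the weights is symmetric. -/
theorem mom_heatFamily {N : ℤ → ℚ⟦X⟧} (hN : LocFin N) (r : ℕ) :
    mom 1 r (heatFamily N) =
      integ hN (fun m : ℤ => (m ^ 2 + m) / 2 * ((m - 1 : ℚ) ^ r - 2 * m ^ r + (m + 1) ^ r) +
        m ^ (r + 1) - m * (m + 1) ^ r + m ^ r) +
      3 * euler (integ hN (fun m : ℤ => (m - 1 : ℚ) ^ r - 2 * m ^ r + (m + 1) ^ r)) := by
  have h (k : ℤ) := hN.comp_injective (sub_left_injective (b := k))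
  have sh : ∀ (k : ℤ) (f : ℤ → ℚ), ∑' m : ℤ, f (m - k) • N (m - k) = integ hN f := by
    intro k f
    rw [← (Equiv.addRight k).tsum_eq, integ_apply]
    simp
  have she : ∀ (k : ℤ) (f : ℤ → ℚ), ∑' m : ℤ, f (m - k) • euler (N (m - k)) =
      euler (integ hN f) := by
    intro k f
    rw [← sh k f, euler_tsum ((h k).smul fun m => f (m - k))]
    simp only [Derivation.map_smul]
  have s1 : ∀ (k : ℤ) (f : ℤ → ℚ), Summable fun m : ℤ => f (m - k) • N (m - k) := fun k f =>
    ((h k).smul fun m => f (m - k)).summable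
  have s2 : ∀ (k : ℤ) (f : ℤ → ℚ), Summable fun m : ℤ => f (m - k) • euler (N (m - k)) :=
    fun k f => ((h k).euler.smul fun m => f (m - k)).summable
  -- `f0`, `f2`, `f4` are the weights of N and `f1`, `f3`, `f5` those of its derivative at shifts 0,
  -- 1, 2, expressed in the shifted variable. They are kept opaque so that the sums can be
  -- manipulated before the weights are compared.
  obtain ⟨f0, hf0⟩ : ∃ f : ℤ → ℚ, f = fun m : ℤ => (m ^ 2 + m) / 2 * (m - 1 : ℚ) ^ r := ⟨_, rfl⟩
  obtain ⟨f1, hf1⟩ : ∃ f : ℤ → ℚ, f = fun m : ℤ => 3 * (m - 1 : ℚ) ^ r := ⟨_, rfl⟩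
  obtain ⟨f2, hf2⟩ : ∃ f : ℤ → ℚ, f = fun m : ℤ => -(m ^ 2 + m) * (m : ℚ) ^ r + (m + 1) * m ^ r := ⟨_, rfl⟩
  obtain ⟨f3, hf3⟩ : ∃ f : ℤ → ℚ, f = fun m : ℤ => -6 * (m : ℚ) ^ r := ⟨_, rfl⟩
  obtain ⟨f4, hf4⟩ : ∃ f : ℤ → ℚ, f = fun m : ℤ => ((m ^ 2 + m) / 2 - m) * (m + 1 : ℚ) ^ r := ⟨_, rfl⟩
  obtain ⟨f5, hf5⟩ : ∃ f : ℤ → ℚ, f = fun m : ℤ => 3 * (m + 1 : ℚ) ^ r := ⟨_, rfl⟩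
  have e : ∀ m : ℤ, ((m : ℚ) - 1) ^ r • heatFamily N m =
      f0 (m - 0) • N (m - 0)
      + f1 (m - 0) • euler (N (m - 0))
      + f2 (m - 1) • N (m - 1)
      + f3 (m - 1) • euler (N (m - 1))
      + f4 (m - 2) • N (m - 2)
      + f5 (m - 2) • euler (N (m - 2)) := by
    intro m
    simp only [hf0, hf1, hf2, hf3, hf4, hf5, heatFamily, smul_eq_C_mul, sub_zero]
    push_cast
    simp only [map_mul, map_add, map_sub, map_neg, map_pow, div_eq_mul_inv, map_one, map_ofNat]
    have h6 : (C (2⁻¹ : ℚ) : ℚ⟦X⟧) * 2 = 1 := by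
      rw [← map_ofNat (C (R := ℚ)) 2, ← map_mul]; norm_num
    have h7 : (C (m : ℚ) - 2 + 1 : ℚ⟦X⟧) = C (m : ℚ) - 1 := by ring
    rw [h7]
    linear_combination ((C (m : ℚ) - 1) ^ r * N (m - 1) *
      -(C (m : ℚ) ^ 2 - 2 * C (m : ℚ) + 1 + C (m : ℚ) - 1)) * h6
  rw [mom, tsum_congr e, Summable.tsum_add _ (s2 2 f5), Summable.tsum_add _ (s1 2 f4),
    Summable.tsum_add _ (s2 1 f3), Summable.tsum_add _ (s1 1 f2),
    Summable.tsum_add (s1 0 f0) (s2 0 f1)]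
  rotate_left
  · exact (s1 0 f0).add (s2 0 f1)
  · exact ((s1 0 f0).add (s2 0 f1)).add (s1 1 f2)
  · exact (((s1 0 f0).add (s2 0 f1)).add (s1 1 f2)).add (s2 1 f3)
  · exact ((((s1 0 f0).add (s2 0 f1)).add (s1 1 f2)).add (s2 1 f3)).add (s1 2 f4)
  simp only [sh, she]
  have h3 : ∀ a : ℚ⟦X⟧, 3 * euler a = euler ((3 : ℚ) • a) := fun a => by
    rw [Derivation.map_smul, smul_eq_C_mul, map_ofNat]
  rw [h3, ← map_smul]
  have t : ∀ a b c d e f : ℚ⟦X⟧, a + b + c + d + e + f = (a + c + e) + (b + d + f) :=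
    fun _ _ _ _ _ _ => by ring
  rw [t, ← map_add, ← map_add, ← map_add, ← map_add, ← map_add, ← map_add]
  congr 1
  · congr 1
    funext m
    simp only [hf0, hf2, hf4, Pi.add_apply]
    ring
  · congr 2
    funext m
    simp only [hf1, hf3, hf5, Pi.add_apply, Pi.smul_apply, smul_eq_mul]
    ring

/-- Θ vanishes at t = 0, so Θ^3 is divisible by t^3. -/
theorem mom_thetaCube_eq_zero {r : ℕ} (hr : r < 3) : mom (3 / 2) r thetaCube = 0 := by
  have h : egf (3 / 2) thetaCube = egf (1 / 2) theta ^ 3 := by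
    rw [thetaCube, show (3 / 2 : ℚ) = 1 / 2 + (1 / 2 + 1 / 2) by norm_num,
      egf_conv locFin_theta (locFin_theta.conv locFin_theta), egf_conv locFin_theta locFin_theta]
    ring
  have h1 : (X : ℚ⟦X⟧⟦X⟧) ∣ egf (1 / 2) theta := by
    rw [X_dvd_iff, ← coeff_zero_eq_constantCoeff_apply, coeff_egf]
    change _ • thetaMom 0 = 0
    rw [thetaMom_even (by decide), smul_zero]
  have h2 := pow_dvd_pow_of_dvd h1 3
  rw [← h, X_pow_dvd_iff] at h2
  have h3 := h2 r hr
  rw [coeff_egf, smul_eq_zero] at h3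
  exact h3.resolve_left (inv_ne_zero (Nat.cast_ne_zero.2 r.factorial_ne_zero))

/-- A convolution with a polynomial of degree two in the index involves only the moments of order at
most two, and these vanish for the theta cube. This disposes of the inhomogeneity in the rank
recurrence. -/
theorem conv_thetaCube_quadratic (p : ℚ⟦X⟧) (m : ℤ) :
    conv thetaCube (fun m => 3 * euler p + ((m * (m + 1) / 2 : ℚ)) • p) m = 0 := by
  set J := locFin_thetaCube
  have h0 := mom_thetaCube_eq_zero (show 0 < 3 by norm_num)
  have h1 := mom_thetaCube_eq_zero (show 1 < 3 by norm_num)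
  have h2 := mom_thetaCube_eq_zero (show 2 < 3 by norm_num)
  rw [mom_eq_integ J] at h0 h1 h2
  have e : (fun a : ℤ => ((m - a) * (m - a + 1) / 2 : ℚ)) =
      (1 / 2 : ℚ) • (fun a : ℤ => ((a : ℚ) - 3 / 2) ^ 2)
      + (1 - m : ℚ) • (fun a : ℤ => ((a : ℚ) - 3 / 2) ^ 1)
      + (m ^ 2 / 2 - m + 3 / 8 : ℚ) • (fun a : ℤ => ((a : ℚ) - 3 / 2) ^ 0) := by
    funext a
    simp only [Pi.add_apply, Pi.smul_apply, smul_eq_mul]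
    ring
  have h3 : integ J (fun a : ℤ => ((m - a) * (m - a + 1) / 2 : ℚ)) = 0 := by
    rw [e, map_add, map_add, map_smul, map_smul, map_smul, h0, h1, h2]
    simp
  have h4 : ∀ a, thetaCube a * (3 * euler p + (((m - a : ℤ) * ((m - a : ℤ) + 1) / 2 : ℚ)) • p) =
      ((a : ℚ) - 3 / 2) ^ 0 • thetaCube a * (3 * euler p) +
      ((m - a) * (m - a + 1) / 2 : ℚ) • thetaCube a * p := by
    intro a
    push_cast
    rw [pow_zero, one_smul, smul_eq_C_mul, smul_eq_C_mul]
    ring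
  rw [conv, tsum_congr h4, ((J.smul _).mul_right _).summable.tsum_add
    ((J.smul _).mul_right _).summable, (J.smul _).summable.tsum_mul_right,
    (J.smul _).summable.tsum_mul_right]
  change integ J _ * _ + integ J _ * _ = 0
  rw [h0, h3, zero_mul, zero_mul, add_zero]

/-- The rank generating function, cubed theta and the heat operator: the rank-crank differential
equation before the comparison with the crank. -/
theorem egf_theta_cube_mul_heatFamily {B : ℤ → ℚ⟦X⟧} {P : ℚ⟦X⟧}
    (hN : LocFin fun m => B m - B (m - 1))
    (hB : ∀ m, let h : ℤ → ℚ⟦X⟧ := fun m => 3 * euler (B m) + ((m * (m + 1) / 2 : ℚ)) • B m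
      qpow (-(m + 2)) * h m + qpow (m + 2) * h (m + 3) =
        qpow (-(m + 2)) * (3 * euler P + ((m * (m + 1) / 2 : ℚ)) • P)) :
    ∃ κ, egf (1 / 2) theta ^ 3 * egf 1 (heatFamily fun m => B m - B (m - 1)) =
      C κ * sinhSeries ^ 3 := by
  set h : ℤ → ℚ⟦X⟧ := fun m => 3 * euler (B m) + ((m * (m + 1) / 2 : ℚ)) • B m with hh
  set N : ℤ → ℚ⟦X⟧ := fun m => B m - B (m - 1) with hNdef
  -- The third difference, i.e. multiplication by (1 - z)^3. The family is phrased through N because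
  -- the cumulative series B(m) need not be locally finite: it tends to P as m grows, so it has no
  -- moments of its own.
  have hG : ∀ m, heatFamily N m = h m - 3 * h (m - 1) + 3 * h (m - 2) - h (m - 3) := by
    intro m
    simp only [heatFamily, hNdef, hh, smul_eq_C_mul, map_sub, sub_sub]
    push_cast
    simp only [map_mul, map_add, map_sub, map_pow, div_eq_mul_inv, map_one, map_ofNat]
    have h6 : (C (2⁻¹ : ℚ) : ℚ⟦X⟧) * 2 = 1 := by
      rw [← map_ofNat (C (R := ℚ)) 2, ← map_mul]; norm_num
    linear_combination (-C (m : ℚ) * (B (m - 1) - B (m - 2)) +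
      (C (m : ℚ) - 2) * (B (m - 2) - B (m - 3))) * h6
  have hs : ∀ f : ℤ → ℚ⟦X⟧, Summable fun a => thetaCube a * f a := fun f =>
    (locFin_thetaCube.mul_right _).summable
  -- The surviving index is 3 - 2 = 1: the quasi-period of the theta cube minus the offset in the
  -- exponent m + 2.
  have hK : ∀ m, m ≠ 1 → conv thetaCube h m = 0 := fun m hm =>
    conv_eq_zero_of_recurrence (s := 2) locFin_thetaCube quasiPeriodic_thetaCube hB
      (conv_thetaCube_quadratic P) (by norm_num; exact hm)
  have hc : ∀ m, conv thetaCube (heatFamily N) m = conv thetaCube h m -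
      3 * conv thetaCube h (m - 1) + 3 * conv thetaCube h (m - 2) - conv thetaCube h (m - 3) := by
    intro m
    simp only [conv]
    rw [← (hs _).tsum_mul_left, ← (hs _).tsum_mul_left, ← (hs _).tsum_sub ((hs _).mul_left _),
      ← ((hs _).sub ((hs _).mul_left _)).tsum_add ((hs _).mul_left _),
      ← (((hs _).sub ((hs _).mul_left _)).add ((hs _).mul_left _)).tsum_sub (hs _)]
    refine tsum_congr fun a => ?_
    rw [hG, sub_right_comm m a 1, sub_right_comm m a 2, sub_right_comm m a 3]
    ring
  have hcube : egf (3 / 2) thetaCube = egf (1 / 2) theta ^ 3 := by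
    rw [thetaCube, show (3 / 2 : ℚ) = 1 / 2 + (1 / 2 + 1 / 2) by norm_num,
      egf_conv locFin_theta (locFin_theta.conv locFin_theta), egf_conv locFin_theta locFin_theta]
    ring
  -- Convolving the third difference with the theta cube gives coefficients K, -3K, 3K, -K at 1, 2,
  -- 3, 4. About the centre 3/2 + 1 = 5/2 this is -K times the cube of 2 sinh(t/2).
  refine ⟨-conv thetaCube h 1, ?_⟩
  rw [← hcube, ← egf_conv locFin_thetaCube (locFin_heatFamily hN),
    egf_of_support {1, 2, 3, 4}]
  · have e3 : sinhSeries ^ 3 = expSeries (3 / 2) - 3 * expSeries (1 / 2) +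
        3 * expSeries (-1 / 2) - expSeries (-3 / 2) := by
      have : ∀ a b : ℚ⟦X⟧⟦X⟧, (a - b) ^ 3 =
        a * a * a - 3 * (a * a * b) + 3 * (a * b * b) - b * b * b :=
        fun a b => by ring
      rw [sinhSeries, this]
      simp only [expSeries_mul]
      norm_num
    rw [e3, Finset.sum_insert (by decide), Finset.sum_insert (by decide),
      Finset.sum_pair (by decide)]
    simp only [hc]
    norm_num [hK, map_ofNat]
    ring
  · intro m hm
    simp only [Finset.mem_insert, Finset.mem_singleton, not_or] at hm
    rw [hc, hK m (by omega), hK (m - 1) (by omega), hK (m - 2) (by omega), hK (m - 3) (by omega)]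
    simp

/-- The rank-crank differential equation, in terms of moment generating functions. -/
theorem rank_crank_equation {B c : ℤ → ℚ⟦X⟧} {P : ℚ⟦X⟧} (hP : P ≠ 0)
    (hN : LocFin fun m => B m - B (m - 1)) (hN0 : mom 0 0 (fun m => B m - B (m - 1)) = P)
    (hB : ∀ m, let h : ℤ → ℚ⟦X⟧ := fun m => 3 * euler (B m) + ((m * (m + 1) / 2 : ℚ)) • B m
      qpow (-(m + 2)) * h m + qpow (m + 2) * h (m + 3) =
        qpow (-(m + 2)) * (3 * euler P + ((m * (m + 1) / 2 : ℚ)) • P))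
    (hf : LocFin c) (hc0 : mom 0 0 c = P)
    (hc : ∀ m, qpow (-m) * c m - qpow m * c m =
      X * (qpow (-m) * c (m - 1)) - X * (qpow m * c (m + 1))) :
    C (P ^ 2) * egf 1 (heatFamily fun m => B m - B (m - 1)) = egf 0 c ^ 3 := by
  obtain ⟨κ, hκ⟩ := egf_theta_cube_mul_heatFamily hN hB
  have h1 := egf_crank_mul_theta hf hc
  rw [hc0] at h1
  set T := egf (1 / 2) theta
  set Y := egf 1 (heatFamily fun m => B m - B (m - 1)) with hY
  set K := egf 0 c with hK
  -- Rank and crank are compared by eliminating the cube of 2 sinh(t/2) and cancelling Θ^3.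
  have h2 : C ((P * thetaMom 1) ^ 3) * Y = C κ * K ^ 3 := by
    refine mul_left_cancel₀ (pow_ne_zero 3 egf_theta_ne_zero) ?_
    change T ^ 3 * _ = T ^ 3 * _
    rw [map_pow]
    calc T ^ 3 * (C (P * thetaMom 1) ^ 3 * Y) = C (P * thetaMom 1) ^ 3 * (T ^ 3 * Y) := by ring
      _ = C κ * (C (P * thetaMom 1) * sinhSeries) ^ 3 := by rw [hκ]; ring
      _ = T ^ 3 * (C κ * K ^ 3) := by rw [← h1]; ring
  have hY0 : constantCoeff Y = P := by
    rw [hY, ← coeff_zero_eq_constantCoeff_apply, coeff_egf, mom_heatFamily hN, ← hN0,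
      mom_eq_integ hN]
    have : (fun m : ℤ => (m - 1 : ℚ) ^ 0 - 2 * m ^ 0 + (m + 1) ^ 0) = 0 := by
      funext m; norm_num
    rw [this, map_zero, map_zero, mul_zero, add_zero]
    norm_num
  have hK0 : constantCoeff K = P := by
    rw [hK, ← coeff_zero_eq_constantCoeff_apply, coeff_egf, ← hc0]
    simp
  have hθ : thetaMom 1 ≠ 0 := fun h => by
    have := constantCoeff_thetaMom_one
    rw [h] at this
    norm_num at this
  -- The constant is fixed at t = 0, where both Y and K equal P.
  have h3 : κ = P * thetaMom 1 ^ 3 := by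
    have := congrArg constantCoeff h2
    simp only [map_mul, map_pow, constantCoeff_C, hY0, hK0] at this
    refine mul_right_cancel₀ (pow_ne_zero 3 hP) ?_
    linear_combination -this
  have h4 : C (P * thetaMom 1 ^ 3) ≠ (0 : ℚ⟦X⟧⟦X⟧) := fun h =>
    mul_ne_zero hP (pow_ne_zero 3 hθ) (by simpa using congrArg constantCoeff h)
  refine mul_left_cancel₀ h4 ?_
  rw [h3] at h2
  rw [← h2, ← mul_assoc, ← map_mul]
  congr 2
  ring

/-! ### Hirota's bilinear equation for the theta series. -/

/-- Weighted self-convolutions of the theta coefficients, as in Hirota's bilinear derivatives. -/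
noncomputable def thetaSq (k : ℕ) (m : ℤ) : ℚ⟦X⟧ :=
  ∑' a : ℤ, ((2 * a - m : ℚ) ^ k) • (theta a * theta (m - a))

theorem locFin_thetaSq_summand (k : ℕ) (m : ℤ) :
    LocFin fun a : ℤ => ((2 * a - m : ℚ) ^ k) • (theta a * theta (m - a)) :=
  (locFin_theta.mul_right _).smul _

/-- Shifting both indices by one preserves their difference, hence the weight, and the two sign
changes cancel. So the whole family is determined by its members at m = 0 and m = 1, whatever k is.
-/
theorem thetaSq_add_two (k : ℕ) (m : ℤ) :
    qpow (-m) * thetaSq k (m + 2) = qpow m * thetaSq k m := by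
  have hs := (locFin_thetaSq_summand k (m + 2)).comp_injective (add_left_injective (1 : ℤ))
  rw [thetaSq, thetaSq, ← (Equiv.addRight (1 : ℤ)).tsum_eq]
  simp only [Equiv.coe_addRight]
  rw [← hs.summable.tsum_mul_left, ← (locFin_thetaSq_summand k m).summable.tsum_mul_left]
  refine tsum_congr fun a => ?_
  have h := quasiPeriodic_theta.mul quasiPeriodic_theta a (m - a)
  rw [add_sub_cancel, neg_one_mul, neg_neg, one_mul, show m - a + 1 = m + 2 - (a + 1) by ring] at h
  rw [mul_smul_comm, h, mul_smul_comm]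
  congr 2
  push_cast
  ring

theorem coeff_zero_theta (a : ℤ) :
    constantCoeff (theta a) = if a = 0 then 1 else if a = 1 then -1 else 0 := by
  split_ifs with h0 h1
  · simp [h0, theta]
  · simp [h1, theta]
  · have h1 := two_mul_tri a
    have h2 : 0 < a * (a - 1) := by
      rcases lt_or_gt_of_ne h0 with h3 | h3
      · nlinarith
      · have : 1 < a := by omega
        nlinarith
    have h3 : (a * (a - 1) / 2).toNat ≠ 0 := by omega
    simp [theta, show 0 < a * (a - 1) / 2 by omega]

theorem coeff_zero_thetaSq (k : ℕ) (m : ℤ) : constantCoeff (thetaSq k m) =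
    (-m : ℚ) ^ k * constantCoeff (theta m) -
      (2 - m : ℚ) ^ k * constantCoeff (theta (m - 1)) := by
  rw [thetaSq, ← coeff_zero_eq_constantCoeff_apply, (locFin_thetaSq_summand k m).coeff_tsum,
    finsum_eq_sum_of_support_subset (s := {0, 1})]
  · rw [Finset.sum_pair zero_ne_one]
    simp only [map_smul]
    simp only [coeff_zero_eq_constantCoeff_apply, map_mul, coeff_zero_theta 0, coeff_zero_theta 1,
      smul_eq_mul]
    norm_num
    ring
  · intro a ha
    by_contra h
    apply ha
    simp only [Finset.coe_insert, Finset.coe_singleton, Set.mem_insert_iff,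
      Set.mem_singleton_iff, not_or] at h
    change coeff 0 (_ • _) = 0
    rw [map_smul, coeff_zero_eq_constantCoeff_apply, map_mul]
    simp [coeff_zero_theta a, h.1, h.2]

/-- Three solutions of a recurrence whose solutions are determined by two initial values are
linearly dependent. The coefficients can be taken in the power series ring because the relevant
determinant is a unit. -/
theorem exists_thetaSq_relation : ∃ α β : ℚ⟦X⟧, ∀ m,
    thetaSq 4 m = α * thetaSq 2 m + β * thetaSq 0 m := by
  -- The Cramer determinant of the initial values for k = 0 and k = 2; its constant term is -2.
  set d := thetaSq 0 0 * thetaSq 2 1 - thetaSq 0 1 * thetaSq 2 0 with hd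
  have hd0 : constantCoeff d ≠ 0 := by
    rw [hd]
    simp only [map_sub, map_mul, coeff_zero_thetaSq, coeff_zero_theta]
    norm_num
  have hdd := PowerSeries.mul_inv_cancel d hd0
  set α := (thetaSq 0 0 * thetaSq 4 1 - thetaSq 0 1 * thetaSq 4 0) * d⁻¹ with hα
  set β := (thetaSq 4 0 * thetaSq 2 1 - thetaSq 4 1 * thetaSq 2 0) * d⁻¹ with hβ
  refine ⟨α, β, ?_⟩
  set U : ℤ → ℚ⟦X⟧ := fun m => thetaSq 4 m - (α * thetaSq 2 m + β * thetaSq 0 m) with hU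
  have hrec : ∀ m, qpow (-m) * U (m + 2) = qpow m * U m := by
    intro m
    simp only [hU]
    linear_combination thetaSq_add_two 4 m - α * thetaSq_add_two 2 m - β * thetaSq_add_two 0 m
  have h0 : U 0 = 0 := by
    simp only [hU, hα, hβ]
    linear_combination -thetaSq 4 0 * hdd + thetaSq 4 0 * d⁻¹ * hd
  have h1 : U 1 = 0 := by
    simp only [hU, hα, hβ]
    linear_combination -thetaSq 4 1 * hdd + thetaSq 4 1 * d⁻¹ * hd
  have hup : ∀ m, U m = 0 → U (m + 2) = 0 := fun m hm => by
    have := hrec m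
    rw [hm, mul_zero] at this
    exact (mul_eq_zero.1 this).resolve_left (qpow_ne_zero _)
  have hdown : ∀ m, U m = 0 → U (m - 2) = 0 := fun m hm => by
    have := hrec (m - 2)
    rw [sub_add_cancel, hm, mul_zero] at this
    exact (mul_eq_zero.1 this.symm).resolve_left (qpow_ne_zero _)
  have h : ∀ n : ℤ, U n = 0 ∧ U (n + 1) = 0 := by
    intro n
    induction n using Int.induction_on with
    | zero => exact ⟨h0, h1⟩
    | succ n ih => exact ⟨ih.2, by rw [add_assoc]; exact hup _ ih.1⟩
    | pred n ih =>
      refine ⟨?_, by rw [sub_add_cancel]; exact ih.1⟩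
      have := hdown _ ih.2
      rwa [show -(n : ℤ) + 1 - 2 = -n - 1 by ring] at this
  exact fun m => sub_eq_zero.1 (h m).1

theorem locFin_theta_mul_theta : LocFin fun p : ℤ × ℤ => theta p.1 * theta p.2 :=
  locFin_theta.prod_mul locFin_theta

/-- The monomial weight `(a - 1/2) ^ r (b - 1/2) ^ s` on pairs of integers. -/
def pairMonomial (r s : ℕ) (p : ℤ × ℤ) : ℚ := (p.1 - 1 / 2 : ℚ) ^ r * (p.2 - 1 / 2 : ℚ) ^ s

/-- With x = a - 1/2 and y = b - 1/2 the weights of the bilinear equation are polynomials in x + y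
and x - y. Expanding them in monomials turns each integral into a quadratic form in theta moments.
-/
theorem integ_pairMonomial (r s : ℕ) :
    integ locFin_theta_mul_theta (pairMonomial r s) = thetaMom r * thetaMom s := by
  have h1 := locFin_theta.smul fun a : ℤ => ((a : ℚ) - 1 / 2) ^ r
  have h2 := locFin_theta.smul fun a : ℤ => ((a : ℚ) - 1 / 2) ^ s
  rw [thetaMom, thetaMom, mom, mom, h1.summable.tsum_mul_tsum h2.summable
    (h1.prod_mul h2).summable, integ_apply]
  refine tsum_congr fun p => ?_
  rw [pairMonomial, smul_mul_smul_comm]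

theorem tsum_thetaSq (k r : ℕ) : ∑' m : ℤ, ((m - 1 : ℚ) ^ r) • thetaSq k m =
    integ locFin_theta_mul_theta fun p => (p.1 + p.2 - 1 : ℚ) ^ r * (p.1 - p.2 : ℚ) ^ k := by
  have h : LocFin fun p : ℤ × ℤ =>
      ((p.1 + p.2 - 1 : ℚ) ^ r * (p.1 - p.2 : ℚ) ^ k) • (theta p.1 * theta p.2) :=
    locFin_theta_mul_theta.smul _
  have h' := h.comp_injective shear.symm.injective
  rw [integ_apply, ← shear.symm.tsum_eq, h'.summable.tsum_prod']
  · refine tsum_congr fun m => ?_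
    rw [thetaSq, ← (locFin_thetaSq_summand k m).summable.tsum_const_smul]
    refine tsum_congr fun a => ?_
    simp only [shear, Equiv.coe_fn_symm_mk, smul_smul]
    congr 2
    · push_cast; ring
    · push_cast; ring
  · intro m
    exact (h'.comp_injective (Prod.mk_right_injective m)).summable

theorem locFin_thetaSq (k : ℕ) : LocFin (thetaSq k) := by
  have h : LocFin fun p : ℤ × ℤ => ((p.1 - p.2 : ℚ) ^ k) • (theta p.1 * theta p.2) :=
    locFin_theta_mul_theta.smul _
  have h' := h.comp_injective shear.symm.injective
  intro n
  refine ((h' n).image Prod.fst).subset fun m hm => ?_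
  by_contra h'
  apply hm
  have h2 : ∀ a : ℤ, coeff n (((2 * a - m : ℚ) ^ k) • (theta a * theta (m - a))) = 0 := by
    intro a
    by_contra h3
    refine h' ⟨(m, a), ?_, rfl⟩
    simp only [shear, Equiv.coe_fn_symm_mk, Set.mem_ofPred_eq]
    push_cast
    rwa [show (a : ℚ) - (m - a) = 2 * a - m by ring]
  rw [thetaSq, (locFin_thetaSq_summand k m).coeff_tsum]
  simp [h2]

/-- Hirota's bilinear equation for the theta series, integrated against the power `r`. -/
theorem exists_integ_relation : ∃ α β : ℚ⟦X⟧, ∀ r : ℕ,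
    integ locFin_theta_mul_theta (fun p => (p.1 + p.2 - 1 : ℚ) ^ r * (p.1 - p.2 : ℚ) ^ 4) =
      α * integ locFin_theta_mul_theta (fun p => (p.1 + p.2 - 1 : ℚ) ^ r * (p.1 - p.2 : ℚ) ^ 2) +
      β * integ locFin_theta_mul_theta (fun p => (p.1 + p.2 - 1 : ℚ) ^ r * (p.1 - p.2 : ℚ) ^ 0) := by
  obtain ⟨α, β, h⟩ := exists_thetaSq_relation
  refine ⟨α, β, fun r => ?_⟩
  have hs : ∀ k, LocFin fun m : ℤ => ((m - 1 : ℚ) ^ r) • thetaSq k m := fun k =>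
    (locFin_thetaSq k).smul _
  rw [← tsum_thetaSq, ← tsum_thetaSq, ← tsum_thetaSq, ← (hs 2).summable.tsum_mul_left,
    ← (hs 0).summable.tsum_mul_left,
    ← ((hs 2).summable.mul_left _).tsum_add ((hs 0).summable.mul_left _)]
  refine tsum_congr fun m => ?_
  rw [h, smul_add, mul_smul_comm, mul_smul_comm]

/-! ### Generating functions of sets of partitions. -/

/-- The generating function of a set of partitions, given as multisets of positive integers. -/
noncomputable def gf (S : Set (Multiset ℕ)) : ℚ⟦X⟧ := ∑' s : S, X ^ s.1.sum

/-- Multisets of positive integers. -/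
def pos : Set (Multiset ℕ) := {s | 0 ∉ s}

open Classical in
/-- The partitions of `n` that lie in `S`. -/
noncomputable def fiber (S : Set (Multiset ℕ)) (n : ℕ) : Finset S :=
  (Finset.univ : Finset {p : n.Partition // p.parts ∈ S}).map
    ⟨fun p => ⟨p.1.parts, p.2⟩, fun p p' h => by
      ext1
      exact Nat.Partition.ext (congrArg Subtype.val h)⟩

theorem mem_fiber {S : Set (Multiset ℕ)} (hS : S ⊆ pos) {n : ℕ} {s : S} (h : s.1.sum = n) :
    s ∈ fiber S n := by
  simp only [fiber, Finset.mem_map, Finset.mem_univ, true_and]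
  exact ⟨⟨⟨s.1, fun {i} hi => Nat.pos_of_ne_zero fun h0 => hS s.2 (h0 ▸ hi), h⟩, s.2⟩, rfl⟩

theorem locFin_X_pow_sum {S : Set (Multiset ℕ)} (hS : S ⊆ pos) :
    LocFin fun s : S => (X : ℚ⟦X⟧) ^ s.1.sum := fun n => by
  refine (fiber S n).finite_toSet.subset fun s hs => mem_fiber hS ?_
  by_contra h
  exact hs (by rw [coeff_X_pow, if_neg fun h' => h h'.symm])

open Classical in
theorem coeff_gf {S : Set (Multiset ℕ)} (hS : S ⊆ pos) (n : ℕ) :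
    coeff n (gf S) = (Finset.univ.filter fun p : n.Partition => p.parts ∈ S).card := by
  rw [gf, (locFin_X_pow_sum hS).coeff_tsum, finsum_eq_sum_of_support_subset (s := fiber S n)]
  · rw [fiber, Finset.sum_map, ← Fintype.card_subtype]
    refine (Finset.sum_congr rfl (g := fun _ => (1 : ℚ)) fun p _ => ?_).trans (by simp)
    change coeff n (X ^ p.1.parts.sum) = 1
    rw [p.1.parts_sum, coeff_X_pow_self]
  · intro s hs
    refine mem_fiber hS ?_
    by_contra h
    exact hs (by simp only [coeff_X_pow, if_neg fun h' => h (Eq.symm h')])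

theorem gf_union {S T : Set (Multiset ℕ)} (hS : S ⊆ pos) (hT : T ⊆ pos) (h : Disjoint S T) :
    gf (S ∪ T) = gf S + gf T :=
  Summable.tsum_union_disjoint (f := fun s : Multiset ℕ => (X : ℚ⟦X⟧) ^ s.sum) h
    (locFin_X_pow_sum hS).summable (locFin_X_pow_sum hT).summable

theorem gf_singleton_zero : gf {0} = 1 := by
  rw [gf, tsum_fintype]
  simp

theorem gf_empty : gf ∅ = 0 := by
  rw [gf, tsum_empty]

theorem gf_of_bijOn {ι : Type*} {I : Set ι} {S : Set (Multiset ℕ)} {φ : ι → Multiset ℕ}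
    (h : Set.BijOn φ I S) : gf S = ∑' i : I, X ^ (φ i).sum := by
  rw [gf, ← (h.equiv φ).tsum_eq]
  rfl

theorem gf_of_bijOn_prod {S T U : Set (Multiset ℕ)} (hS : S ⊆ pos) (hT : T ⊆ pos) (c : ℕ)
    {φ : Multiset ℕ × Multiset ℕ → Multiset ℕ} (h : Set.BijOn φ (S ×ˢ T) U)
    (hφ : ∀ p ∈ S ×ˢ T, (φ p).sum = c + p.1.sum + p.2.sum) :
    gf U = X ^ c * gf S * gf T := by
  rw [gf_of_bijOn h, ← (Equiv.Set.prod S T).symm.tsum_eq, mul_assoc, gf, gf,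
    (locFin_X_pow_sum hS).summable.tsum_mul_tsum (locFin_X_pow_sum hT).summable
      ((locFin_X_pow_sum hS).prod_mul (locFin_X_pow_sum hT)).summable,
    ← ((locFin_X_pow_sum hS).prod_mul (locFin_X_pow_sum hT)).summable.tsum_mul_left]
  refine tsum_congr fun p => ?_
  rw [hφ _ ((Equiv.Set.prod S T).symm p).2, pow_add, pow_add, mul_assoc]
  rfl

theorem gf_of_bijOn_shift {S U : Set (Multiset ℕ)} (hS : S ⊆ pos) (c : ℕ)
    {φ : Multiset ℕ → Multiset ℕ} (h : Set.BijOn φ S U)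
    (hφ : ∀ s ∈ S, (φ s).sum = c + s.sum) : gf U = X ^ c * gf S := by
  rw [gf_of_bijOn h, gf, ← (locFin_X_pow_sum hS).summable.tsum_mul_left]
  exact tsum_congr fun s => by rw [hφ _ s.2, pow_add]

/-! ### Dyson's symmetry and the recurrence for the rank. -/

/-- Remove `d` from each part and drop the zeros. -/
def lower (d : ℕ) (s : Multiset ℕ) : Multiset ℕ := (s.map fun x => x - d).filter (· ≠ 0)

/-- Add `d` to each part, after padding with zeros to `l` parts. -/
def raise (d l : ℕ) (s : Multiset ℕ) : Multiset ℕ :=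
  s.map (fun x => x + d) + Multiset.replicate (l - s.card) d

theorem card_raise {d l : ℕ} {s : Multiset ℕ} (h : s.card ≤ l) : (raise d l s).card = l := by
  simp [raise, h]

theorem sum_raise {d l : ℕ} {s : Multiset ℕ} (h : s.card ≤ l) :
    (raise d l s).sum = d * l + s.sum := by
  obtain ⟨k, rfl⟩ := Nat.exists_eq_add_of_le h
  simp [raise, Multiset.sum_map_add]
  ring

theorem mem_raise {d l : ℕ} {s : Multiset ℕ} {x : ℕ} (hx : x ∈ raise d l s) :
    x = d ∨ ∃ y ∈ s, x = y + d := by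
  rcases Multiset.mem_add.1 hx with h | h
  · obtain ⟨y, hy, rfl⟩ := Multiset.mem_map.1 h
    exact Or.inr ⟨y, hy, rfl⟩
  · exact Or.inl (Multiset.eq_of_mem_replicate h)

theorem lower_raise {d l : ℕ} {s : Multiset ℕ} (hs : s ∈ pos) : lower d (raise d l s) = s := by
  have h1 : ∀ n, Multiset.filter (fun x => x ≠ 0) (Multiset.replicate n 0) = 0 := fun n =>
    Multiset.filter_eq_nil.2 fun a ha => by simp [Multiset.eq_of_mem_replicate ha]
  have h2 : Multiset.filter (fun x => x ≠ 0) s = s :=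
    Multiset.filter_eq_self.2 fun a ha h0 => hs (h0 ▸ ha)
  simp only [lower, raise, Multiset.map_add, Multiset.filter_add, Multiset.map_map,
    Function.comp_def, Nat.add_sub_cancel, Multiset.map_id', Multiset.map_replicate,
    Nat.sub_self, h1, h2, add_zero]

theorem card_lower_le (d : ℕ) (s : Multiset ℕ) : (lower d s).card ≤ s.card :=
  (Multiset.card_le_card (Multiset.filter_le _ _)).trans (by simp)

theorem lower_mem_pos (d : ℕ) (s : Multiset ℕ) : lower d s ∈ pos := by
  simp [pos, lower]

theorem raise_lower {d : ℕ} {s : Multiset ℕ} (hs : ∀ x ∈ s, d ≤ x) :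
    raise d s.card (lower d s) = s := by
  induction s using Multiset.induction_on with
  | empty => simp [raise, lower]
  | cons a s ih =>
    have ih := ih fun x hx => hs x (Multiset.mem_cons_of_mem hx)
    have ha := hs a (Multiset.mem_cons_self a s)
    have hc := card_lower_le d s
    conv_rhs => rw [← ih]
    rcases ha.eq_or_lt with h | h
    · have h1 : lower d (a ::ₘ s) = lower d s := by simp [lower, h]
      rw [h1, raise, raise, Multiset.card_cons, Nat.succ_sub hc, Multiset.replicate_succ,
        Multiset.add_cons, h]
    · have h1 : lower d (a ::ₘ s) = (a - d) ::ₘ lower d s := by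
        rw [lower, Multiset.map_cons, Multiset.filter_cons_of_pos _ (by omega)]
        rfl
      rw [h1, raise, raise, Multiset.card_cons, Multiset.card_cons, Multiset.map_cons,
        Nat.add_sub_add_right, Nat.sub_add_cancel ha, Multiset.cons_add]

theorem exists_of_mem_lower {d x : ℕ} {s : Multiset ℕ} (hx : x ∈ lower d s) : x + d ∈ s := by
  simp only [lower, Multiset.mem_filter, Multiset.mem_map] at hx
  obtain ⟨⟨y, hy, rfl⟩, h⟩ := hx
  rwa [Nat.sub_add_cancel (by omega)]

theorem sup_mem_of_mem {s : Multiset ℕ} {x : ℕ} (hx : x ∈ s) : s.sup ∈ s := by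
  obtain ⟨y, hy, h⟩ := Finset.exists_mem_eq_sup s.toFinset ⟨x, Multiset.mem_toFinset.2 hx⟩ id
  rw [Finset.sup_def, Multiset.map_id, Multiset.toFinset_val, Multiset.sup_dedup] at h
  rw [h]
  exact Multiset.mem_toFinset.1 hy

/-- The rank of a multiset. -/
def mrank (s : Multiset ℕ) : ℤ := (s.sup : ℤ) - s.card

/-- The generating function of all partitions. -/
noncomputable def partSeries : ℚ⟦X⟧ := gf pos

/-- The generating function of the partitions of rank at most `m`. -/
noncomputable def rankLe (m : ℤ) : ℚ⟦X⟧ := gf {s | s ∈ pos ∧ mrank s ≤ m}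

theorem gf_sep_zero (S : Set (Multiset ℕ)) (hS : S ⊆ pos) (h0 : (0 : Multiset ℕ) ∈ S) :
    gf S = gf (S \ {0}) + 1 := by
  rw [← gf_singleton_zero, ← gf_union (Set.sdiff_subset.trans hS) _ Set.disjoint_sdiff_left,
    Set.sdiff_union_of_subset (Set.singleton_subset_iff.2 h0)]
  exact (Set.singleton_subset_iff.2 h0).trans hS

theorem zero_mem_pos : (0 : Multiset ℕ) ∈ pos := Multiset.notMem_zero 0

/-- The index set of Dyson's symmetry: pairs `(l, ν)` where `ν` fits into an `l × (l + r)` box. -/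
def boxes (r : ℤ) : Set (ℕ × Multiset ℕ) :=
  {p | 0 ≤ p.1 + r ∧ p.2 ∈ pos ∧ p.2.card ≤ p.1 ∧ ∀ x ∈ p.2, (x : ℤ) ≤ p.1 + r}

/-- Adding a first column of height l makes the number of parts exactly l and the largest part at
most l + r + 1. For r = -1 a box needs l ≥ 1, so the empty partition, of rank 0, is missed; this is
the exception. -/
theorem bijOn_raise (r : ℤ) : Set.BijOn (fun p : ℕ × Multiset ℕ => raise 1 p.1 p.2) (boxes r)
    {s | s ∈ pos ∧ mrank s ≤ r + 1 ∧ (r = -1 → s ≠ 0)} := by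
  refine Set.InvOn.bijOn (f' := fun s => (s.card, lower 1 s)) ⟨?_, ?_⟩ ?_ ?_
  · rintro ⟨l, ν⟩ ⟨h1, h2, h3, h4⟩
    simp only [card_raise h3, lower_raise h2]
  · rintro s ⟨h1, h2, h3⟩
    exact raise_lower fun x hx => Nat.one_le_iff_ne_zero.2 fun h0 => h1 (h0 ▸ hx)
  · rintro ⟨l, ν⟩ ⟨h1, h2, h3, h4⟩
    simp only at h1 h2 h3 h4
    have h5 : ∀ x ∈ raise 1 l ν, x ≤ (l + r + 1).toNat := by
      intro x hx
      rcases mem_raise hx with rfl | ⟨y, hy, rfl⟩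
      · omega
      · have := h4 y hy; omega
    refine ⟨fun h0 => ?_, ?_, ?_⟩
    · rcases mem_raise h0 with h | ⟨y, hy, h⟩ <;> omega
    · have := Multiset.sup_le.2 h5
      simp only [mrank, card_raise h3]
      omega
    · rintro rfl h
      have := congrArg Multiset.card h
      rw [card_raise h3, Multiset.card_zero] at this
      omega
  · rintro s ⟨h1, h2, h3⟩
    rw [mrank] at h2
    have h4 : ∀ x ∈ s, x ≤ s.sup := fun x hx => Multiset.le_sup hx
    refine ⟨?_, lower_mem_pos 1 s, card_lower_le 1 s, ?_⟩
    · rcases s.empty_or_exists_mem with rfl | ⟨x, hx⟩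
      · have : r ≠ -1 := fun h => h3 h rfl
        simp at h2 ⊢
        omega
      · have := h4 x hx
        have : x ≠ 0 := fun h0 => h1 (h0 ▸ hx)
        simp only
        omega
    · intro x hx
      have := h4 _ (exists_of_mem_lower hx)
      simp only
      omega

/-- Adding a new largest part l + r to at most l parts gives rank at least r - 1, and l is recovered
as the largest part minus r. When l + r = 0 the added part is empty and the image is the empty
partition. For r = 1 that cannot happen although the rank 0 is admissible, hence the exception. -/
theorem bijOn_cons (r : ℤ) : Set.BijOn
    (fun p : ℕ × Multiset ℕ => if p.1 + r = 0 then 0 else (p.1 + r).toNat ::ₘ p.2) (boxes r)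
    {s | s ∈ pos ∧ r - 1 ≤ mrank s ∧ (r = 1 → s ≠ 0)} := by
  refine Set.InvOn.bijOn (f' := fun s => ((s.sup - r).toNat, s.erase s.sup)) ⟨?_, ?_⟩ ?_ ?_
  · rintro ⟨l, ν⟩ ⟨h1, h2, h3, h4⟩
    simp only at h1 h2 h3 h4 ⊢
    split_ifs with h
    · have : ν = 0 := Multiset.eq_zero_of_forall_notMem fun x hx => by
        have := h4 x hx
        have h0 : x = 0 := by omega
        exact h2 (h0 ▸ hx)
      simp [this]
      omega
    · have h5 : ν.sup ≤ (l + r).toNat := Multiset.sup_le.2 fun x hx => by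
        have := h4 x hx; omega
      rw [Multiset.sup_cons, sup_eq_left.2 h5, Multiset.erase_cons_head]
      simp
      omega
  · rintro s ⟨h1, h2, h3⟩
    rw [mrank] at h2
    simp only
    rcases s.empty_or_exists_mem with rfl | ⟨x, hx⟩
    · have : r ≠ 1 := fun h => h3 h rfl
      simp at h2 ⊢
      omega
    · have h4 := Multiset.le_sup hx
      have h5 : x ≠ 0 := fun h0 => h1 (h0 ▸ hx)
      have h6 := Multiset.card_pos_iff_exists_mem.2 ⟨x, hx⟩
      have h7 := sup_mem_of_mem hx
      rw [if_neg (by omega), show (((s.sup - r).toNat : ℤ) + r).toNat = s.sup by omega,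
        Multiset.cons_erase h7]
  · rintro ⟨l, ν⟩ ⟨h1, h2, h3, h4⟩
    simp only at h1 h2 h3 h4 ⊢
    split_ifs with h
    · refine ⟨zero_mem_pos, ?_, ?_⟩
      · simp [mrank]; omega
      · omega
    · have h5 : ν.sup ≤ (l + r).toNat := Multiset.sup_le.2 fun x hx => by
        have := h4 x hx; omega
      refine ⟨fun h0 => ?_, ?_, fun _ => Multiset.cons_ne_zero⟩
      · rcases Multiset.mem_cons.1 h0 with h6 | h6
        · omega
        · exact h2 h6
      · rw [mrank, Multiset.sup_cons, sup_eq_left.2 h5, Multiset.card_cons]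
        push_cast
        omega
  · rintro s ⟨h1, h2, h3⟩
    rw [mrank] at h2
    have h4 : ∀ x ∈ s, x ≤ s.sup := fun x hx => Multiset.le_sup hx
    rcases s.empty_or_exists_mem with rfl | ⟨x, hx⟩
    · have : r ≠ 1 := fun h => h3 h rfl
      simp at h2
      refine ⟨?_, zero_mem_pos, by simp, by simp⟩
      simp
      omega
    · have h6 := Multiset.card_pos_iff_exists_mem.2 ⟨x, hx⟩
      refine ⟨?_, fun h => h1 (Multiset.mem_of_mem_erase h), ?_, fun x hx => ?_⟩
      · simp only; omega
      · rw [Multiset.card_erase_of_mem (sup_mem_of_mem hx)]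
        simp only [Nat.pred_eq_sub_one]; omega
      · have := h4 x (Multiset.mem_of_mem_erase hx)
        simp only; omega

theorem rankLe_subset_pos (m : ℤ) : {s | s ∈ pos ∧ mrank s ≤ m} ⊆ pos := fun _ hs => hs.1

/-- The generating function of Dyson's boxes. -/
noncomputable def boxSeries (r : ℤ) : ℚ⟦X⟧ := ∑' p : boxes r, X ^ (p.1.1 + p.1.2.sum)

theorem gf_raise_eq (r : ℤ) :
    gf {s | s ∈ pos ∧ mrank s ≤ r + 1 ∧ (r = -1 → s ≠ 0)} = boxSeries r := by
  rw [gf_of_bijOn (bijOn_raise r), boxSeries]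
  refine tsum_congr fun p => ?_
  rw [sum_raise p.2.2.2.1, one_mul]

theorem locFin_boxes (r : ℤ) :
    LocFin fun p : boxes r => (X : ℚ⟦X⟧) ^ (p.1.1 + p.1.2.sum) := by
  have h := (locFin_X_pow_sum (S := {s | s ∈ pos ∧ mrank s ≤ r + 1 ∧ (r = -1 → s ≠ 0)})
    fun _ hs => hs.1).comp_injective ((bijOn_raise r).equiv _).injective
  refine (congrArg LocFin (funext fun p => ?_)).mp h
  change X ^ (raise 1 p.1.1 p.1.2).sum = _
  rw [sum_raise p.2.2.2.1, one_mul]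

theorem rankLe_eq (r : ℤ) : rankLe (r + 1) = boxSeries r + if r = -1 then 1 else 0 := by
  rw [← gf_raise_eq]
  split_ifs with h
  · rw [rankLe, gf_sep_zero _ (rankLe_subset_pos _) ⟨zero_mem_pos, by simp [mrank, h]⟩]
    congr 2
    ext s
    simp only [Set.mem_ofPred_eq, Set.mem_sdiff, Set.mem_singleton_iff, h, and_assoc,
      forall_true_left, ne_eq]
  · rw [add_zero, rankLe]
    congr 1
    ext s
    simp [h]

theorem partSeries_eq (m : ℤ) :
    partSeries = rankLe m + gf {s | s ∈ pos ∧ m + 1 ≤ mrank s} := by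
  rw [rankLe, ← gf_union (fun _ h => h.1) (fun _ h => h.1), partSeries]
  · congr 1
    ext s
    simp only [Set.mem_union, Set.mem_ofPred_eq, ← and_or_left]
    exact ⟨fun h => ⟨h, by omega⟩, fun h => h.1⟩
  · refine Set.disjoint_left.2 fun s h1 h2 => ?_
    have := h1.2
    have := h2.2
    omega

theorem qpow_mul_gf_cons (r : ℤ) :
    qpow (-r) * gf {s | s ∈ pos ∧ r - 1 ≤ mrank s ∧ (r = 1 → s ≠ 0)} =
      qpow r * boxSeries r := by
  have h1 := locFin_X_pow_sum (S := {s | s ∈ pos ∧ r - 1 ≤ mrank s ∧ (r = 1 → s ≠ 0)})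
    fun _ hs => hs.1
  have h2 := h1.comp_injective ((bijOn_cons r).equiv _).injective
  rw [gf, ← ((bijOn_cons r).equiv _).tsum_eq, ← h2.summable.tsum_mul_left, boxSeries,
    ← (locFin_boxes r).summable.tsum_mul_left]
  refine tsum_congr fun ⟨⟨l, ν⟩, h1, h2, h3, h4⟩ => ?_
  change qpow (-r) * X ^ (if (l : ℤ) + r = 0 then 0 else ((l : ℤ) + r).toNat ::ₘ ν).sum = _
  simp only at h1 h2 h3 h4
  rw [qpow, qpow, ← pow_add, ← pow_add]
  congr 1
  split_ifs with h
  · have : ν = 0 := Multiset.eq_zero_of_forall_notMem fun x hx => by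
      have := h4 x hx
      have h0 : x = 0 := by omega
      exact h2 (h0 ▸ hx)
    simp [this]
    omega
  · rw [Multiset.sum_cons]
    simp only
    omega

/-- The two bijections start from the same boxes and their weights differ by q^r. Partitions of rank
at least r - 1 are the complement of those of rank at most r - 2, so this is Dyson's functional
equation, with the empty partition accounting for the constant. -/
theorem qpow_mul_partSeries_sub_rankLe (r : ℤ) :
    qpow (-r) * (partSeries - rankLe (r - 2)) = qpow r * boxSeries r + if r = 1 then 1 else 0 := by
  rw [partSeries_eq (r - 2), add_sub_cancel_left, ← qpow_mul_gf_cons,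
    show r - 2 + 1 = r - 1 by ring]
  split_ifs with h
  · subst h
    rw [show qpow (-1) = 1 by simp [qpow], one_mul, one_mul,
      gf_sep_zero {s | s ∈ pos ∧ (1 : ℤ) - 1 ≤ mrank s} (fun _ hs => hs.1)
        ⟨zero_mem_pos, by simp [mrank]⟩]
    congr 2
    ext s
    simp only [Set.mem_ofPred_eq, Set.mem_sdiff, Set.mem_singleton_iff, and_assoc,
      forall_true_left, ne_eq]
  · rw [add_zero]
    congr 2
    ext s
    simp [h]

theorem euler_qpow (e : ℤ) : euler (qpow e) = (e.toNat : ℚ) • qpow e := euler_X_pow _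

/-- The functional equation of the rank generating function under the heat operator. -/
theorem rankLe_recurrence (m : ℤ) :
    let h : ℤ → ℚ⟦X⟧ := fun m => 3 * euler (rankLe m) + ((m * (m + 1) / 2 : ℚ)) • rankLe m
    qpow (-(m + 2)) * h m + qpow (m + 2) * h (m + 3) =
      qpow (-(m + 2)) * (3 * euler partSeries + ((m * (m + 1) / 2 : ℚ)) • partSeries) := by
  intro h
  simp only [h]
  obtain ⟨r, rfl⟩ : ∃ r, m = r - 2 := ⟨m + 2, by ring⟩
  have h1 := rankLe_eq r
  have h2 := qpow_mul_partSeries_sub_rankLe r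
  rw [show r - 2 + 2 = r by ring, show r - 2 + 3 = r + 1 by ring]
  set Q := partSeries - rankLe (r - 2) with hQ
  have h3 : rankLe (r - 2) = partSeries - Q := by rw [hQ]; ring
  set ε : ℚ⟦X⟧ := if r = -1 then 1 else 0 with hε
  set δ : ℚ⟦X⟧ := if r = 1 then 1 else 0 with hδ
  have h4 : qpow (-r) * Q = qpow r * rankLe (r + 1) + (δ - qpow r * ε) := by
    rw [h1]; linear_combination h2
  have h5 : δ - qpow r * ε = if r = 1 then 1 else if r = -1 then -1 else 0 := by
    rw [hδ, hε]
    split_ifs with a b b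
    · omega
    · ring
    · simp [b, qpow]
    · ring
  rw [h5] at h4
  have h6 := congrArg euler h4
  have h7 : euler (if r = 1 then 1 else if r = -1 then -1 else 0 : ℚ⟦X⟧) = 0 := by
    split_ifs <;> simp
  rw [map_add, h7, Derivation.leibniz, Derivation.leibniz, euler_qpow, euler_qpow, smul_eq_mul,
    smul_eq_mul, smul_eq_mul, smul_eq_mul, smul_eq_C_mul, smul_eq_C_mul] at h6
  have h8 : (r : ℚ) = r.toNat - (-r).toNat := by
    have : r = (r.toNat : ℤ) - (-r).toNat := by omega
    exact_mod_cast this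
  -- The exceptional constants disappear: D kills them, and the remaining coefficient is 0 at r = 1
  -- and 3 - 3 = 0 at r = -1.
  have h9 : (C ((r - 2) * (r - 2 + 1) / 2 - 3 * (-r).toNat : ℚ) : ℚ⟦X⟧) *
      (if r = 1 then 1 else if r = -1 then -1 else 0) = 0 := by
    split_ifs with a b
    · norm_num [a]
    · simp [b]
      norm_num
    · ring
  rw [h3]
  simp only [map_sub, smul_eq_C_mul]
  push_cast
  -- The quadratic m(m+1)/2 increases by 3r from m = r - 2 to m = r + 1, which is what 3D produces
  -- from the factor q^r. Thus the heat operator respects the recurrence.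
  have e1 : ((r + 1) * (r + 1 + 1) / 2 : ℚ) = (r - 2) * (r - 2 + 1) / 2 + 3 * (r.toNat - (-r).toNat) := by
    rw [← h8]; ring
  rw [e1]
  set T : ℚ := (r - 2) * (r - 2 + 1) / 2
  simp only [map_sub, map_add, map_mul, map_ofNat] at h9 ⊢
  linear_combination -3 * h6 - (C T - 3 * C ((-r).toNat : ℚ)) * h4 - h9

theorem rankLe_sub (m : ℤ) : rankLe m - rankLe (m - 1) = gf {s | s ∈ pos ∧ mrank s = m} := by
  rw [sub_eq_iff_eq_add, rankLe, rankLe, ← gf_union (fun _ h => h.1) (fun _ h => h.1)]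
  · congr 1
    ext s
    simp only [Set.mem_union, Set.mem_ofPred_eq, ← and_or_left]
    exact and_congr_right fun _ => by omega
  · refine Set.disjoint_left.2 fun s h1 h2 => ?_
    have := h1.2
    have := h2.2
    omega

theorem parts_mem_pos {n : ℕ} (p : n.Partition) : p.parts ∈ pos := fun h =>
  (p.parts_pos h).ne' rfl

theorem coeff_rankSeries (m : ℤ) (n : ℕ) : coeff n (rankLe m - rankLe (m - 1)) = N m n := by
  classical
  rw [rankLe_sub, coeff_gf fun _ h => h.1, N, Int.cast_natCast]
  congr 2
  ext p
  simp only [Finset.mem_filter, Set.mem_ofPred_eq, Finset.mem_univ, true_and]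
  exact ⟨fun h => h.2, fun h => ⟨parts_mem_pos p, h⟩⟩

theorem coeff_partSeries (n : ℕ) : coeff n partSeries = Fintype.card n.Partition := by
  classical
  rw [partSeries, coeff_gf subset_rfl, Finset.filter_true_of_mem fun p _ => parts_mem_pos p,
    Finset.card_univ]

/-! ### The crank generating function and its recurrence. -/

theorem gf_iUnion {κ : Type*} {S : κ → Set (Multiset ℕ)} (hS : ∀ k, S k ⊆ pos)
    (hd : ∀ i j, i ≠ j → Disjoint (S i) (S j)) : gf (⋃ k, S k) = ∑' k, gf (S k) := by
  have h := (locFin_X_pow_sum (Set.iUnion_subset hS)).comp_injective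
    (Set.unionEqSigmaOfDisjoint hd).symm.injective
  rw [gf, ← (Set.unionEqSigmaOfDisjoint hd).symm.tsum_eq, h.summable.tsum_sigma']
  · refine tsum_congr fun k => tsum_congr fun s => ?_
    congr 2
  · exact fun k => (h.comp_injective sigma_mk_injective).summable

/-- The generating function of the partitions into at most `i` parts. -/
noncomputable def atMost (i : ℕ) : ℚ⟦X⟧ := gf {s | s ∈ pos ∧ s.card ≤ i}

theorem bijOn_raise_card {d : ℕ} (hd : 0 < d) (l : ℕ) :
    Set.BijOn (raise d l) {s | s ∈ pos ∧ s.card ≤ l} {s | s.card = l ∧ ∀ x ∈ s, d ≤ x} := by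
  refine Set.InvOn.bijOn (f' := lower d) ⟨?_, ?_⟩ ?_ ?_
  · exact fun s hs => lower_raise hs.1
  · rintro s ⟨rfl, hs⟩
    exact raise_lower hs
  · refine fun s hs => ⟨card_raise hs.2, fun x hx => ?_⟩
    rcases mem_raise hx with rfl | ⟨y, hy, rfl⟩ <;> omega
  · exact fun s hs => ⟨lower_mem_pos d s, (card_lower_le d s).trans_eq hs.1⟩

theorem gf_card_eq {d : ℕ} (hd : 0 < d) (l : ℕ) :
    gf {s | s.card = l ∧ ∀ x ∈ s, d ≤ x} = X ^ (d * l) * atMost l :=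
  gf_of_bijOn_shift (fun _ h => h.1) (d * l) (bijOn_raise_card hd l)
    fun _ hs => sum_raise hs.2

theorem atMost_zero : atMost 0 = 1 := by
  rw [← gf_singleton_zero, atMost]
  congr 1
  ext s
  simp only [Set.mem_ofPred_eq, Nat.le_zero, Multiset.card_eq_zero, Set.mem_singleton_iff,
    and_iff_right_iff_imp]
  rintro rfl
  exact zero_mem_pos

/-- Partitions with exactly i + 1 parts lose a full column of height i + 1. -/
theorem atMost_succ (i : ℕ) : (1 - X ^ (i + 1)) * atMost (i + 1) = atMost i := by
  have h : atMost (i + 1) = atMost i + X ^ (1 * (i + 1)) * atMost (i + 1) := by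
    rw [← gf_card_eq one_pos, atMost, atMost, ← gf_union (fun _ h => h.1)
      (fun _ h h0 => absurd (h.2 0 h0) (by norm_num))]
    · congr 1
      ext s
      simp only [Set.mem_union, Set.mem_ofPred_eq]
      have : s ∈ pos ↔ ∀ x ∈ s, 1 ≤ x :=
        ⟨fun h x hx => Nat.one_le_iff_ne_zero.2 fun h0 => h (h0 ▸ hx),
          fun h h0 => absurd (h 0 h0) (by norm_num)⟩
      rw [← this]
      constructor
      · rintro ⟨h1, h2⟩
        rcases h2.lt_or_eq with h | h
        · exact Or.inl ⟨h1, by omega⟩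
        · exact Or.inr ⟨h, h1⟩
      · rintro (⟨h1, h2⟩ | ⟨h1, h2⟩)
        · exact ⟨h1, by omega⟩
        · exact ⟨h2, h1.le⟩
    · refine Set.disjoint_left.2 fun s h1 h2 => ?_
      have := h1.2
      have := h2.1
      omega
  rw [one_mul] at h
  linear_combination h

/-- Partitions with all parts between `2` and `k`. -/
def between (k : ℕ) : Set (Multiset ℕ) := {s | ∀ x ∈ s, 2 ≤ x ∧ x ≤ k}

theorem between_subset_pos (k : ℕ) : between k ⊆ pos := fun _ h h0 =>
  absurd (h 0 h0).1 (by norm_num)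

theorem gf_between_one : gf (between 1) = 1 := by
  rw [← gf_singleton_zero]
  congr 1
  ext s
  simp only [between, Set.mem_ofPred_eq, Set.mem_singleton_iff]
  constructor
  · exact fun h => Multiset.eq_zero_of_forall_notMem fun x hx => by
      have := h x hx; omega
  · rintro rfl
    simp

theorem bijOn_cons_between {k : ℕ} (hk : 2 ≤ k) :
    Set.BijOn (fun s => k ::ₘ s) (between k) {s | s ∈ between k ∧ k ∈ s} := by
  refine Set.InvOn.bijOn (f' := fun s => s.erase k) ⟨?_, ?_⟩ ?_ ?_
  · exact fun s _ => Multiset.erase_cons_head k s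
  · exact fun s hs => Multiset.cons_erase hs.2
  · refine fun s hs => ⟨fun x hx => ?_, Multiset.mem_cons_self k s⟩
    rcases Multiset.mem_cons.1 hx with rfl | hx
    · exact ⟨hk, le_rfl⟩
    · exact hs x hx
  · exact fun s hs x hx => hs.1 x (Multiset.mem_of_mem_erase hx)

theorem gf_between_mem {k : ℕ} (hk : 2 ≤ k) :
    gf {s | s ∈ between k ∧ k ∈ s} = X ^ k * gf (between k) :=
  gf_of_bijOn_shift (between_subset_pos k) k (bijOn_cons_between hk) fun s _ =>
    Multiset.sum_cons k s

theorem gf_between_succ {k : ℕ} (hk : 1 ≤ k) :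
    (1 - X ^ (k + 1)) * gf (between (k + 1)) = gf (between k) := by
  have h : gf (between (k + 1)) = gf (between k) + X ^ (k + 1) * gf (between (k + 1)) := by
    rw [← gf_between_mem (by omega), ← gf_union (between_subset_pos k)
      fun s hs => between_subset_pos _ hs.1]
    · congr 1
      ext s
      simp only [Set.mem_union, Set.mem_ofPred_eq, between]
      constructor
      · intro h
        by_cases h1 : k + 1 ∈ s
        · exact Or.inr ⟨h, h1⟩
        · refine Or.inl fun x hx => ⟨(h x hx).1, ?_⟩
          have := (h x hx).2
          have : x ≠ k + 1 := fun h2 => h1 (h2 ▸ hx)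
          omega
      · rintro (h | h)
        · exact fun x hx => ⟨(h x hx).1, (h x hx).2.trans (Nat.le_succ k)⟩
        · exact h.1
    · refine Set.disjoint_left.2 fun s h1 h2 => ?_
      have := (h1 _ h2.2).2
      omega
  linear_combination h

theorem one_sub_X_pow_ne_zero (k : ℕ) : (1 - X ^ (k + 1) : ℚ⟦X⟧) ≠ 0 := fun h => by
  simpa using congrArg constantCoeff h

/-- Both sides satisfy the same recurrence in k; the conjugation between bounded parts and bounded
length is thereby avoided, and the factor 1 - q removes the ones. -/
theorem gf_between_eq {k : ℕ} (hk : 1 ≤ k) : gf (between k) = (1 - X) * atMost k := by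
  induction k, hk using Nat.le_induction with
  | base =>
    have h := atMost_succ 0
    rw [zero_add, pow_one, atMost_zero] at h
    rw [h, gf_between_one]
  | succ k hk ih =>
    refine mul_left_cancel₀ (one_sub_X_pow_ne_zero k) ?_
    rw [gf_between_succ hk, ih, ← atMost_succ k]
    ring

/-- The crank of a multiset. -/
def mcrank (s : Multiset ℕ) : ℤ :=
  if s.count 1 = 0 then (s.sup : ℤ) else (s.countP (fun a => s.count 1 < a) : ℤ) - s.count 1

/-- Partitions with `k` ones and crank `m`. -/
def crankOnes (m : ℤ) (k : ℕ) : Set (Multiset ℕ) := {s | s ∈ pos ∧ mcrank s = m ∧ s.count 1 = k}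

/-- Once the number k ≥ 1 of ones is fixed, the crank only counts the parts above k. The parts
therefore split freely into ones, parts from 2 to k, and i parts above k. -/
theorem bijOn_crankOnes {k i : ℕ} (hk : 1 ≤ k) :
    Set.BijOn (fun p : Multiset ℕ × Multiset ℕ => Multiset.replicate k 1 + p.1 + p.2)
      (between k ×ˢ {s | s.card = i ∧ ∀ x ∈ s, k + 1 ≤ x}) (crankOnes (i - k) k) := by
  have fz : ∀ (p : ℕ → Prop) [DecidablePred p] (s : Multiset ℕ), (∀ x ∈ s, ¬p x) →
    s.filter p = 0 := fun p _ s h => Multiset.filter_eq_nil.2 h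
  have c1 : ∀ s : Multiset ℕ, (∀ x ∈ s, 2 ≤ x) → s.count 1 = 0 := fun s h =>
    Multiset.count_eq_zero.2 fun h1 => absurd (h 1 h1) (by norm_num)
  refine Set.InvOn.bijOn (f' := fun s => (s.filter fun x => 1 < x ∧ x ≤ k,
    s.filter fun x => k < x)) ⟨?_, ?_⟩ ?_ ?_
  · rintro ⟨μ, ν⟩ ⟨h1, h2, h3⟩
    simp only at h1 h2 h3
    simp only [Multiset.filter_add]
    rw [fz (fun x => 1 < x ∧ x ≤ k) (Multiset.replicate k 1) fun x hx => by
        rw [Multiset.eq_of_mem_replicate hx]; omega,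
      fz (fun x => k < x) (Multiset.replicate k 1) fun x hx => by
        rw [Multiset.eq_of_mem_replicate hx]; omega,
      fz (fun x => 1 < x ∧ x ≤ k) ν fun x hx => by have := h3 x hx; omega,
      fz (fun x => k < x) μ fun x hx => by have := h1 x hx; omega,
      Multiset.filter_eq_self.2 fun x hx => by have := h1 x hx; omega,
      Multiset.filter_eq_self.2 fun x hx => by have := h3 x hx; omega]
    simp
  · rintro s ⟨h1, h2, h3⟩
    ext x
    have hx : x = 0 → s.count x = 0 := by
      rintro rfl; exact Multiset.count_eq_zero.2 h1
    simp only [Multiset.count_add, Multiset.count_replicate, Multiset.count_filter]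
    split_ifs <;> first | omega | (subst_vars; omega)
  · rintro ⟨μ, ν⟩ ⟨h1, h2, h3⟩
    simp only at h1 h2 h3
    have e1 : (Multiset.replicate k 1 + μ + ν).count 1 = k := by
      rw [Multiset.count_add, Multiset.count_add, Multiset.count_replicate_self,
        c1 μ fun x hx => (h1 x hx).1, c1 ν fun x hx => by have := h3 x hx; omega]
      rfl
    have e2 : (Multiset.replicate k 1 + μ + ν).countP (fun a => k < a) = i := by
      rw [Multiset.countP_eq_card_filter, Multiset.filter_add, Multiset.filter_add,
        fz _ (Multiset.replicate k 1) fun x hx => by rw [Multiset.eq_of_mem_replicate hx]; omega,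
        fz _ μ fun x hx => by have := h1 x hx; omega,
        Multiset.filter_eq_self.2 fun x hx => by have := h3 x hx; omega]
      simpa using h2
    refine ⟨fun h0 => ?_, ?_, e1⟩
    · simp only [Multiset.mem_add] at h0
      rcases h0 with (h0 | h0) | h0
      · exact absurd (Multiset.eq_of_mem_replicate h0) (by norm_num)
      · exact absurd (h1 0 h0).1 (by norm_num)
      · exact absurd (h3 0 h0) (by norm_num)
    · simp only [mcrank, e1, e2]
      rw [if_neg (by omega)]
  · rintro s ⟨h1, h2, h3⟩
    refine ⟨fun x hx => ?_, ?_, fun x hx => ?_⟩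
    · have := (Multiset.mem_filter.1 hx).2; omega
    · rw [mcrank, h3, if_neg (by omega), Multiset.countP_eq_card_filter] at h2
      simp only
      omega
    · have := (Multiset.mem_filter.1 hx).2; omega

/-- The summands of the crank generating function, up to the factor `(1 - q) / q`. -/
noncomputable def crankTerm (i k : ℤ) : ℚ⟦X⟧ :=
  if 0 ≤ i ∧ 0 ≤ k then X ^ ((i.toNat + 1) * (k.toNat + 1)) * atMost i.toNat * atMost k.toNat else 0

theorem crankTerm_natCast (i k : ℕ) :
    crankTerm i k = X ^ ((i + 1) * (k + 1)) * atMost i * atMost k := by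
  simp [crankTerm]

theorem X_mul_gf_crankOnes {m : ℤ} {k : ℕ} (hk : 1 ≤ k) :
    X * gf (crankOnes m k) = (1 - X) * crankTerm (k + m) k := by
  rcases lt_or_ge ((k : ℤ) + m) 0 with h | h
  · have : crankOnes m k = ∅ := Set.eq_empty_iff_forall_notMem.2 fun s hs => by
      have h2 := hs.2.1
      rw [mcrank, hs.2.2, if_neg (by omega)] at h2
      omega
    rw [this, gf_empty, crankTerm, if_neg (by omega), mul_zero, mul_zero]
  · obtain ⟨i, hi⟩ := Int.eq_ofNat_of_zero_le h
    obtain rfl : m = i - k := by omega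
    rw [gf_of_bijOn_prod (between_subset_pos k)
      (fun _ hs h0 => absurd (hs.2 0 h0) (by norm_num)) k (bijOn_crankOnes hk)
      (fun p _ => by simp [Multiset.sum_add]), gf_between_eq hk, gf_card_eq (by omega), hi,
      crankTerm_natCast]
    ring

/-- Without ones the crank is the largest part. For m ≥ 2 this agrees with the general term; the
discrepancy at m = 0 and m = 1 is exactly what the customary amendment at n = 1 repairs. -/
theorem X_mul_gf_crankOnes_zero (m : ℤ) : X * gf (crankOnes m 0) = (1 - X) * crankTerm m 0 +
    X * ((if m = 0 then X else 0) - if m = 1 then X else 0) := by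
  have hsup : ∀ s : Multiset ℕ, s ∈ crankOnes m 0 → (s.sup : ℤ) = m := fun s hs => by
    have := hs.2.1
    rwa [mcrank, if_pos hs.2.2] at this
  have hge : ∀ s : Multiset ℕ, s ∈ crankOnes m 0 → ∀ x ∈ s, 2 ≤ x := fun s hs x hx => by
    have h0 : x ≠ 0 := fun h => hs.1 (h ▸ hx)
    have h1 : x ≠ 1 := fun h => Multiset.count_eq_zero.1 hs.2.2 (h ▸ hx)
    omega
  rcases lt_or_ge m 0 with h | h
  · have : crankOnes m 0 = ∅ := Set.eq_empty_iff_forall_notMem.2 fun s hs => by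
      have := hsup s hs
      omega
    rw [this, gf_empty, crankTerm, if_neg (by omega), if_neg (by omega), if_neg (by omega)]
    ring
  obtain ⟨n, rfl⟩ := Int.eq_ofNat_of_zero_le h
  have ht : crankTerm n 0 = X ^ (n + 1) * atMost n := by
    have := crankTerm_natCast n 0
    rw [atMost_zero, mul_one, zero_add, mul_one] at this
    exact_mod_cast this
  rw [ht]
  rcases n with _ | _ | n
  · have : crankOnes (0 : ℕ) 0 = {0} := by
      ext s
      constructor
      · intro hs
        refine Multiset.eq_zero_of_forall_notMem fun x hx => ?_
        have := hge s hs x hx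
        have := Multiset.le_sup hx
        have := hsup s hs
        omega
      · rintro rfl
        exact ⟨zero_mem_pos, by simp [mcrank], by simp⟩
    rw [this, gf_singleton_zero, atMost_zero]
    simp
    ring
  · have : crankOnes (0 + 1 : ℕ) 0 = ∅ := Set.eq_empty_iff_forall_notMem.2 fun s hs => by
      have h1 := hsup s hs
      have h2 : s.sup ≠ 0 := by omega
      rcases s.empty_or_exists_mem with rfl | ⟨x, hx⟩
      · simp at h2
      · have := hge s hs x hx
        have := Multiset.le_sup hx
        omega
    have h1 := atMost_succ 0
    rw [zero_add, pow_one, atMost_zero] at h1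
    rw [this, gf_empty]
    simp
    linear_combination -X ^ 2 * h1
  · have h2 : 2 ≤ n + 1 + 1 := by omega
    have : crankOnes (n + 1 + 1 : ℕ) 0 = {s | s ∈ between (n + 1 + 1) ∧ n + 1 + 1 ∈ s} := by
      ext s
      constructor
      · intro hs
        have h1 := hsup s hs
        refine ⟨fun x hx => ⟨hge s hs x hx, ?_⟩, ?_⟩
        · have := Multiset.le_sup hx
          omega
        · rcases s.empty_or_exists_mem with rfl | ⟨x, hx⟩
          · simp at h1
            omega
          · have := sup_mem_of_mem hx
            rwa [show s.sup = n + 1 + 1 by omega] at this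
      · rintro ⟨h1, h3⟩
        have h4 : s.count 1 = 0 := Multiset.count_eq_zero.2 fun h5 => by
          have := h1 1 h5; omega
        refine ⟨between_subset_pos _ h1, ?_, h4⟩
        rw [mcrank, if_pos h4]
        have h5 := Multiset.le_sup h3
        have h6 : s.sup ≤ n + 1 + 1 := Multiset.sup_le.2 fun x hx => (h1 x hx).2
        omega
    rw [this, gf_between_mem h2, gf_between_eq (by omega), if_neg (by omega), if_neg (by omega)]
    ring

/-- The amended crank generating function. -/
noncomputable def crankSeries (m : ℤ) : ℚ⟦X⟧ :=
  gf {s | s ∈ pos ∧ mcrank s = m} + ((if m = 1 then X else 0) - if m = 0 then X else 0)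

theorem locFin_crankTerm (m : ℤ) : LocFin fun k : ℤ => crankTerm (k + m) k := fun n => by
  refine (Set.finite_Icc (0 : ℤ) n).subset fun k hk => ?_
  simp only [Set.mem_ofPred_eq, crankTerm] at hk
  split_ifs at hk with h
  · refine ⟨h.2, ?_⟩
    by_contra! hn
    rw [mul_assoc, coeff_X_pow_mul', if_neg] at hk
    · exact hk rfl
    · have : k.toNat + 1 ≤ ((k + m).toNat + 1) * (k.toNat + 1) :=
        Nat.le_mul_of_pos_left _ (by omega)
      omega
  · simp at hk

/-- Summation over the number k of ones, with i = k + m parts larger than k. The factor q on the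
left clears the surplus power in `crankTerm`, which makes that term symmetric in i and k. -/
theorem X_mul_crankSeries (m : ℤ) :
    X * crankSeries m = (1 - X) * ∑' k : ℤ, crankTerm (k + m) k := by
  have hU : {s | s ∈ pos ∧ mcrank s = m} = ⋃ k : ℕ, crankOnes m k := by
    ext s
    simp only [crankOnes, Set.mem_iUnion, Set.mem_ofPred_eq, exists_and_left, exists_eq', and_true]
  have hd : ∀ i j : ℕ, i ≠ j → Disjoint (crankOnes m i) (crankOnes m j) := fun i j h =>
    Set.disjoint_left.2 fun s h1 h2 => h (h1.2.2.symm.trans h2.2.2)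
  have hs : ∑' k : ℤ, crankTerm (k + m) k = ∑' k : ℕ, crankTerm (k + m) k := by
    refine (Nat.cast_injective (R := ℤ)).tsum_eq (f := fun k : ℤ => crankTerm (k + m) k)
      (fun k hk => ?_) |>.symm
    by_contra h
    refine hk (if_neg fun h2 => h ⟨k.toNat, by simp [h2.2]⟩)
  have hf := (locFin_crankTerm m).comp_injective (Nat.cast_injective (R := ℤ))
  set δ : ℚ⟦X⟧ := (if m = 1 then X else 0) - if m = 0 then X else 0 with hδ
  have hX : ∀ k : ℕ, X * (gf (crankOnes m k) + if k = 0 then δ else 0) =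
      (1 - X) * crankTerm (k + m) k := by
    intro k
    rcases Nat.eq_zero_or_pos k with rfl | hk
    · have := X_mul_gf_crankOnes_zero m
      rw [if_pos rfl, mul_add, this, hδ]
      push_cast
      rw [zero_add]
      ring
    · rw [if_neg (by omega), add_zero, X_mul_gf_crankOnes hk]
  have hg : LocFin fun k : ℕ => gf (crankOnes m k) := fun n => by
    refine (Set.finite_Iic n).subset fun k hk => ?_
    by_contra h
    apply hk
    classical
    rw [coeff_gf fun _ h => h.1, Nat.cast_eq_zero, Finset.card_eq_zero,
      Finset.filter_eq_empty_iff]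
    intro p _ hp
    have h1 : p.parts.count 1 = k := hp.2.2
    have h2 := Multiset.le_count_iff_replicate_le.1 h1.ge
    obtain ⟨t, ht⟩ := Multiset.le_iff_exists_add.1 h2
    have h3 := p.parts_sum
    rw [ht, Multiset.sum_add, Multiset.sum_replicate] at h3
    simp at h h3
    omega
  rw [hs, ← hf.summable.tsum_mul_left, ← tsum_congr hX, crankSeries, hU,
    gf_iUnion (fun k _ h => h.1) hd]
  have h0 : HasSum (fun k : ℕ => if k = 0 then δ else 0) δ := hasSum_ite_eq 0 δ
  rw [(hg.summable.add h0.summable).tsum_mul_left, hg.summable.tsum_add h0.summable, h0.tsum_eq]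

/-- The three-term recurrence already holds for each summand. By `atMost_succ`, lowering i or k
contributes a factor 1 - q^i or 1 - q^k; with m = i - k the leading terms of the two contributions
cancel. Terms with a negative index are zero, which covers the boundary. -/
theorem crankTerm_recurrence (i k : ℤ) :
    qpow (-(i - k)) * crankTerm i k - qpow (i - k) * crankTerm i k =
      X * (qpow (-(i - k)) * crankTerm (i - 1) k) - X * (qpow (i - k) * crankTerm i (k - 1)) := by
  rcases lt_or_ge i 0 with hi | hi
  · simp only [crankTerm]
    rw [if_neg (by omega), if_neg (by omega), if_neg (by omega)]
    ring
  rcases lt_or_ge k 0 with hk | hk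
  · simp only [crankTerm]
    rw [if_neg (by omega), if_neg (by omega), if_neg (by omega)]
    ring
  obtain ⟨i, rfl⟩ := Int.eq_ofNat_of_zero_le hi
  obtain ⟨k, rfl⟩ := Int.eq_ofNat_of_zero_le hk
  have h1 : crankTerm ((i : ℤ) - 1) k =
      X ^ (i * (k + 1)) * ((1 - X ^ i) * atMost i) * atMost k := by
    cases i with
    | zero => simp [crankTerm]
    | succ i =>
      rw [atMost_succ]
      push_cast
      rw [add_sub_cancel_right, crankTerm_natCast]
  have h2 : crankTerm (i : ℤ) (k - 1) =
      X ^ ((i + 1) * k) * atMost i * ((1 - X ^ k) * atMost k) := by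
    cases k with
    | zero => simp [crankTerm]
    | succ k =>
      rw [atMost_succ]
      push_cast
      rw [add_sub_cancel_right, crankTerm_natCast]
  have h3 : qpow (-((i : ℤ) - k)) * X ^ i = qpow ((i : ℤ) - k) * X ^ k := by
    rw [qpow, qpow, ← pow_add, ← pow_add]
    congr 1
    omega
  rw [h1, h2, crankTerm_natCast]
  linear_combination (-atMost i * atMost k * X ^ (i * k + 1) * (1 - X ^ i - X ^ k)) * h3

/-- The three-term recurrence of the crank generating functions. -/
theorem crankSeries_recurrence (m : ℤ) :
    qpow (-m) * crankSeries m - qpow m * crankSeries m =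
      X * (qpow (-m) * crankSeries (m - 1)) - X * (qpow m * crankSeries (m + 1)) := by
  have e1 : X * crankSeries (m + 1) = (1 - X) * ∑' k : ℤ, crankTerm (k + m) (k - 1) := by
    rw [X_mul_crankSeries, ← (Equiv.subRight (1 : ℤ)).tsum_eq]
    congr 1
    refine tsum_congr fun k => ?_
    rw [Equiv.subRight_apply]
    congr 1
    ring
  have e2 : X * crankSeries (m - 1) = (1 - X) * ∑' k : ℤ, crankTerm (k + m - 1) k := by
    rw [X_mul_crankSeries]
    congr 1
    exact tsum_congr fun k => by rw [add_sub_assoc]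
  have l0 := locFin_crankTerm m
  have l1 : LocFin fun k : ℤ => crankTerm (k + m) (k - 1) := by
    have := (locFin_crankTerm (m + 1)).comp_injective (sub_left_injective (b := (1 : ℤ)))
    refine (congrArg LocFin (funext fun k => ?_)).mp this
    congr 1
    ring
  have l2 : LocFin fun k : ℤ => crankTerm (k + m - 1) k := by
    simpa only [add_sub_assoc] using locFin_crankTerm (m - 1)
  have key : qpow (-m) * ∑' k : ℤ, crankTerm (k + m) k - qpow m * ∑' k : ℤ, crankTerm (k + m) k =
      X * qpow (-m) * ∑' k : ℤ, crankTerm (k + m - 1) k -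
        X * qpow m * ∑' k : ℤ, crankTerm (k + m) (k - 1) := by
    rw [← l0.summable.tsum_mul_left, ← l0.summable.tsum_mul_left, ← l1.summable.tsum_mul_left,
      ← l2.summable.tsum_mul_left,
      ← (l0.summable.mul_left _).tsum_sub (l0.summable.mul_left _),
      ← (l2.summable.mul_left _).tsum_sub (l1.summable.mul_left _)]
    refine tsum_congr fun k => ?_
    have := crankTerm_recurrence (k + m) k
    rw [show k + m - k = m by ring] at this
    linear_combination this
  refine mul_left_cancel₀ (X_ne_zero (R := ℚ)) ?_
  linear_combination (qpow (-m) - qpow m) * X_mul_crankSeries m + (1 - X) * key -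
    X * qpow (-m) * e2 + X * qpow m * e1

theorem coeff_crankSeries (m : ℤ) (n : ℕ) : coeff n (crankSeries m) = M m n := by
  classical
  have hp : ∀ p : n.Partition, p.parts ∈ {s | s ∈ pos ∧ mcrank s = m} ↔ crank p = m := fun p =>
    ⟨fun h => h.2, fun h => ⟨parts_mem_pos p, h⟩⟩
  have hg : coeff n (gf {s | s ∈ pos ∧ mcrank s = m}) =
      (Finset.univ.filter fun p : n.Partition => crank p = m).card := by
    rw [coeff_gf fun _ h => h.1]
    congr 2
    ext p
    simp only [Finset.mem_filter, hp]
  rw [crankSeries, map_add, hg, M]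
  by_cases hn : n = 1
  · subst hn
    have h1 : ∀ p : Nat.Partition 1, crank p = -1 := by
      intro p
      rw [Subsingleton.elim p (Nat.Partition.indiscrete 1)]
      decide
    have h2 : (Finset.univ.filter fun p : Nat.Partition 1 => crank p = m).card =
        if m = -1 then 1 else 0 := by
      split_ifs with h
      · rw [Finset.filter_true_of_mem fun p _ => by rw [h1, h], Finset.card_univ]
        exact Fintype.card_unique
      · rw [Finset.card_eq_zero, Finset.filter_eq_empty_iff]
        exact fun p _ hp => h (hp ▸ h1 p)
    rw [h2, if_pos rfl, map_sub, apply_ite (coeff 1), apply_ite (coeff 1)]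
    simp only [coeff_one_X, map_zero]
    split_ifs <;> first | omega | simp
  · have hX : coeff n (X : ℚ⟦X⟧) = 0 := by rw [coeff_X, if_neg hn]
    rw [if_neg hn, map_sub, apply_ite (coeff n), apply_ite (coeff n), hX]
    simp

/-! ### From generating series to the moments of rank and crank. -/

theorem locFin_crankSeries : LocFin crankSeries := fun n => by
  refine (finite_support_crank 0 n).subset fun m hm => ?_
  simpa [coeff_crankSeries] using hm

theorem locFin_rankSeries : LocFin fun m => rankLe m - rankLe (m - 1) := fun n => by
  refine (finite_support_rank 0 n).subset fun m hm => ?_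
  simpa only [Set.mem_ofPred_eq, coeff_rankSeries, Function.mem_support, pow_zero, one_mul] using hm

theorem tsum_gf_fiber (f : Multiset ℕ → ℤ) :
    ∑' m, gf {s | s ∈ pos ∧ f s = m} = partSeries := by
  rw [partSeries, ← gf_iUnion (fun _ _ h => h.1) fun i j h =>
    Set.disjoint_left.2 fun s h1 h2 => h (h1.2.symm.trans h2.2)]
  congr 1
  ext s
  simp

theorem mom_zero_rankSeries : mom 0 0 (fun m => rankLe m - rankLe (m - 1)) = partSeries := by
  simp only [mom, pow_zero, one_smul, rankLe_sub]
  exact tsum_gf_fiber mrank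

theorem mom_zero_crankSeries : mom 0 0 crankSeries = partSeries := by
  have h1 : HasSum (fun m : ℤ => if m = 1 then (X : ℚ⟦X⟧) else 0) X := hasSum_ite_eq 1 _
  have h0 : HasSum (fun m : ℤ => if m = 0 then (X : ℚ⟦X⟧) else 0) X := hasSum_ite_eq 0 _
  have h := h1.sub h0
  have h2 : Summable fun m => gf {s | s ∈ pos ∧ mcrank s = m} := by
    refine (locFin_crankSeries.summable.sub h.summable).congr fun m => ?_
    rw [crankSeries, add_sub_cancel_right]
  simp only [mom, pow_zero, one_smul, crankSeries]
  rw [h2.tsum_add h.summable, h.tsum_eq, tsum_gf_fiber, sub_self, add_zero]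

theorem constantCoeff_partSeries : constantCoeff partSeries = 1 := by
  rw [← coeff_zero_eq_constantCoeff_apply, coeff_partSeries, Fintype.card_unique, Nat.cast_one]

theorem coeff_mom_crankSeries (j n : ℕ) : coeff n (mom 0 j crankSeries) = crankMoment j n := by
  rw [mom, (locFin_crankSeries.smul _).coeff_tsum, crankMoment]
  simp only [map_smul, coeff_crankSeries, sub_zero, smul_eq_mul]

theorem coeff_mom_rankSeries (j n : ℕ) :
    coeff n (mom 0 j fun m => rankLe m - rankLe (m - 1)) = rankMoment j n := by
  rw [mom, (locFin_rankSeries.smul _).coeff_tsum, rankMoment]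
  simp only [map_smul, coeff_rankSeries, sub_zero, smul_eq_mul]

theorem thetaMom_one_ne_zero : thetaMom 1 ≠ 0 := fun h => by
  have := constantCoeff_thetaMom_one
  rw [h] at this
  norm_num at this

theorem partSeries_ne_zero : partSeries ≠ 0 := fun h => by
  have := constantCoeff_partSeries
  rw [h] at this
  norm_num at this

/-! ### Normalized theta moments and Ramanujan's differential equations. -/

theorem eq_of_smul_eq_smul {a b : ℚ⟦X⟧} {c : ℚ} (hc : c ≠ 0) (h : c • a = c • b) : a = b := by
  have := congrArg (fun t => c⁻¹ • t) h
  simpa only [smul_smul, inv_mul_cancel₀ hc, one_smul] using this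

/-- The normalized moments of the theta series. -/
noncomputable def thetaNorm (r : ℕ) : ℚ⟦X⟧ := thetaMom r * (thetaMom 1)⁻¹

theorem thetaMom_eq (r : ℕ) : thetaMom r = thetaMom 1 * thetaNorm r := by
  have h : constantCoeff (thetaMom 1) ≠ 0 := by
    rw [← coeff_zero_eq_constantCoeff_apply, constantCoeff_thetaMom_one]
    norm_num
  rw [thetaNorm, mul_left_comm, PowerSeries.mul_inv_cancel _ h, mul_one]

theorem thetaNorm_one : thetaNorm 1 = 1 := by
  refine mul_left_cancel₀ thetaMom_one_ne_zero ?_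
  rw [← thetaMom_eq, mul_one]

theorem thetaNorm_even {r : ℕ} (hr : Even r) : thetaNorm r = 0 := by
  rw [thetaNorm, thetaMom_even hr, zero_mul]

/-- The heat equation divided by the first moment; the third moment enters through the logarithmic
derivative of the first. All odd moments thus arise from the third by differentiation. -/
theorem thetaNorm_add_two (r : ℕ) :
    thetaNorm (r + 2) = (2 : ℚ) • euler (thetaNorm r) + thetaNorm 3 * thetaNorm r := by
  have h1 := euler_thetaMom 1
  have h2 := euler_thetaMom r
  rw [thetaMom_eq r, Derivation.leibniz, thetaMom_eq (r + 2), h1, thetaMom_eq (1 + 2)] at h2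
  refine mul_left_cancel₀ thetaMom_one_ne_zero ?_
  simp only [smul_eq_mul, Nat.reduceAdd] at h2
  have h3 := congrArg (fun t => (2 : ℚ) • t) h2
  linear_combination (norm := algebra) -h3

theorem integ_pairMonomial_eq (r s : ℕ) :
    integ locFin_theta_mul_theta (pairMonomial r s) =
      thetaMom 1 ^ 2 * (thetaNorm r * thetaNorm s) := by
  rw [integ_pairMonomial, thetaMom_eq r, thetaMom_eq s]
  ring

/-- This and the eight evaluations after it give the terms of the bilinear equation for the outer
exponents 0, 2 and 6. In each expansion only monomials odd in both variables survive. -/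
theorem integ_0_4 :
    integ locFin_theta_mul_theta (fun p => (p.1 + p.2 - 1 : ℚ) ^ 0 * (p.1 - p.2 : ℚ) ^ 4) =
      thetaMom 1 ^ 2 * ((-8 : ℚ) • (thetaNorm 1 * thetaNorm 3)) := by
  have e : (fun p : ℤ × ℤ => (p.1 + p.2 - 1 : ℚ) ^ 0 * (p.1 - p.2 : ℚ) ^ 4) =
      (1 : ℚ) • pairMonomial 0 4 + (-4 : ℚ) • pairMonomial 1 3 + (6 : ℚ) • pairMonomial 2 2 + (-4 : ℚ) • pairMonomial 3 1 + (1 : ℚ) • pairMonomial 4 0 := by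
    funext p
    simp only [Pi.add_apply, Pi.smul_apply, smul_eq_mul, pairMonomial]
    ring
  rw [e]
  simp only [map_add, map_smul, integ_pairMonomial_eq]
  simp only [thetaNorm_even (show Even 0 by decide), thetaNorm_even (show Even 2 by decide), thetaNorm_even (show Even 4 by decide)]
  algebra

theorem integ_0_2 :
    integ locFin_theta_mul_theta (fun p => (p.1 + p.2 - 1 : ℚ) ^ 0 * (p.1 - p.2 : ℚ) ^ 2) =
      thetaMom 1 ^ 2 * ((-2 : ℚ) • (thetaNorm 1 * thetaNorm 1)) := by
  have e : (fun p : ℤ × ℤ => (p.1 + p.2 - 1 : ℚ) ^ 0 * (p.1 - p.2 : ℚ) ^ 2) =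
      (1 : ℚ) • pairMonomial 0 2 + (-2 : ℚ) • pairMonomial 1 1 + (1 : ℚ) • pairMonomial 2 0 := by
    funext p
    simp only [Pi.add_apply, Pi.smul_apply, smul_eq_mul, pairMonomial]
    ring
  rw [e]
  simp only [map_add, map_smul, integ_pairMonomial_eq]
  simp only [thetaNorm_even (show Even 0 by decide), thetaNorm_even (show Even 2 by decide)]
  algebra

theorem integ_0_0 :
    integ locFin_theta_mul_theta (fun p => (p.1 + p.2 - 1 : ℚ) ^ 0 * (p.1 - p.2 : ℚ) ^ 0) =
      thetaMom 1 ^ 2 * (0) := by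
  have e : (fun p : ℤ × ℤ => (p.1 + p.2 - 1 : ℚ) ^ 0 * (p.1 - p.2 : ℚ) ^ 0) =
      (1 : ℚ) • pairMonomial 0 0 := by
    funext p
    simp only [Pi.add_apply, Pi.smul_apply, smul_eq_mul, pairMonomial]
    ring
  rw [e]
  simp only [map_add, map_smul, integ_pairMonomial_eq]
  simp only [thetaNorm_even (show Even 0 by decide)]
  algebra

theorem integ_2_4 :
    integ locFin_theta_mul_theta (fun p => (p.1 + p.2 - 1 : ℚ) ^ 2 * (p.1 - p.2 : ℚ) ^ 4) =
      thetaMom 1 ^ 2 * ((-4 : ℚ) • (thetaNorm 1 * thetaNorm 5) + (4 : ℚ) • (thetaNorm 3 * thetaNorm 3)) := by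
  have e : (fun p : ℤ × ℤ => (p.1 + p.2 - 1 : ℚ) ^ 2 * (p.1 - p.2 : ℚ) ^ 4) =
      (1 : ℚ) • pairMonomial 0 6 + (-2 : ℚ) • pairMonomial 1 5 + (-1 : ℚ) • pairMonomial 2 4 + (4 : ℚ) • pairMonomial 3 3 + (-1 : ℚ) • pairMonomial 4 2 + (-2 : ℚ) • pairMonomial 5 1 + (1 : ℚ) • pairMonomial 6 0 := by
    funext p
    simp only [Pi.add_apply, Pi.smul_apply, smul_eq_mul, pairMonomial]
    ring
  rw [e]
  simp only [map_add, map_smul, integ_pairMonomial_eq]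
  simp only [thetaNorm_even (show Even 0 by decide), thetaNorm_even (show Even 2 by decide), thetaNorm_even (show Even 4 by decide), thetaNorm_even (show Even 6 by decide)]
  algebra

theorem integ_2_2 :
    integ locFin_theta_mul_theta (fun p => (p.1 + p.2 - 1 : ℚ) ^ 2 * (p.1 - p.2 : ℚ) ^ 2) =
      thetaMom 1 ^ 2 * (0) := by
  have e : (fun p : ℤ × ℤ => (p.1 + p.2 - 1 : ℚ) ^ 2 * (p.1 - p.2 : ℚ) ^ 2) =
      (1 : ℚ) • pairMonomial 0 4 + (-2 : ℚ) • pairMonomial 2 2 + (1 : ℚ) • pairMonomial 4 0 := by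
    funext p
    simp only [Pi.add_apply, Pi.smul_apply, smul_eq_mul, pairMonomial]
    ring
  rw [e]
  simp only [map_add, map_smul, integ_pairMonomial_eq]
  simp only [thetaNorm_even (show Even 0 by decide), thetaNorm_even (show Even 2 by decide), thetaNorm_even (show Even 4 by decide)]
  algebra

theorem integ_2_0 :
    integ locFin_theta_mul_theta (fun p => (p.1 + p.2 - 1 : ℚ) ^ 2 * (p.1 - p.2 : ℚ) ^ 0) =
      thetaMom 1 ^ 2 * ((2 : ℚ) • (thetaNorm 1 * thetaNorm 1)) := by
  have e : (fun p : ℤ × ℤ => (p.1 + p.2 - 1 : ℚ) ^ 2 * (p.1 - p.2 : ℚ) ^ 0) =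
      (1 : ℚ) • pairMonomial 0 2 + (2 : ℚ) • pairMonomial 1 1 + (1 : ℚ) • pairMonomial 2 0 := by
    funext p
    simp only [Pi.add_apply, Pi.smul_apply, smul_eq_mul, pairMonomial]
    ring
  rw [e]
  simp only [map_add, map_smul, integ_pairMonomial_eq]
  simp only [thetaNorm_even (show Even 0 by decide), thetaNorm_even (show Even 2 by decide)]
  algebra

theorem integ_6_4 :
    integ locFin_theta_mul_theta (fun p => (p.1 + p.2 - 1 : ℚ) ^ 6 * (p.1 - p.2 : ℚ) ^ 4) =
      thetaMom 1 ^ 2 * ((4 : ℚ) • (thetaNorm 1 * thetaNorm 9) + (-16 : ℚ) • (thetaNorm 3 * thetaNorm 7) + (12 : ℚ) • (thetaNorm 5 * thetaNorm 5)) := by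
  have e : (fun p : ℤ × ℤ => (p.1 + p.2 - 1 : ℚ) ^ 6 * (p.1 - p.2 : ℚ) ^ 4) =
      (1 : ℚ) • pairMonomial 0 10 + (2 : ℚ) • pairMonomial 1 9 + (-3 : ℚ) • pairMonomial 2 8 + (-8 : ℚ) • pairMonomial 3 7 + (2 : ℚ) • pairMonomial 4 6 + (12 : ℚ) • pairMonomial 5 5 + (2 : ℚ) • pairMonomial 6 4 + (-8 : ℚ) • pairMonomial 7 3 + (-3 : ℚ) • pairMonomial 8 2 + (2 : ℚ) • pairMonomial 9 1 + (1 : ℚ) • pairMonomial 10 0 := by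
    funext p
    simp only [Pi.add_apply, Pi.smul_apply, smul_eq_mul, pairMonomial]
    ring
  rw [e]
  simp only [map_add, map_smul, integ_pairMonomial_eq]
  simp only [thetaNorm_even (show Even 0 by decide), thetaNorm_even (show Even 2 by decide), thetaNorm_even (show Even 4 by decide), thetaNorm_even (show Even 6 by decide), thetaNorm_even (show Even 8 by decide), thetaNorm_even (show Even 10 by decide)]
  algebra

theorem integ_6_2 :
    integ locFin_theta_mul_theta (fun p => (p.1 + p.2 - 1 : ℚ) ^ 6 * (p.1 - p.2 : ℚ) ^ 2) =
      thetaMom 1 ^ 2 * ((8 : ℚ) • (thetaNorm 1 * thetaNorm 7) + (-8 : ℚ) • (thetaNorm 3 * thetaNorm 5)) := by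
  have e : (fun p : ℤ × ℤ => (p.1 + p.2 - 1 : ℚ) ^ 6 * (p.1 - p.2 : ℚ) ^ 2) =
      (1 : ℚ) • pairMonomial 0 8 + (4 : ℚ) • pairMonomial 1 7 + (4 : ℚ) • pairMonomial 2 6 + (-4 : ℚ) • pairMonomial 3 5 + (-10 : ℚ) • pairMonomial 4 4 + (-4 : ℚ) • pairMonomial 5 3 + (4 : ℚ) • pairMonomial 6 2 + (4 : ℚ) • pairMonomial 7 1 + (1 : ℚ) • pairMonomial 8 0 := by
    funext p
    simp only [Pi.add_apply, Pi.smul_apply, smul_eq_mul, pairMonomial]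
    ring
  rw [e]
  simp only [map_add, map_smul, integ_pairMonomial_eq]
  simp only [thetaNorm_even (show Even 0 by decide), thetaNorm_even (show Even 2 by decide), thetaNorm_even (show Even 4 by decide), thetaNorm_even (show Even 6 by decide), thetaNorm_even (show Even 8 by decide)]
  algebra

theorem integ_6_0 :
    integ locFin_theta_mul_theta (fun p => (p.1 + p.2 - 1 : ℚ) ^ 6 * (p.1 - p.2 : ℚ) ^ 0) =
      thetaMom 1 ^ 2 * ((12 : ℚ) • (thetaNorm 1 * thetaNorm 5) + (20 : ℚ) • (thetaNorm 3 * thetaNorm 3)) := by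
  have e : (fun p : ℤ × ℤ => (p.1 + p.2 - 1 : ℚ) ^ 6 * (p.1 - p.2 : ℚ) ^ 0) =
      (1 : ℚ) • pairMonomial 0 6 + (6 : ℚ) • pairMonomial 1 5 + (15 : ℚ) • pairMonomial 2 4 + (20 : ℚ) • pairMonomial 3 3 + (15 : ℚ) • pairMonomial 4 2 + (6 : ℚ) • pairMonomial 5 1 + (1 : ℚ) • pairMonomial 6 0 := by
    funext p
    simp only [Pi.add_apply, Pi.smul_apply, smul_eq_mul, pairMonomial]
    ring
  rw [e]
  simp only [map_add, map_smul, integ_pairMonomial_eq]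
  simp only [thetaNorm_even (show Even 0 by decide), thetaNorm_even (show Even 2 by decide), thetaNorm_even (show Even 4 by decide), thetaNorm_even (show Even 6 by decide)]
  algebra

/-- The analogue of the Eisenstein series of weight two. -/
noncomputable def eisTwo : ℚ⟦X⟧ := (4 : ℚ) • thetaNorm 3

/-- The analogue of the Eisenstein series of weight four. -/
noncomputable def eisFour : ℚ⟦X⟧ := eisTwo ^ 2 - (12 : ℚ) • euler eisTwo

/-- The analogue of the Eisenstein series of weight six. -/
noncomputable def eisSix : ℚ⟦X⟧ := eisTwo * eisFour - (3 : ℚ) • euler eisFour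

/-- The first two Ramanujan equations hold by the choice of `eisFour` and `eisSix`; no divisor-sum
expansions are needed. -/
theorem euler_eisTwo : euler eisTwo = (1 / 12 : ℚ) • (eisTwo ^ 2 - eisFour) := by
  rw [eisFour]
  algebra

theorem euler_eisFour : euler eisFour = (1 / 3 : ℚ) • (eisTwo * eisFour - eisSix) := by
  rw [eisSix]
  algebra

theorem thetaNorm_three : thetaNorm 3 = (1 / 4 : ℚ) • eisTwo := by
  rw [eisTwo]
  algebra

theorem thetaNorm_five : thetaNorm 5 =
    ((5/48 : ℚ) • eisTwo^2 + (-1/24 : ℚ) • eisFour) := by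
  rw [thetaNorm_add_two 3, thetaNorm_three]
  simp only [map_add, Derivation.leibniz, Derivation.leibniz_pow, Derivation.map_smul,
    Derivation.map_one_eq_zero, smul_eq_mul, euler_eisTwo, euler_eisFour]
  algebra

theorem thetaNorm_seven : thetaNorm 7 =
    ((35/576 : ℚ) • eisTwo^3 + (-7/96 : ℚ) • (eisTwo*eisFour) + (1/36 : ℚ) • eisSix) := by
  rw [thetaNorm_add_two 5, thetaNorm_five, thetaNorm_three]
  simp only [map_add, Derivation.leibniz, Derivation.leibniz_pow, Derivation.map_smul,
    Derivation.map_one_eq_zero, smul_eq_mul, euler_eisTwo, euler_eisFour]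
  algebra

/-- The third of Ramanujan's differential equations, from Hirota's bilinear equation. -/
theorem euler_eisSix : euler eisSix = (1 / 2 : ℚ) • (eisTwo * eisSix - eisFour ^ 2) := by
  have h9 : thetaNorm 9 = (1/18 : ℚ) • euler eisSix +
      ((35/768 : ℚ) • eisTwo^4 + (-7/64 : ℚ) • (eisTwo^2*eisFour) + (1/18 : ℚ) • (eisTwo*eisSix) + (7/576 : ℚ) • eisFour^2) := by
    rw [thetaNorm_add_two 7, thetaNorm_seven, thetaNorm_three]
    simp only [map_add, Derivation.leibniz, Derivation.leibniz_pow, Derivation.map_smul,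
      Derivation.map_one_eq_zero, smul_eq_mul, euler_eisTwo, euler_eisFour]
    algebra
  obtain ⟨α, β, h⟩ := exists_integ_relation
  -- Exponent 0 determines α and exponent 2 determines β. Exponent 4 would give nothing new: there
  -- the left weight is (x^2 - y^2)^4, which integrates to 0, and the right side then cancels.
  -- Exponent 6 is the first genuine constraint; it contains the ninth moment and hence the
  -- derivative of `eisSix`.
  have h0 := h 0
  have h2 := h 2
  have h6 := h 6
  rw [integ_0_4, integ_0_2, integ_0_0] at h0
  rw [integ_2_4, integ_2_2, integ_2_0] at h2
  rw [integ_6_4, integ_6_2, integ_6_0] at h6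
  have hθ : thetaMom 1 ^ 2 ≠ 0 := pow_ne_zero 2 thetaMom_one_ne_zero
  rw [mul_left_comm, mul_left_comm β, ← mul_add] at h0 h2 h6
  replace h0 := mul_left_cancel₀ hθ h0
  replace h2 := mul_left_cancel₀ hθ h2
  replace h6 := mul_left_cancel₀ hθ h6
  rw [thetaNorm_one, thetaNorm_three] at h0
  rw [thetaNorm_one, thetaNorm_three, thetaNorm_five] at h2
  rw [thetaNorm_one, thetaNorm_three, thetaNorm_five, thetaNorm_seven, h9] at h6
  have hα : α = eisTwo := by
    linear_combination (norm := algebra) (1 / 2 : ℚ) • h0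
  rw [hα] at h2 h6
  have hβ : β = (1 / 12 : ℚ) • (eisFour - eisTwo ^ 2) := by
    linear_combination (norm := algebra) (-1 / 2 : ℚ) • h2
  rw [hβ] at h6
  linear_combination (norm := algebra) (9 / 2 : ℚ) • h6

/-! ### Moment relations extracted from the product formulas. -/

/-- The binomial convolution of two sequences. -/
noncomputable def binomConv (a b : ℕ → ℚ⟦X⟧) (n : ℕ) : ℚ⟦X⟧ :=
  ∑ i ∈ Finset.range (n + 1), (n.choose i : ℚ) • (a i * b (n - i))

theorem coeff_mul_of_exponential {f g : ℚ⟦X⟧⟦X⟧} {a b : ℕ → ℚ⟦X⟧}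
    (hf : ∀ i, coeff i f = (i.factorial : ℚ)⁻¹ • a i)
    (hg : ∀ i, coeff i g = (i.factorial : ℚ)⁻¹ • b i) (n : ℕ) :
    coeff n (f * g) = (n.factorial : ℚ)⁻¹ • binomConv a b n := by
  rw [coeff_mul, Finset.Nat.sum_antidiagonal_eq_sum_range_succ fun i j => coeff i f * coeff j g,
    binomConv, Finset.smul_sum]
  refine Finset.sum_congr rfl fun i hi => ?_
  have hi : i ≤ n := Nat.lt_succ_iff.1 (Finset.mem_range.1 hi)
  rw [hf, hg, smul_mul_smul_comm, smul_smul, Nat.cast_choose ℚ hi]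
  have h1 := Nat.cast_ne_zero (R := ℚ).2 n.factorial_ne_zero
  have h2 := Nat.cast_ne_zero (R := ℚ).2 i.factorial_ne_zero
  have h3 := Nat.cast_ne_zero (R := ℚ).2 (n - i).factorial_ne_zero
  congr 1
  field_simp

theorem binomConv_mul_mul (u v : ℚ⟦X⟧) (a b : ℕ → ℚ⟦X⟧) (n : ℕ) :
    binomConv (fun i => u * a i) (fun i => v * b i) n = u * v * binomConv a b n := by
  rw [binomConv, binomConv, Finset.mul_sum]
  refine Finset.sum_congr rfl fun i _ => ?_
  rw [mul_smul_comm, mul_mul_mul_comm]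

/-- The generating series of the crank moments divided by that of the partition numbers. -/
noncomputable def crankNorm (k : ℕ) : ℚ⟦X⟧ := mom 0 k crankSeries * partSeries⁻¹

theorem mom_crankSeries (k : ℕ) : mom 0 k crankSeries = partSeries * crankNorm k := by
  have h : constantCoeff partSeries ≠ 0 := by
    rw [constantCoeff_partSeries]
    exact one_ne_zero
  rw [crankNorm, mul_left_comm, PowerSeries.mul_inv_cancel _ h, mul_one]

theorem crankNorm_zero : crankNorm 0 = 1 := by
  refine mul_left_cancel₀ partSeries_ne_zero ?_
  rw [← mom_crankSeries, mom_zero_crankSeries, mul_one]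

/-- The t^n coefficient of the product formula for Θ·C, divided by P and the first theta moment.
Since the zeroth theta moment is 0 and the first is normalized to 1, it determines the crank moment
of order n - 1 from the lower ones. -/
theorem binomConv_thetaNorm_crankNorm (n : ℕ) :
    binomConv thetaNorm crankNorm n = ((1 / 2 : ℚ) ^ n - (-1 / 2) ^ n) • 1 := by
  have h := congrArg (coeff n) (egf_crank_mul_theta locFin_crankSeries crankSeries_recurrence)
  rw [coeff_mul_of_exponential (a := fun i => thetaMom 1 * thetaNorm i)
    (b := fun i => partSeries * crankNorm i) (fun i => by rw [coeff_egf, ← thetaMom_eq]; rfl)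
    (fun i => by rw [coeff_egf, mom_crankSeries]), binomConv_mul_mul, coeff_C_mul, sinhSeries,
    map_sub, coeff_expSeries, coeff_expSeries, mom_zero_crankSeries, ← map_sub, ← sub_div,
    Algebra.algebraMap_eq_smul_one, ← mul_smul_comm, mul_comm (thetaMom 1)] at h
  have h := mul_left_cancel₀ (mul_ne_zero partSeries_ne_zero thetaMom_one_ne_zero) h
  have hn := Nat.cast_ne_zero (R := ℚ).2 n.factorial_ne_zero
  refine eq_of_smul_eq_smul (inv_ne_zero hn) (h.trans ?_)
  rw [smul_smul, div_eq_inv_mul]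

/-- In the relation of even order k + 1 the right side is 0. Even theta moments vanish, and the odd
ones beyond the first meet odd crank moments of smaller order, so only (k + 1) times the k-th crank
moment is left. -/
theorem crankNorm_odd {k : ℕ} (hk : Odd k) : crankNorm k = 0 := by
  induction k using Nat.strong_induction_on with
  | _ k ih =>
    have h := binomConv_thetaNorm_crankNorm (k + 1)
    rw [binomConv, Finset.sum_eq_single 1, neg_div, (hk.add_odd odd_one).neg_pow, sub_self,
      zero_smul, Nat.choose_one_right, thetaNorm_one, one_mul, Nat.add_sub_cancel] at h
    · exact (smul_eq_zero.1 h).resolve_left (Nat.cast_ne_zero.2 k.succ_ne_zero)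
    · intro i hi h1
      rcases Nat.even_or_odd i with he | ho
      · rw [thetaNorm_even he, zero_mul, smul_zero]
      · have hi := Finset.mem_range.1 hi
        have hi' : i ≤ k + 1 := by lia
        have h0 : 0 < i := ho.pos
        rw [ih _ (by lia) ((Nat.odd_sub hi').2 ?_), mul_zero, smul_zero]
        exact iff_of_false (Nat.not_odd_iff_even.2 (hk.add_odd odd_one))
          (Nat.not_even_iff_odd.2 ho)
    · intro h1
      exact absurd (Finset.mem_range.2 (by lia)) h1

/-- The generating series of the rank moments. -/
noncomputable def rankMom (k : ℕ) : ℚ⟦X⟧ := mom 0 k fun m => rankLe m - rankLe (m - 1)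

theorem rankMom_eq_integ (k : ℕ) :
    rankMom k = integ locFin_rankSeries fun m => (m : ℚ) ^ k := by
  rw [rankMom, mom_eq_integ locFin_rankSeries]
  simp only [sub_zero]

/-- The moments of the heat operator applied to the rank series, in terms of crank moments. -/
theorem mom_heatFamily_rankSeries (r : ℕ) :
    integ locFin_rankSeries
        (fun m : ℤ => (m ^ 2 + m) / 2 * ((m - 1 : ℚ) ^ r - 2 * m ^ r + (m + 1) ^ r) +
          m ^ (r + 1) - m * (m + 1) ^ r + m ^ r) +
      3 * euler (integ locFin_rankSeries fun m : ℤ => (m - 1 : ℚ) ^ r - 2 * m ^ r + (m + 1) ^ r) =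
      partSeries * binomConv (binomConv crankNorm crankNorm) crankNorm r := by
  have h := congrArg (coeff r) (rank_crank_equation partSeries_ne_zero locFin_rankSeries
    mom_zero_rankSeries rankLe_recurrence locFin_crankSeries mom_zero_crankSeries
    crankSeries_recurrence)
  have h1 : ∀ i, coeff i (egf 0 crankSeries) =
      (i.factorial : ℚ)⁻¹ • (partSeries * crankNorm i) := fun i => by
    rw [coeff_egf, mom_crankSeries]
  rw [pow_three', coeff_mul_of_exponential (fun i => by
    rw [coeff_mul_of_exponential h1 h1, binomConv_mul_mul]) h1, binomConv_mul_mul, coeff_C_mul,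
    coeff_egf, mul_smul_comm, mom_heatFamily locFin_rankSeries] at h
  have hr := Nat.cast_ne_zero (R := ℚ).2 r.factorial_ne_zero
  have h := eq_of_smul_eq_smul (inv_ne_zero hr) h
  refine mul_left_cancel₀ (pow_ne_zero 2 partSeries_ne_zero) (h.trans ?_)
  ring

/-- The iterated derivatives of the generating series of the second rank moments. -/
noncomputable def rankDeriv (k : ℕ) : ℚ⟦X⟧ := euler^[k] (rankMom 2)

theorem euler_rankDeriv (k : ℕ) : euler (rankDeriv k) = rankDeriv (k + 1) :=
  (Function.iterate_succ_apply' euler k _).symm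

theorem coeff_rankDeriv (k n : ℕ) : coeff n (rankDeriv k) = n ^ k * rankMoment 2 n := by
  induction k with
  | zero => rw [rankDeriv, Function.iterate_zero_apply, rankMom, coeff_mom_rankSeries, pow_zero,
      one_mul]
  | succ k ih => rw [← euler_rankDeriv, coeff_euler, ih, pow_succ', mul_assoc]

/-! ### Theta and crank moments as polynomials in `eisTwo`, `eisFour`, `eisSix`. -/

theorem thetaNorm_nine : thetaNorm 9 =
    ((35 / 768 : ℚ) • eisTwo ^ 4 + (-7 / 64 : ℚ) • (eisTwo ^ 2 * eisFour) + (1 / 12 : ℚ) • (eisTwo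
      * eisSix) + (-1 / 64 : ℚ) • eisFour ^ 2) := by
  rw [thetaNorm_add_two 7, thetaNorm_seven, thetaNorm_three]
  simp only [map_add, Derivation.leibniz, Derivation.leibniz_pow, Derivation.map_smul,
    Derivation.map_one_eq_zero, smul_eq_mul, euler_eisTwo, euler_eisFour, euler_eisSix]
  algebra

theorem thetaNorm_eleven : thetaNorm 11 =
    ((385 / 9216 : ℚ) • eisTwo ^ 5 + (-385 / 2304 : ℚ) • (eisTwo ^ 3 * eisFour) + (55 / 288 : ℚ) •
      (eisTwo ^ 2 * eisSix) + (-55 / 768 : ℚ) • (eisTwo * eisFour ^ 2) + (1 / 144 : ℚ) • (eisFour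
      * eisSix)) := by
  rw [thetaNorm_add_two 9, thetaNorm_nine, thetaNorm_three]
  simp only [map_add, Derivation.leibniz, Derivation.leibniz_pow, Derivation.map_smul,
    Derivation.map_one_eq_zero, smul_eq_mul, euler_eisTwo, euler_eisFour, euler_eisSix]
  algebra

theorem thetaNorm_thirteen : thetaNorm 13 =
    ((5005 / 110592 : ℚ) • eisTwo ^ 6 + (-5005 / 18432 : ℚ) • (eisTwo ^ 4 * eisFour) + (715 / 1728
      : ℚ) • (eisTwo ^ 3 * eisSix) + (-715 / 3072 : ℚ) • (eisTwo ^ 2 * eisFour ^ 2) + (13 / 288 :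
      ℚ) • (eisTwo * eisFour * eisSix) + (23 / 4608 : ℚ) • eisFour ^ 3 + (-1 / 216 : ℚ) • eisSix ^
      2) := by
  rw [thetaNorm_add_two 11, thetaNorm_eleven, thetaNorm_three]
  simp only [map_add, Derivation.leibniz, Derivation.leibniz_pow, Derivation.map_smul,
    Derivation.map_one_eq_zero, smul_eq_mul, euler_eisTwo, euler_eisFour, euler_eisSix]
  algebra

theorem thetaNorm_fifteen : thetaNorm 15 =
    ((25025 / 442368 : ℚ) • eisTwo ^ 7 + (-35035 / 73728 : ℚ) • (eisTwo ^ 5 * eisFour) + (25025 /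
      27648 : ℚ) • (eisTwo ^ 4 * eisSix) + (-25025 / 36864 : ℚ) • (eisTwo ^ 3 * eisFour ^ 2) +
      (455 / 2304 : ℚ) • (eisTwo ^ 2 * eisFour * eisSix) + (805 / 18432 : ℚ) • (eisTwo * eisFour ^
      3) + (-35 / 864 : ℚ) • (eisTwo * eisSix ^ 2) + (-19 / 2304 : ℚ) • (eisFour ^ 2 * eisSix)) := by
  rw [thetaNorm_add_two 13, thetaNorm_thirteen, thetaNorm_three]
  simp only [map_add, Derivation.leibniz, Derivation.leibniz_pow, Derivation.map_smul,
    Derivation.map_one_eq_zero, smul_eq_mul, euler_eisTwo, euler_eisFour, euler_eisSix]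
  algebra

/-- Here and for the higher even orders k, the relation of order k + 1 contains the unknown moment
with coefficient k + 1, while the remaining crank moments are already known. -/
theorem crankNorm_two : crankNorm 2 =
    ((-1 / 12 : ℚ) • eisTwo + (1 / 12 : ℚ) • 1) := by
  have h := binomConv_thetaNorm_crankNorm 3
  simp +decide only [binomConv, Finset.sum_range_succ, Finset.range_zero,
    Finset.sum_empty, Nat.reduceAdd, Nat.reduceSub, Nat.choose, zero_mul, mul_zero, smul_zero,
    add_zero, zero_add, Nat.cast_ofNat, Nat.cast_one, one_smul, mul_one, one_mul, thetaNorm_even,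
    crankNorm_odd, crankNorm_zero,
    thetaNorm_one, thetaNorm_three] at h
  linear_combination (norm := algebra) (1 / 3 : ℚ) • h

theorem crankNorm_four : crankNorm 4 =
    ((1 / 48 : ℚ) • eisTwo ^ 2 + (1 / 120 : ℚ) • eisFour + (-1 / 24 : ℚ) • eisTwo + (1 / 80 : ℚ) •
      1) := by
  have h := binomConv_thetaNorm_crankNorm 5
  simp +decide only [binomConv, Finset.sum_range_succ, Finset.range_zero,
    Finset.sum_empty, Nat.reduceAdd, Nat.reduceSub, Nat.choose, zero_mul, mul_zero, smul_zero,
    add_zero, zero_add, Nat.cast_ofNat, Nat.cast_one, one_smul, mul_one, one_mul, thetaNorm_even,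
    crankNorm_odd, crankNorm_zero, crankNorm_two,
    thetaNorm_one, thetaNorm_three, thetaNorm_five] at h
  linear_combination (norm := algebra) (1 / 5 : ℚ) • h

theorem crankNorm_six : crankNorm 6 =
    ((-5 / 576 : ℚ) • eisTwo ^ 3 + (-1 / 96 : ℚ) • (eisTwo * eisFour) + (-1 / 252 : ℚ) • eisSix +
      (5 / 192 : ℚ) • eisTwo ^ 2 + (1 / 96 : ℚ) • eisFour + (-1 / 64 : ℚ) • eisTwo + (1 / 448 : ℚ)
      • 1) := by
  have h := binomConv_thetaNorm_crankNorm 7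
  simp +decide only [binomConv, Finset.sum_range_succ, Finset.range_zero,
    Finset.sum_empty, Nat.reduceAdd, Nat.reduceSub, Nat.choose, zero_mul, mul_zero, smul_zero,
    add_zero, zero_add, Nat.cast_ofNat, Nat.cast_one, one_smul, mul_one, one_mul, thetaNorm_even,
    crankNorm_odd, crankNorm_zero, crankNorm_two, crankNorm_four,
    thetaNorm_one, thetaNorm_three, thetaNorm_five, thetaNorm_seven] at h
  linear_combination (norm := algebra) (1 / 7 : ℚ) • h

theorem crankNorm_eight : crankNorm 8 =
    ((35 / 6912 : ℚ) • eisTwo ^ 4 + (7 / 576 : ℚ) • (eisTwo ^ 2 * eisFour) + (1 / 108 : ℚ) •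
      (eisTwo * eisSix) + (19 / 2880 : ℚ) • eisFour ^ 2 + (-35 / 1728 : ℚ) • eisTwo ^ 3 + (-7 /
      288 : ℚ) • (eisTwo * eisFour) + (-1 / 108 : ℚ) • eisSix + (7 / 384 : ℚ) • eisTwo ^ 2 + (7 /
      960 : ℚ) • eisFour + (-1 / 192 : ℚ) • eisTwo + (1 / 2304 : ℚ) • 1) := by
  have h := binomConv_thetaNorm_crankNorm 9
  simp +decide only [binomConv, Finset.sum_range_succ, Finset.range_zero,
    Finset.sum_empty, Nat.reduceAdd, Nat.reduceSub, Nat.choose, zero_mul, mul_zero, smul_zero,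
    add_zero, zero_add, Nat.cast_ofNat, Nat.cast_one, one_smul, mul_one, one_mul, thetaNorm_even,
    crankNorm_odd, crankNorm_zero, crankNorm_two, crankNorm_four, crankNorm_six,
    thetaNorm_one, thetaNorm_three, thetaNorm_five, thetaNorm_seven, thetaNorm_nine] at h
  linear_combination (norm := algebra) (1 / 9 : ℚ) • h

theorem crankNorm_ten : crankNorm 10 =
    ((-35 / 9216 : ℚ) • eisTwo ^ 5 + (-35 / 2304 : ℚ) • (eisTwo ^ 3 * eisFour) + (-5 / 288 : ℚ) •
      (eisTwo ^ 2 * eisSix) + (-19 / 768 : ℚ) • (eisTwo * eisFour ^ 2) + (-23 / 1584 : ℚ) •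
      (eisFour * eisSix) + (175 / 9216 : ℚ) • eisTwo ^ 4 + (35 / 768 : ℚ) • (eisTwo ^ 2 * eisFour)
      + (5 / 144 : ℚ) • (eisTwo * eisSix) + (19 / 768 : ℚ) • eisFour ^ 2 + (-35 / 1536 : ℚ) •
      eisTwo ^ 3 + (-7 / 256 : ℚ) • (eisTwo * eisFour) + (-1 / 96 : ℚ) • eisSix + (5 / 512 : ℚ) •
      eisTwo ^ 2 + (1 / 256 : ℚ) • eisFour + (-5 / 3072 : ℚ) • eisTwo + (1 / 11264 : ℚ) • 1) := by
  have h := binomConv_thetaNorm_crankNorm 11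
  simp +decide only [binomConv, Finset.sum_range_succ, Finset.range_zero,
    Finset.sum_empty, Nat.reduceAdd, Nat.reduceSub, Nat.choose, zero_mul, mul_zero, smul_zero,
    add_zero, zero_add, Nat.cast_ofNat, Nat.cast_one, one_smul, mul_one, one_mul, thetaNorm_even,
    crankNorm_odd, crankNorm_zero, crankNorm_two, crankNorm_four, crankNorm_six, crankNorm_eight,
    thetaNorm_one, thetaNorm_three, thetaNorm_five, thetaNorm_seven, thetaNorm_nine, thetaNorm_eleven] at h
  linear_combination (norm := algebra) (1 / 11 : ℚ) • h

theorem crankNorm_twelve : crankNorm 12 =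
    ((385 / 110592 : ℚ) • eisTwo ^ 6 + (385 / 18432 : ℚ) • (eisTwo ^ 4 * eisFour) + (55 / 1728 :
      ℚ) • (eisTwo ^ 3 * eisSix) + (209 / 3072 : ℚ) • (eisTwo ^ 2 * eisFour ^ 2) + (23 / 288 : ℚ)
      • (eisTwo * eisFour * eisSix) + (10181 / 299520 : ℚ) • eisFour ^ 3 + (293 / 19656 : ℚ) •
      eisSix ^ 2 + (-385 / 18432 : ℚ) • eisTwo ^ 5 + (-385 / 4608 : ℚ) • (eisTwo ^ 3 * eisFour) +
      (-55 / 576 : ℚ) • (eisTwo ^ 2 * eisSix) + (-209 / 1536 : ℚ) • (eisTwo * eisFour ^ 2) + (-23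
      / 288 : ℚ) • (eisFour * eisSix) + (385 / 12288 : ℚ) • eisTwo ^ 4 + (77 / 1024 : ℚ) • (eisTwo
      ^ 2 * eisFour) + (11 / 192 : ℚ) • (eisTwo * eisSix) + (209 / 5120 : ℚ) • eisFour ^ 2 + (-55
      / 3072 : ℚ) • eisTwo ^ 3 + (-11 / 512 : ℚ) • (eisTwo * eisFour) + (-11 / 1344 : ℚ) • eisSix
      + (55 / 12288 : ℚ) • eisTwo ^ 2 + (11 / 6144 : ℚ) • eisFour + (-1 / 2048 : ℚ) • eisTwo + (1
      / 53248 : ℚ) • 1) := by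
  have h := binomConv_thetaNorm_crankNorm 13
  simp +decide only [binomConv, Finset.sum_range_succ, Finset.range_zero,
    Finset.sum_empty, Nat.reduceAdd, Nat.reduceSub, Nat.choose, zero_mul, mul_zero, smul_zero,
    add_zero, zero_add, Nat.cast_ofNat, Nat.cast_one, one_smul, mul_one, one_mul, thetaNorm_even,
    crankNorm_odd, crankNorm_zero, crankNorm_two, crankNorm_four, crankNorm_six, crankNorm_eight, crankNorm_ten,
    thetaNorm_one, thetaNorm_three, thetaNorm_five, thetaNorm_seven, thetaNorm_nine, thetaNorm_eleven, thetaNorm_thirteen] at h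
  linear_combination (norm := algebra) (1 / 13 : ℚ) • h

theorem crankNorm_fourteen : crankNorm 14 =
    ((-5005 / 1327104 : ℚ) • eisTwo ^ 7 + (-7007 / 221184 : ℚ) • (eisTwo ^ 5 * eisFour) + (-5005 /
      82944 : ℚ) • (eisTwo ^ 4 * eisSix) + (-19019 / 110592 : ℚ) • (eisTwo ^ 3 * eisFour ^ 2) +
      (-2093 / 6912 : ℚ) • (eisTwo ^ 2 * eisFour * eisSix) + (-71267 / 276480 : ℚ) • (eisTwo *
      eisFour ^ 3) + (-293 / 2592 : ℚ) • (eisTwo * eisSix ^ 2) + (-7781 / 34560 : ℚ) • (eisFour ^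
      2 * eisSix) + (35035 / 1327104 : ℚ) • eisTwo ^ 6 + (35035 / 221184 : ℚ) • (eisTwo ^ 4 *
      eisFour) + (5005 / 20736 : ℚ) • (eisTwo ^ 3 * eisSix) + (19019 / 36864 : ℚ) • (eisTwo ^ 2 *
      eisFour ^ 2) + (2093 / 3456 : ℚ) • (eisTwo * eisFour * eisSix) + (71267 / 276480 : ℚ) •
      eisFour ^ 3 + (293 / 2592 : ℚ) • eisSix ^ 2 + (-7007 / 147456 : ℚ) • eisTwo ^ 5 + (-7007 /
      36864 : ℚ) • (eisTwo ^ 3 * eisFour) + (-1001 / 4608 : ℚ) • (eisTwo ^ 2 * eisSix) + (-19019 /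
      61440 : ℚ) • (eisTwo * eisFour ^ 2) + (-2093 / 11520 : ℚ) • (eisFour * eisSix) + (5005 /
      147456 : ℚ) • eisTwo ^ 4 + (1001 / 12288 : ℚ) • (eisTwo ^ 2 * eisFour) + (143 / 2304 : ℚ) •
      (eisTwo * eisSix) + (2717 / 61440 : ℚ) • eisFour ^ 2 + (-5005 / 442368 : ℚ) • eisTwo ^ 3 +
      (-1001 / 73728 : ℚ) • (eisTwo * eisFour) + (-143 / 27648 : ℚ) • eisSix + (91 / 49152 : ℚ) •
      eisTwo ^ 2 + (91 / 122880 : ℚ) • eisFour + (-7 / 49152 : ℚ) • eisTwo + (1 / 245760 : ℚ) • 1) := by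
  have h := binomConv_thetaNorm_crankNorm 15
  simp +decide only [binomConv, Finset.sum_range_succ, Finset.range_zero,
    Finset.sum_empty, Nat.reduceAdd, Nat.reduceSub, Nat.choose, zero_mul, mul_zero, smul_zero,
    add_zero, zero_add, Nat.cast_ofNat, Nat.cast_one, one_smul, mul_one, one_mul, thetaNorm_even,
    crankNorm_odd, crankNorm_zero, crankNorm_two, crankNorm_four, crankNorm_six, crankNorm_eight, crankNorm_ten, crankNorm_twelve,
    thetaNorm_one, thetaNorm_three, thetaNorm_five, thetaNorm_seven, thetaNorm_nine, thetaNorm_eleven, thetaNorm_thirteen, thetaNorm_fifteen] at h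
  linear_combination (norm := algebra) (1 / 15 : ℚ) • h

/-- The coefficients of the square of the normalized crank series, an intermediate stage for the
cube in the rank-crank equation. -/
theorem binomConv_crankNorm_zero : binomConv crankNorm crankNorm 0 =
    ((1 : ℚ) • 1) := by
  simp +decide only [binomConv, Finset.sum_range_succ, Finset.range_zero,
    Finset.sum_empty, Nat.reduceAdd, Nat.reduceSub, Nat.choose, zero_mul, mul_zero, smul_zero,
    add_zero, zero_add, Nat.cast_ofNat, Nat.cast_one, one_smul, mul_one, one_mul, crankNorm_odd,
    crankNorm_zero]

theorem binomConv_crankNorm_two : binomConv crankNorm crankNorm 2 =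
    ((-1 / 6 : ℚ) • eisTwo + (1 / 6 : ℚ) • 1) := by
  simp +decide only [binomConv, Finset.sum_range_succ, Finset.range_zero,
    Finset.sum_empty, Nat.reduceAdd, Nat.reduceSub, Nat.choose, zero_mul, mul_zero, smul_zero,
    add_zero, zero_add, Nat.cast_ofNat, Nat.cast_one, one_smul, mul_one, one_mul, crankNorm_odd,
    crankNorm_zero, crankNorm_two]
  algebra

theorem binomConv_crankNorm_four : binomConv crankNorm crankNorm 4 =
    ((1 / 12 : ℚ) • eisTwo ^ 2 + (1 / 60 : ℚ) • eisFour + (-1 / 6 : ℚ) • eisTwo + (1 / 15 : ℚ) •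
      1) := by
  simp +decide only [binomConv, Finset.sum_range_succ, Finset.range_zero,
    Finset.sum_empty, Nat.reduceAdd, Nat.reduceSub, Nat.choose, zero_mul, mul_zero, smul_zero,
    add_zero, zero_add, Nat.cast_ofNat, Nat.cast_one, one_smul, mul_one, one_mul, crankNorm_odd,
    crankNorm_zero, crankNorm_two, crankNorm_four]
  algebra

theorem binomConv_crankNorm_six : binomConv crankNorm crankNorm 6 =
    ((-5 / 72 : ℚ) • eisTwo ^ 3 + (-1 / 24 : ℚ) • (eisTwo * eisFour) + (-1 / 126 : ℚ) • eisSix +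
      (5 / 24 : ℚ) • eisTwo ^ 2 + (1 / 24 : ℚ) • eisFour + (-1 / 6 : ℚ) • eisTwo + (1 / 28 : ℚ) •
      1) := by
  simp +decide only [binomConv, Finset.sum_range_succ, Finset.range_zero,
    Finset.sum_empty, Nat.reduceAdd, Nat.reduceSub, Nat.choose, zero_mul, mul_zero, smul_zero,
    add_zero, zero_add, Nat.cast_ofNat, Nat.cast_one, one_smul, mul_one, one_mul, crankNorm_odd,
    crankNorm_zero, crankNorm_two, crankNorm_four, crankNorm_six]
  algebra

theorem binomConv_crankNorm_eight : binomConv crankNorm crankNorm 8 =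
    ((35 / 432 : ℚ) • eisTwo ^ 4 + (7 / 72 : ℚ) • (eisTwo ^ 2 * eisFour) + (1 / 27 : ℚ) • (eisTwo
      * eisSix) + (13 / 720 : ℚ) • eisFour ^ 2 + (-35 / 108 : ℚ) • eisTwo ^ 3 + (-7 / 36 : ℚ) •
      (eisTwo * eisFour) + (-1 / 27 : ℚ) • eisSix + (7 / 18 : ℚ) • eisTwo ^ 2 + (7 / 90 : ℚ) •
      eisFour + (-1 / 6 : ℚ) • eisTwo + (1 / 45 : ℚ) • 1) := by
  simp +decide only [binomConv, Finset.sum_range_succ, Finset.range_zero,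
    Finset.sum_empty, Nat.reduceAdd, Nat.reduceSub, Nat.choose, zero_mul, mul_zero, smul_zero,
    add_zero, zero_add, Nat.cast_ofNat, Nat.cast_one, one_smul, mul_one, one_mul, crankNorm_odd,
    crankNorm_zero, crankNorm_two, crankNorm_four, crankNorm_six, crankNorm_eight]
  algebra

theorem binomConv_crankNorm_ten : binomConv crankNorm crankNorm 10 =
    ((-35 / 288 : ℚ) • eisTwo ^ 5 + (-35 / 144 : ℚ) • (eisTwo ^ 3 * eisFour) + (-5 / 36 : ℚ) •
      (eisTwo ^ 2 * eisSix) + (-13 / 96 : ℚ) • (eisTwo * eisFour ^ 2) + (-17 / 396 : ℚ) • (eisFour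
      * eisSix) + (175 / 288 : ℚ) • eisTwo ^ 4 + (35 / 48 : ℚ) • (eisTwo ^ 2 * eisFour) + (5 / 18
      : ℚ) • (eisTwo * eisSix) + (13 / 96 : ℚ) • eisFour ^ 2 + (-35 / 36 : ℚ) • eisTwo ^ 3 + (-7 /
      12 : ℚ) • (eisTwo * eisFour) + (-1 / 9 : ℚ) • eisSix + (5 / 8 : ℚ) • eisTwo ^ 2 + (1 / 8 :
      ℚ) • eisFour + (-1 / 6 : ℚ) • eisTwo + (1 / 66 : ℚ) • 1) := by
  simp +decide only [binomConv, Finset.sum_range_succ, Finset.range_zero,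
    Finset.sum_empty, Nat.reduceAdd, Nat.reduceSub, Nat.choose, zero_mul, mul_zero, smul_zero,
    add_zero, zero_add, Nat.cast_ofNat, Nat.cast_one, one_smul, mul_one, one_mul, crankNorm_odd,
    crankNorm_zero, crankNorm_two, crankNorm_four, crankNorm_six, crankNorm_eight, crankNorm_ten]
  algebra

theorem binomConv_crankNorm_twelve : binomConv crankNorm crankNorm 12 =
    ((385 / 1728 : ℚ) • eisTwo ^ 6 + (385 / 576 : ℚ) • (eisTwo ^ 4 * eisFour) + (55 / 108 : ℚ) •
      (eisTwo ^ 3 * eisSix) + (143 / 192 : ℚ) • (eisTwo ^ 2 * eisFour ^ 2) + (17 / 36 : ℚ) •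
      (eisTwo * eisFour * eisSix) + (4583 / 37440 : ℚ) • eisFour ^ 3 + (109 / 2457 : ℚ) • eisSix ^
      2 + (-385 / 288 : ℚ) • eisTwo ^ 5 + (-385 / 144 : ℚ) • (eisTwo ^ 3 * eisFour) + (-55 / 36 :
      ℚ) • (eisTwo ^ 2 * eisSix) + (-143 / 96 : ℚ) • (eisTwo * eisFour ^ 2) + (-17 / 36 : ℚ) •
      (eisFour * eisSix) + (385 / 144 : ℚ) • eisTwo ^ 4 + (77 / 24 : ℚ) • (eisTwo ^ 2 * eisFour) +
      (11 / 9 : ℚ) • (eisTwo * eisSix) + (143 / 240 : ℚ) • eisFour ^ 2 + (-55 / 24 : ℚ) • eisTwo ^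
      3 + (-11 / 8 : ℚ) • (eisTwo * eisFour) + (-11 / 42 : ℚ) • eisSix + (11 / 12 : ℚ) • eisTwo ^
      2 + (11 / 60 : ℚ) • eisFour + (-1 / 6 : ℚ) • eisTwo + (1 / 91 : ℚ) • 1) := by
  simp +decide only [binomConv, Finset.sum_range_succ, Finset.range_zero,
    Finset.sum_empty, Nat.reduceAdd, Nat.reduceSub, Nat.choose, zero_mul, mul_zero, smul_zero,
    add_zero, zero_add, Nat.cast_ofNat, Nat.cast_one, one_smul, mul_one, one_mul, crankNorm_odd,
    crankNorm_zero, crankNorm_two, crankNorm_four, crankNorm_six, crankNorm_eight, crankNorm_ten, crankNorm_twelve]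
  algebra

theorem binomConv_crankNorm_fourteen : binomConv crankNorm crankNorm 14 =
    ((-5005 / 10368 : ℚ) • eisTwo ^ 7 + (-7007 / 3456 : ℚ) • (eisTwo ^ 5 * eisFour) + (-5005 /
      2592 : ℚ) • (eisTwo ^ 4 * eisSix) + (-13013 / 3456 : ℚ) • (eisTwo ^ 3 * eisFour ^ 2) +
      (-1547 / 432 : ℚ) • (eisTwo ^ 2 * eisFour * eisSix) + (-32081 / 17280 : ℚ) • (eisTwo *
      eisFour ^ 3) + (-109 / 162 : ℚ) • (eisTwo * eisSix ^ 2) + (-3671 / 4320 : ℚ) • (eisFour ^ 2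
      * eisSix) + (35035 / 10368 : ℚ) • eisTwo ^ 6 + (35035 / 3456 : ℚ) • (eisTwo ^ 4 * eisFour) +
      (5005 / 648 : ℚ) • (eisTwo ^ 3 * eisSix) + (13013 / 1152 : ℚ) • (eisTwo ^ 2 * eisFour ^ 2) +
      (1547 / 216 : ℚ) • (eisTwo * eisFour * eisSix) + (32081 / 17280 : ℚ) • eisFour ^ 3 + (109 /
      162 : ℚ) • eisSix ^ 2 + (-7007 / 864 : ℚ) • eisTwo ^ 5 + (-7007 / 432 : ℚ) • (eisTwo ^ 3 *
      eisFour) + (-1001 / 108 : ℚ) • (eisTwo ^ 2 * eisSix) + (-13013 / 1440 : ℚ) • (eisTwo *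
      eisFour ^ 2) + (-1547 / 540 : ℚ) • (eisFour * eisSix) + (5005 / 576 : ℚ) • eisTwo ^ 4 +
      (1001 / 96 : ℚ) • (eisTwo ^ 2 * eisFour) + (143 / 36 : ℚ) • (eisTwo * eisSix) + (1859 / 960
      : ℚ) • eisFour ^ 2 + (-1001 / 216 : ℚ) • eisTwo ^ 3 + (-1001 / 360 : ℚ) • (eisTwo * eisFour)
      + (-143 / 270 : ℚ) • eisSix + (91 / 72 : ℚ) • eisTwo ^ 2 + (91 / 360 : ℚ) • eisFour + (-1 /
      6 : ℚ) • eisTwo + (1 / 120 : ℚ) • 1) := by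
  simp +decide only [binomConv, Finset.sum_range_succ, Finset.range_zero,
    Finset.sum_empty, Nat.reduceAdd, Nat.reduceSub, Nat.choose, zero_mul, mul_zero, smul_zero,
    add_zero, zero_add, Nat.cast_ofNat, Nat.cast_one, one_smul, mul_one, one_mul, crankNorm_odd,
    crankNorm_zero, crankNorm_two, crankNorm_four, crankNorm_six, crankNorm_eight, crankNorm_ten, crankNorm_twelve, crankNorm_fourteen]
  algebra

theorem binomConv_crankNorm_crankNorm_two :
    binomConv (binomConv crankNorm crankNorm) crankNorm 2 =
    ((-1 / 4 : ℚ) • eisTwo + (1 / 4 : ℚ) • 1) := by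
  rw [binomConv]
  simp +decide only [Finset.sum_range_succ, Finset.range_zero,
    Finset.sum_empty, Nat.reduceAdd, Nat.reduceSub, Nat.choose, zero_mul, mul_zero, smul_zero,
    add_zero, zero_add, Nat.cast_ofNat, Nat.cast_one, one_smul, mul_one, one_mul, crankNorm_odd,
    crankNorm_zero, crankNorm_two,
    binomConv_crankNorm_zero, binomConv_crankNorm_two]
  algebra

theorem binomConv_crankNorm_crankNorm_four :
    binomConv (binomConv crankNorm crankNorm) crankNorm 4 =
    ((3 / 16 : ℚ) • eisTwo ^ 2 + (1 / 40 : ℚ) • eisFour + (-3 / 8 : ℚ) • eisTwo + (13 / 80 : ℚ) •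
      1) := by
  rw [binomConv]
  simp +decide only [Finset.sum_range_succ, Finset.range_zero,
    Finset.sum_empty, Nat.reduceAdd, Nat.reduceSub, Nat.choose, zero_mul, mul_zero, smul_zero,
    add_zero, zero_add, Nat.cast_ofNat, Nat.cast_one, one_smul, mul_one, one_mul, crankNorm_odd,
    crankNorm_zero, crankNorm_two, crankNorm_four,
    binomConv_crankNorm_zero, binomConv_crankNorm_two, binomConv_crankNorm_four]
  algebra

theorem binomConv_crankNorm_crankNorm_six :
    binomConv (binomConv crankNorm crankNorm) crankNorm 6 =
    ((-15 / 64 : ℚ) • eisTwo ^ 3 + (-3 / 32 : ℚ) • (eisTwo * eisFour) + (-1 / 84 : ℚ) • eisSix +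
      (45 / 64 : ℚ) • eisTwo ^ 2 + (3 / 32 : ℚ) • eisFour + (-39 / 64 : ℚ) • eisTwo + (205 / 1344
      : ℚ) • 1) := by
  rw [binomConv]
  simp +decide only [Finset.sum_range_succ, Finset.range_zero,
    Finset.sum_empty, Nat.reduceAdd, Nat.reduceSub, Nat.choose, zero_mul, mul_zero, smul_zero,
    add_zero, zero_add, Nat.cast_ofNat, Nat.cast_one, one_smul, mul_one, one_mul, crankNorm_odd,
    crankNorm_zero, crankNorm_two, crankNorm_four, crankNorm_six,
    binomConv_crankNorm_zero, binomConv_crankNorm_two, binomConv_crankNorm_four, binomConv_crankNorm_six]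
  algebra

theorem binomConv_crankNorm_crankNorm_eight :
    binomConv (binomConv crankNorm crankNorm) crankNorm 8 =
    ((105 / 256 : ℚ) • eisTwo ^ 4 + (21 / 64 : ℚ) • (eisTwo ^ 2 * eisFour) + (1 / 12 : ℚ) •
      (eisTwo * eisSix) + (11 / 320 : ℚ) • eisFour ^ 2 + (-105 / 64 : ℚ) • eisTwo ^ 3 + (-21 / 32
      : ℚ) • (eisTwo * eisFour) + (-1 / 12 : ℚ) • eisSix + (273 / 128 : ℚ) • eisTwo ^ 2 + (91 /
      320 : ℚ) • eisFour + (-205 / 192 : ℚ) • eisTwo + (671 / 3840 : ℚ) • 1) := by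
  rw [binomConv]
  simp +decide only [Finset.sum_range_succ, Finset.range_zero,
    Finset.sum_empty, Nat.reduceAdd, Nat.reduceSub, Nat.choose, zero_mul, mul_zero, smul_zero,
    add_zero, zero_add, Nat.cast_ofNat, Nat.cast_one, one_smul, mul_one, one_mul, crankNorm_odd,
    crankNorm_zero, crankNorm_two, crankNorm_four, crankNorm_six, crankNorm_eight,
    binomConv_crankNorm_zero, binomConv_crankNorm_two, binomConv_crankNorm_four, binomConv_crankNorm_six, binomConv_crankNorm_eight]
  algebra

theorem binomConv_crankNorm_crankNorm_ten :
    binomConv (binomConv crankNorm crankNorm) crankNorm 10 =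
    ((-945 / 1024 : ℚ) • eisTwo ^ 5 + (-315 / 256 : ℚ) • (eisTwo ^ 3 * eisFour) + (-15 / 32 : ℚ) •
      (eisTwo ^ 2 * eisSix) + (-99 / 256 : ℚ) • (eisTwo * eisFour ^ 2) + (-15 / 176 : ℚ) •
      (eisFour * eisSix) + (4725 / 1024 : ℚ) • eisTwo ^ 4 + (945 / 256 : ℚ) • (eisTwo ^ 2 *
      eisFour) + (15 / 16 : ℚ) • (eisTwo * eisSix) + (99 / 256 : ℚ) • eisFour ^ 2 + (-4095 / 512 :
      ℚ) • eisTwo ^ 3 + (-819 / 256 : ℚ) • (eisTwo * eisFour) + (-13 / 32 : ℚ) • eisSix + (3075 /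
      512 : ℚ) • eisTwo ^ 2 + (205 / 256 : ℚ) • eisFour + (-2013 / 1024 : ℚ) • eisTwo + (2555 /
      11264 : ℚ) • 1) := by
  rw [binomConv]
  simp +decide only [Finset.sum_range_succ, Finset.range_zero,
    Finset.sum_empty, Nat.reduceAdd, Nat.reduceSub, Nat.choose, zero_mul, mul_zero, smul_zero,
    add_zero, zero_add, Nat.cast_ofNat, Nat.cast_one, one_smul, mul_one, one_mul, crankNorm_odd,
    crankNorm_zero, crankNorm_two, crankNorm_four, crankNorm_six, crankNorm_eight, crankNorm_ten,
    binomConv_crankNorm_zero, binomConv_crankNorm_two, binomConv_crankNorm_four, binomConv_crankNorm_six, binomConv_crankNorm_eight, binomConv_crankNorm_ten]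
  algebra

theorem binomConv_crankNorm_crankNorm_twelve :
    binomConv (binomConv crankNorm crankNorm) crankNorm 12 =
    ((10395 / 4096 : ℚ) • eisTwo ^ 6 + (10395 / 2048 : ℚ) • (eisTwo ^ 4 * eisFour) + (165 / 64 :
      ℚ) • (eisTwo ^ 3 * eisSix) + (3267 / 1024 : ℚ) • (eisTwo ^ 2 * eisFour ^ 2) + (45 / 32 : ℚ)
      • (eisTwo * eisFour * eisSix) + (1899 / 6656 : ℚ) • eisFour ^ 3 + (193 / 2184 : ℚ) • eisSix
      ^ 2 + (-31185 / 2048 : ℚ) • eisTwo ^ 5 + (-10395 / 512 : ℚ) • (eisTwo ^ 3 * eisFour) + (-495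
      / 64 : ℚ) • (eisTwo ^ 2 * eisSix) + (-3267 / 512 : ℚ) • (eisTwo * eisFour ^ 2) + (-45 / 32 :
      ℚ) • (eisFour * eisSix) + (135135 / 4096 : ℚ) • eisTwo ^ 4 + (27027 / 1024 : ℚ) • (eisTwo ^
      2 * eisFour) + (429 / 64 : ℚ) • (eisTwo * eisSix) + (14157 / 5120 : ℚ) • eisFour ^ 2 +
      (-33825 / 1024 : ℚ) • eisTwo ^ 3 + (-6765 / 512 : ℚ) • (eisTwo * eisFour) + (-2255 / 1344 :
      ℚ) • eisSix + (66429 / 4096 : ℚ) • eisTwo ^ 2 + (22143 / 10240 : ℚ) • eisFour + (-7665 /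
      2048 : ℚ) • eisTwo + (597871 / 1863680 : ℚ) • 1) := by
  rw [binomConv]
  simp +decide only [Finset.sum_range_succ, Finset.range_zero,
    Finset.sum_empty, Nat.reduceAdd, Nat.reduceSub, Nat.choose, zero_mul, mul_zero, smul_zero,
    add_zero, zero_add, Nat.cast_ofNat, Nat.cast_one, one_smul, mul_one, one_mul, crankNorm_odd,
    crankNorm_zero, crankNorm_two, crankNorm_four, crankNorm_six, crankNorm_eight, crankNorm_ten, crankNorm_twelve,
    binomConv_crankNorm_zero, binomConv_crankNorm_two, binomConv_crankNorm_four, binomConv_crankNorm_six, binomConv_crankNorm_eight, binomConv_crankNorm_ten, binomConv_crankNorm_twelve]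
  algebra

theorem binomConv_crankNorm_crankNorm_fourteen :
    binomConv (binomConv crankNorm crankNorm) crankNorm 14 =
    ((-135135 / 16384 : ℚ) • eisTwo ^ 7 + (-189189 / 8192 : ℚ) • (eisTwo ^ 5 * eisFour) + (-15015
      / 1024 : ℚ) • (eisTwo ^ 4 * eisSix) + (-99099 / 4096 : ℚ) • (eisTwo ^ 3 * eisFour ^ 2) +
      (-4095 / 256 : ℚ) • (eisTwo ^ 2 * eisFour * eisSix) + (-13293 / 2048 : ℚ) • (eisTwo *
      eisFour ^ 3) + (-193 / 96 : ℚ) • (eisTwo * eisSix ^ 2) + (-2621 / 1280 : ℚ) • (eisFour ^ 2 *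
      eisSix) + (945945 / 16384 : ℚ) • eisTwo ^ 6 + (945945 / 8192 : ℚ) • (eisTwo ^ 4 * eisFour) +
      (15015 / 256 : ℚ) • (eisTwo ^ 3 * eisSix) + (297297 / 4096 : ℚ) • (eisTwo ^ 2 * eisFour ^ 2)
      + (4095 / 128 : ℚ) • (eisTwo * eisFour * eisSix) + (13293 / 2048 : ℚ) • eisFour ^ 3 + (193 /
      96 : ℚ) • eisSix ^ 2 + (-2459457 / 16384 : ℚ) • eisTwo ^ 5 + (-819819 / 4096 : ℚ) • (eisTwo
      ^ 3 * eisFour) + (-39039 / 512 : ℚ) • (eisTwo ^ 2 * eisSix) + (-1288287 / 20480 : ℚ) •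
      (eisTwo * eisFour ^ 2) + (-3549 / 256 : ℚ) • (eisFour * eisSix) + (3078075 / 16384 : ℚ) •
      eisTwo ^ 4 + (615615 / 4096 : ℚ) • (eisTwo ^ 2 * eisFour) + (29315 / 768 : ℚ) • (eisTwo *
      eisSix) + (64493 / 4096 : ℚ) • eisFour ^ 2 + (-2015013 / 16384 : ℚ) • eisTwo ^ 3 + (-2015013
      / 40960 : ℚ) • (eisTwo * eisFour) + (-95953 / 15360 : ℚ) • eisSix + (697515 / 16384 : ℚ) •
      eisTwo ^ 2 + (46501 / 8192 : ℚ) • eisFour + (-597871 / 81920 : ℚ) • eisTwo + (7913 / 16384 :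
      ℚ) • 1) := by
  rw [binomConv]
  simp +decide only [Finset.sum_range_succ, Finset.range_zero,
    Finset.sum_empty, Nat.reduceAdd, Nat.reduceSub, Nat.choose, zero_mul, mul_zero, smul_zero,
    add_zero, zero_add, Nat.cast_ofNat, Nat.cast_one, one_smul, mul_one, one_mul, crankNorm_odd,
    crankNorm_zero, crankNorm_two, crankNorm_four, crankNorm_six, crankNorm_eight, crankNorm_ten, crankNorm_twelve, crankNorm_fourteen,
    binomConv_crankNorm_zero, binomConv_crankNorm_two, binomConv_crankNorm_four, binomConv_crankNorm_six, binomConv_crankNorm_eight, binomConv_crankNorm_ten, binomConv_crankNorm_twelve, binomConv_crankNorm_fourteen]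
  algebra

/-! ### Recursive solution of the rank-crank equation for the rank moments. -/

theorem rankMom_zero : rankMom 0 = partSeries := mom_zero_rankSeries

theorem rankMom_two : rankMom 2 = rankDeriv 0 := rfl

/-- The case r = 2 of the rank-crank equation: the second rank moment drops out and what remains is
the logarithmic derivative of P. No product formula for P is needed. -/
theorem euler_partSeries : euler partSeries = (1 / 24 : ℚ) • (partSeries * (1 - eisTwo)) := by
  have h := mom_heatFamily_rankSeries 2
  have e1 : (fun m : ℤ => ((m : ℚ) ^ 2 + m) / 2 * ((m - 1 : ℚ) ^ 2 - 2 * m ^ 2 + (m + 1) ^ 2) +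
      m ^ (2 + 1) - m * (m + 1) ^ 2 + m ^ 2) =
      0 := by
    funext m
    simp only [Pi.add_apply, Pi.smul_apply, Pi.zero_apply, smul_eq_mul]
    ring
  have e2 : (fun m : ℤ => (m - 1 : ℚ) ^ 2 - 2 * m ^ 2 + (m + 1) ^ 2) =
      (2 : ℚ) • (fun m : ℤ => (m : ℚ) ^ 0) := by
    funext m
    simp only [Pi.add_apply, Pi.smul_apply, smul_eq_mul]
    ring
  rw [e1, e2, binomConv_crankNorm_crankNorm_two] at h
  simp only [map_add, map_smul, map_zero, Derivation.map_smul, ← rankMom_eq_integ] at h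
  rw [rankMom_zero] at h
  linear_combination (norm := algebra) (1 / 6 : ℚ) • h

/-- The pattern for all higher orders r: the weights are expanded into even powers, the r-th moment
occurs with coefficient (r-1)(r-2)/2, and everything else is a lower rank moment, a derivative of
one, or P times a known polynomial. The second moment and its derivatives stay as independent terms.
-/
theorem rankMom_four : rankMom 4 =
      (-12 : ℚ) • rankDeriv 1 + (1 : ℚ) • rankDeriv 0 +
      partSeries * ((1 / 16 : ℚ) • eisTwo ^ 2 + (1 / 120 : ℚ) • eisFour + (-1 / 24 : ℚ) • eisTwo + (-7 / 240 : ℚ)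
      • 1) := by
  have h := mom_heatFamily_rankSeries 4
  have e1 : (fun m : ℤ => ((m : ℚ) ^ 2 + m) / 2 * ((m - 1 : ℚ) ^ 4 - 2 * m ^ 4 + (m + 1) ^ 4) +
      m ^ (4 + 1) - m * (m + 1) ^ 4 + m ^ 4) =
      (3 : ℚ) • (fun m : ℤ => (m : ℚ) ^ 4) + (-3 : ℚ) • (fun m : ℤ => (m : ℚ) ^ 2) := by
    funext m
    simp only [Pi.add_apply, Pi.smul_apply, Pi.zero_apply, smul_eq_mul]
    ring
  have e2 : (fun m : ℤ => (m - 1 : ℚ) ^ 4 - 2 * m ^ 4 + (m + 1) ^ 4) =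
      (12 : ℚ) • (fun m : ℤ => (m : ℚ) ^ 2) + (2 : ℚ) • (fun m : ℤ => (m : ℚ) ^ 0) := by
    funext m
    simp only [Pi.add_apply, Pi.smul_apply, smul_eq_mul]
    ring
  rw [e1, e2, binomConv_crankNorm_crankNorm_four] at h
  simp only [map_add, map_smul, map_zero, Derivation.map_smul, ← rankMom_eq_integ] at h
  simp only [rankMom_two] at h
  simp only [rankMom_zero, rankMom_two,
    euler_partSeries, euler_rankDeriv, Nat.reduceAdd] at h
  linear_combination (norm := algebra) (1 / 3 : ℚ) • h

/-- Lower moments enter the next relations differentiated. The Ramanujan equations and the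
derivative of P keep the result in the same normal form. -/
theorem euler_rankMom_four : euler (rankMom 4) =
      (-12 : ℚ) • rankDeriv 2 + (1 : ℚ) • rankDeriv 1 +
      partSeries * ((1 / 128 : ℚ) • eisTwo ^ 3 + (-23 / 2880 : ℚ) • (eisTwo * eisFour) + (-1 / 360 : ℚ) • eisSix
      + (1 / 1152 : ℚ) • eisTwo ^ 2 + (11 / 2880 : ℚ) • eisFour + (-1 / 1920 : ℚ) • eisTwo + (-7 /
      5760 : ℚ) • 1) := by
  rw [rankMom_four]
  simp only [map_add, Derivation.leibniz, Derivation.leibniz_pow, Derivation.map_smul,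
    Derivation.map_one_eq_zero, smul_eq_mul, euler_eisTwo, euler_eisFour, euler_eisSix,
    euler_partSeries, euler_rankDeriv, Nat.reduceAdd]
  algebra

theorem rankMom_six : rankMom 6 =
      (108 : ℚ) • rankDeriv 2 + (-24 : ℚ) • rankDeriv 1 + (1 : ℚ) • rankDeriv 0 +
      partSeries * ((-3 / 32 : ℚ) • eisTwo ^ 3 + (1 / 16 : ℚ) • (eisTwo * eisFour) + (1 / 42 : ℚ) • eisSix + (3 /
      32 : ℚ) • eisTwo ^ 2 + (-1 / 48 : ℚ) • eisFour + (-5 / 96 : ℚ) • eisTwo + (-3 / 224 : ℚ) •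
      1) := by
  have h := mom_heatFamily_rankSeries 6
  have e1 : (fun m : ℤ => ((m : ℚ) ^ 2 + m) / 2 * ((m - 1 : ℚ) ^ 6 - 2 * m ^ 6 + (m + 1) ^ 6) +
      m ^ (6 + 1) - m * (m + 1) ^ 6 + m ^ 6) =
      (10 : ℚ) • (fun m : ℤ => (m : ℚ) ^ 6) + (-5 : ℚ) • (fun m : ℤ => (m : ℚ) ^ 4) + (-5 : ℚ)
        • (fun m : ℤ => (m : ℚ) ^ 2) := by
    funext m
    simp only [Pi.add_apply, Pi.smul_apply, Pi.zero_apply, smul_eq_mul]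
    ring
  have e2 : (fun m : ℤ => (m - 1 : ℚ) ^ 6 - 2 * m ^ 6 + (m + 1) ^ 6) =
      (30 : ℚ) • (fun m : ℤ => (m : ℚ) ^ 4) + (30 : ℚ) • (fun m : ℤ => (m : ℚ) ^ 2) + (2 : ℚ)
        • (fun m : ℤ => (m : ℚ) ^ 0) := by
    funext m
    simp only [Pi.add_apply, Pi.smul_apply, smul_eq_mul]
    ring
  rw [e1, e2, binomConv_crankNorm_crankNorm_six] at h
  simp only [map_add, map_smul, map_zero, Derivation.map_smul, ← rankMom_eq_integ] at h
  simp only [euler_rankMom_four] at h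
  simp only [rankMom_zero, rankMom_two, rankMom_four,
    euler_partSeries, euler_rankDeriv, Nat.reduceAdd] at h
  linear_combination (norm := algebra) (1 / 10 : ℚ) • h

theorem euler_rankMom_six : euler (rankMom 6) =
      (108 : ℚ) • rankDeriv 3 + (-24 : ℚ) • rankDeriv 2 + (1 : ℚ) • rankDeriv 1 +
      partSeries * ((-5 / 256 : ℚ) • eisTwo ^ 4 + (3 / 64 : ℚ) • (eisTwo ^ 2 * eisFour) + (-5 / 504 : ℚ) •
      (eisTwo * eisSix) + (-23 / 1344 : ℚ) • eisFour ^ 2 + (1 / 128 : ℚ) • eisTwo ^ 3 + (-11 / 576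
      : ℚ) • (eisTwo * eisFour) + (1 / 126 : ℚ) • eisSix + (1 / 576 : ℚ) • eisTwo ^ 2 + (1 / 288 :
      ℚ) • eisFour + (-13 / 8064 : ℚ) • eisTwo + (-1 / 1792 : ℚ) • 1) := by
  rw [rankMom_six]
  simp only [map_add, Derivation.leibniz, Derivation.leibniz_pow, Derivation.map_smul,
    Derivation.map_one_eq_zero, smul_eq_mul, euler_eisTwo, euler_eisFour, euler_eisSix,
    euler_partSeries, euler_rankDeriv, Nat.reduceAdd]
  algebra

theorem rankMom_eight : rankMom 8 =
      (-864 : ℚ) • rankDeriv 3 + (360 : ℚ) • rankDeriv 2 + (-36 : ℚ) • rankDeriv 1 + (1 : ℚ) •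
        rankDeriv 0 +
      partSeries * ((45 / 256 : ℚ) • eisTwo ^ 4 + (-23 / 64 : ℚ) • (eisTwo ^ 2 * eisFour) + (1 / 12 : ℚ) •
      (eisTwo * eisSix) + (133 / 960 : ℚ) • eisFour ^ 2 + (-15 / 64 : ℚ) • eisTwo ^ 3 + (23 / 96 :
      ℚ) • (eisTwo * eisFour) + (-1 / 36 : ℚ) • eisSix + (35 / 384 : ℚ) • eisTwo ^ 2 + (-21 / 320
      : ℚ) • eisFour + (-7 / 192 : ℚ) • eisTwo + (-11 / 2304 : ℚ) • 1) := by
  have h := mom_heatFamily_rankSeries 8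
  have e1 : (fun m : ℤ => ((m : ℚ) ^ 2 + m) / 2 * ((m - 1 : ℚ) ^ 8 - 2 * m ^ 8 + (m + 1) ^ 8) +
      m ^ (8 + 1) - m * (m + 1) ^ 8 + m ^ 8) =
      (21 : ℚ) • (fun m : ℤ => (m : ℚ) ^ 8) + (14 : ℚ) • (fun m : ℤ => (m : ℚ) ^ 6) + (-28 :
        ℚ) • (fun m : ℤ => (m : ℚ) ^ 4) + (-7 : ℚ) • (fun m : ℤ => (m : ℚ) ^ 2) := by
    funext m
    simp only [Pi.add_apply, Pi.smul_apply, Pi.zero_apply, smul_eq_mul]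
    ring
  have e2 : (fun m : ℤ => (m - 1 : ℚ) ^ 8 - 2 * m ^ 8 + (m + 1) ^ 8) =
      (56 : ℚ) • (fun m : ℤ => (m : ℚ) ^ 6) + (140 : ℚ) • (fun m : ℤ => (m : ℚ) ^ 4) + (56 :
        ℚ) • (fun m : ℤ => (m : ℚ) ^ 2) + (2 : ℚ) • (fun m : ℤ => (m : ℚ) ^ 0) := by
    funext m
    simp only [Pi.add_apply, Pi.smul_apply, smul_eq_mul]
    ring
  rw [e1, e2, binomConv_crankNorm_crankNorm_eight] at h
  simp only [map_add, map_smul, map_zero, Derivation.map_smul, ← rankMom_eq_integ] at h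
  simp only [euler_rankMom_four, euler_rankMom_six] at h
  simp only [rankMom_zero, rankMom_two, rankMom_four, rankMom_six,
    euler_partSeries, euler_rankDeriv, Nat.reduceAdd] at h
  linear_combination (norm := algebra) (1 / 21 : ℚ) • h

theorem euler_rankMom_eight : euler (rankMom 8) =
      (-864 : ℚ) • rankDeriv 4 + (360 : ℚ) • rankDeriv 3 + (-36 : ℚ) • rankDeriv 2 + (1 : ℚ) •
        rankDeriv 1 +
      partSeries * ((105 / 2048 : ℚ) • eisTwo ^ 5 + (-343 / 1536 : ℚ) • (eisTwo ^ 3 * eisFour) + (95 / 576 : ℚ) •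
      (eisTwo ^ 2 * eisSix) + (161 / 1536 : ℚ) • (eisTwo * eisFour ^ 2) + (-143 / 1440 : ℚ) •
      (eisFour * eisSix) + (-85 / 2048 : ℚ) • eisTwo ^ 4 + (205 / 1536 : ℚ) • (eisTwo ^ 2 *
      eisFour) + (-77 / 864 : ℚ) • (eisTwo * eisSix) + (-7 / 23040 : ℚ) • eisFour ^ 2 + (5 / 3072
      : ℚ) • eisTwo ^ 3 + (-187 / 7680 : ℚ) • (eisTwo * eisFour) + (179 / 8640 : ℚ) • eisSix + (7
      / 3072 : ℚ) • eisTwo ^ 2 + (7 / 23040 : ℚ) • eisFour + (-73 / 55296 : ℚ) • eisTwo + (-11 /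
      55296 : ℚ) • 1) := by
  rw [rankMom_eight]
  simp only [map_add, Derivation.leibniz, Derivation.leibniz_pow, Derivation.map_smul,
    Derivation.map_one_eq_zero, smul_eq_mul, euler_eisTwo, euler_eisFour, euler_eisSix,
    euler_partSeries, euler_rankDeriv, Nat.reduceAdd]
  algebra

theorem rankMom_ten : rankMom 10 =
      (6480 : ℚ) • rankDeriv 4 + (-4320 : ℚ) • rankDeriv 3 + (756 : ℚ) • rankDeriv 2 + (-48 :
        ℚ) • rankDeriv 1 + (1 : ℚ) • rankDeriv 0 +
      partSeries * ((-105 / 256 : ℚ) • eisTwo ^ 5 + (105 / 64 : ℚ) • (eisTwo ^ 3 * eisFour) + (-5 / 4 : ℚ) •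
      (eisTwo ^ 2 * eisSix) + (-51 / 64 : ℚ) • (eisTwo * eisFour ^ 2) + (49 / 66 : ℚ) • (eisFour *
      eisSix) + (175 / 256 : ℚ) • eisTwo ^ 4 + (-105 / 64 : ℚ) • (eisTwo ^ 2 * eisFour) + (5 / 6 :
      ℚ) • (eisTwo * eisSix) + (17 / 64 : ℚ) • eisFour ^ 2 + (-39 / 128 : ℚ) • eisTwo ^ 3 + (33 /
      64 : ℚ) • (eisTwo * eisFour) + (-1 / 4 : ℚ) • eisSix + (9 / 128 : ℚ) • eisTwo ^ 2 + (-5 / 64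
      : ℚ) • eisFour + (-5 / 256 : ℚ) • eisTwo + (-13 / 8448 : ℚ) • 1) := by
  have h := mom_heatFamily_rankSeries 10
  have e1 : (fun m : ℤ => ((m : ℚ) ^ 2 + m) / 2 * ((m - 1 : ℚ) ^ 10 - 2 * m ^ 10 + (m + 1) ^ 10) +
      m ^ (10 + 1) - m * (m + 1) ^ 10 + m ^ 10) =
      (36 : ℚ) • (fun m : ℤ => (m : ℚ) ^ 10) + (90 : ℚ) • (fun m : ℤ => (m : ℚ) ^ 8) + (-42 :
        ℚ) • (fun m : ℤ => (m : ℚ) ^ 6) + (-75 : ℚ) • (fun m : ℤ => (m : ℚ) ^ 4) + (-9 : ℚ) •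
        (fun m : ℤ => (m : ℚ) ^ 2) := by
    funext m
    simp only [Pi.add_apply, Pi.smul_apply, Pi.zero_apply, smul_eq_mul]
    ring
  have e2 : (fun m : ℤ => (m - 1 : ℚ) ^ 10 - 2 * m ^ 10 + (m + 1) ^ 10) =
      (90 : ℚ) • (fun m : ℤ => (m : ℚ) ^ 8) + (420 : ℚ) • (fun m : ℤ => (m : ℚ) ^ 6) + (420 :
        ℚ) • (fun m : ℤ => (m : ℚ) ^ 4) + (90 : ℚ) • (fun m : ℤ => (m : ℚ) ^ 2) + (2 : ℚ) •
        (fun m : ℤ => (m : ℚ) ^ 0) := by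
    funext m
    simp only [Pi.add_apply, Pi.smul_apply, smul_eq_mul]
    ring
  rw [e1, e2, binomConv_crankNorm_crankNorm_ten] at h
  simp only [map_add, map_smul, map_zero, Derivation.map_smul, ← rankMom_eq_integ] at h
  simp only [euler_rankMom_four, euler_rankMom_six, euler_rankMom_eight] at h
  simp only [rankMom_zero, rankMom_two, rankMom_four, rankMom_six, rankMom_eight,
    euler_partSeries, euler_rankDeriv, Nat.reduceAdd] at h
  linear_combination (norm := algebra) (1 / 36 : ℚ) • h

theorem euler_rankMom_ten : euler (rankMom 10) =
      (6480 : ℚ) • rankDeriv 5 + (-4320 : ℚ) • rankDeriv 4 + (756 : ℚ) • rankDeriv 3 + (-48 :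
        ℚ) • rankDeriv 2 + (1 : ℚ) • rankDeriv 1 +
      partSeries * ((-315 / 2048 : ℚ) • eisTwo ^ 6 + (1085 / 1024 : ℚ) • (eisTwo ^ 4 * eisFour) + (-85 / 64 : ℚ)
      • (eisTwo ^ 3 * eisSix) + (-179 / 512 : ℚ) • (eisTwo ^ 2 * eisFour ^ 2) + (4205 / 3168 : ℚ)
      • (eisTwo * eisFour * eisSix) + (-2575 / 8448 : ℚ) • eisFour ^ 3 + (-49 / 198 : ℚ) • eisSix
      ^ 2 + (35 / 192 : ℚ) • eisTwo ^ 5 + (-175 / 192 : ℚ) • (eisTwo ^ 3 * eisFour) + (545 / 576 :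
      ℚ) • (eisTwo ^ 2 * eisSix) + (-1 / 96 : ℚ) • (eisTwo * eisFour ^ 2) + (-683 / 3168 : ℚ) •
      (eisFour * eisSix) + (-215 / 6144 : ℚ) • eisTwo ^ 4 + (103 / 512 : ℚ) • (eisTwo ^ 2 *
      eisFour) + (-145 / 576 : ℚ) • (eisTwo * eisSix) + (143 / 1536 : ℚ) • eisFour ^ 2 + (-1 / 256
      : ℚ) • eisTwo ^ 3 + (-5 / 384 : ℚ) • (eisTwo * eisFour) + (1 / 64 : ℚ) • eisSix + (13 / 6144
      : ℚ) • eisTwo ^ 2 + (-5 / 3072 : ℚ) • eisFour + (-19 / 25344 : ℚ) • eisTwo + (-13 / 202752 :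
      ℚ) • 1) := by
  rw [rankMom_ten]
  simp only [map_add, Derivation.leibniz, Derivation.leibniz_pow, Derivation.map_smul,
    Derivation.map_one_eq_zero, smul_eq_mul, euler_eisTwo, euler_eisFour, euler_eisSix,
    euler_partSeries, euler_rankDeriv, Nat.reduceAdd]
  algebra

set_option maxHeartbeats 1000000 in
theorem rankMom_twelve : rankMom 12 =
      (-46656 : ℚ) • rankDeriv 5 + (45360 : ℚ) • rankDeriv 4 + (-12096 : ℚ) • rankDeriv 3 +
        (1296 : ℚ) • rankDeriv 2 + (-60 : ℚ) • rankDeriv 1 + (1 : ℚ) • rankDeriv 0 +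
      partSeries * ((4725 / 4096 : ℚ) • eisTwo ^ 6 + (-15435 / 2048 : ℚ) • (eisTwo ^ 4 * eisFour) + (615 / 64 :
      ℚ) • (eisTwo ^ 3 * eisSix) + (2637 / 1024 : ℚ) • (eisTwo ^ 2 * eisFour ^ 2) + (-305 / 32 :
      ℚ) • (eisTwo * eisFour * eisSix) + (73209 / 33280 : ℚ) • eisFour ^ 3 + (3895 / 2184 : ℚ) •
      eisSix ^ 2 + (-4725 / 2048 : ℚ) • eisTwo ^ 5 + (5145 / 512 : ℚ) • (eisTwo ^ 3 * eisFour) +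
      (-615 / 64 : ℚ) • (eisTwo ^ 2 * eisSix) + (-879 / 512 : ℚ) • (eisTwo * eisFour ^ 2) + (305 /
      96 : ℚ) • (eisFour * eisSix) + (5005 / 4096 : ℚ) • eisTwo ^ 4 + (-3927 / 1024 : ℚ) • (eisTwo
      ^ 2 * eisFour) + (649 / 192 : ℚ) • (eisTwo * eisSix) + (-2761 / 5120 : ℚ) • eisFour ^ 2 +
      (-297 / 1024 : ℚ) • eisTwo ^ 3 + (363 / 512 : ℚ) • (eisTwo * eisFour) + (-209 / 448 : ℚ) •
      eisSix + (187 / 4096 : ℚ) • eisTwo ^ 2 + (-385 / 6144 : ℚ) • eisFour + (-55 / 6144 : ℚ) •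
      eisTwo + (-25 / 53248 : ℚ) • 1) := by
  have h := mom_heatFamily_rankSeries 12
  have e1 : (fun m : ℤ => ((m : ℚ) ^ 2 + m) / 2 * ((m - 1 : ℚ) ^ 12 - 2 * m ^ 12 + (m + 1) ^ 12) +
      m ^ (12 + 1) - m * (m + 1) ^ 12 + m ^ 12) =
      (55 : ℚ) • (fun m : ℤ => (m : ℚ) ^ 12) + (275 : ℚ) • (fun m : ℤ => (m : ℚ) ^ 10) + (132
        : ℚ) • (fun m : ℤ => (m : ℚ) ^ 8) + (-297 : ℚ) • (fun m : ℤ => (m : ℚ) ^ 6) + (-154 :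
        ℚ) • (fun m : ℤ => (m : ℚ) ^ 4) + (-11 : ℚ) • (fun m : ℤ => (m : ℚ) ^ 2) := by
    funext m
    simp only [Pi.add_apply, Pi.smul_apply, Pi.zero_apply, smul_eq_mul]
    ring
  have e2 : (fun m : ℤ => (m - 1 : ℚ) ^ 12 - 2 * m ^ 12 + (m + 1) ^ 12) =
      (132 : ℚ) • (fun m : ℤ => (m : ℚ) ^ 10) + (990 : ℚ) • (fun m : ℤ => (m : ℚ) ^ 8) + (1848
        : ℚ) • (fun m : ℤ => (m : ℚ) ^ 6) + (990 : ℚ) • (fun m : ℤ => (m : ℚ) ^ 4) + (132 : ℚ)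
        • (fun m : ℤ => (m : ℚ) ^ 2) + (2 : ℚ) • (fun m : ℤ => (m : ℚ) ^ 0) := by
    funext m
    simp only [Pi.add_apply, Pi.smul_apply, smul_eq_mul]
    ring
  rw [e1, e2, binomConv_crankNorm_crankNorm_twelve] at h
  simp only [map_add, map_smul, map_zero, Derivation.map_smul, ← rankMom_eq_integ] at h
  simp only [euler_rankMom_four, euler_rankMom_six, euler_rankMom_eight, euler_rankMom_ten] at h
  simp only [rankMom_zero, rankMom_two, rankMom_four, rankMom_six, rankMom_eight, rankMom_ten,
    euler_partSeries, euler_rankDeriv, Nat.reduceAdd] at h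
  linear_combination (norm := algebra) (1 / 55 : ℚ) • h

set_option maxHeartbeats 1000000 in
theorem euler_rankMom_twelve : euler (rankMom 12) =
      (-46656 : ℚ) • rankDeriv 6 + (45360 : ℚ) • rankDeriv 5 + (-12096 : ℚ) • rankDeriv 4 +
        (1296 : ℚ) • rankDeriv 3 + (-60 : ℚ) • rankDeriv 2 + (1 : ℚ) • rankDeriv 1 +
      partSeries * ((17325 / 32768 : ℚ) • eisTwo ^ 7 + (-86625 / 16384 : ℚ) • (eisTwo ^ 5 * eisFour) + (19085 /
      2048 : ℚ) • (eisTwo ^ 4 * eisSix) + (-2079 / 8192 : ℚ) • (eisTwo ^ 3 * eisFour ^ 2) + (-6379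
      / 512 : ℚ) • (eisTwo ^ 2 * eisFour * eisSix) + (1715799 / 266240 : ℚ) • (eisTwo * eisFour ^
      3) + (256115 / 52416 : ℚ) • (eisTwo * eisSix ^ 2) + (-2228689 / 698880 : ℚ) • (eisFour ^ 2 *
      eisSix) + (-26775 / 32768 : ℚ) • eisTwo ^ 6 + (99785 / 16384 : ℚ) • (eisTwo ^ 4 * eisFour) +
      (-4585 / 512 : ℚ) • (eisTwo ^ 3 * eisSix) + (9697 / 8192 : ℚ) • (eisTwo ^ 2 * eisFour ^ 2) +
      (11207 / 2304 : ℚ) • (eisTwo * eisFour * eisSix) + (-1081321 / 798720 : ℚ) • eisFour ^ 3 +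
      (-5735 / 5824 : ℚ) • eisSix ^ 2 + (25585 / 98304 : ℚ) • eisTwo ^ 5 + (-42917 / 24576 : ℚ) •
      (eisTwo ^ 3 * eisFour) + (24965 / 9216 : ℚ) • (eisTwo ^ 2 * eisSix) + (-35869 / 24576 : ℚ) •
      (eisTwo * eisFour ^ 2) + (4843 / 23040 : ℚ) • (eisFour * eisSix) + (-935 / 98304 : ℚ) •
      eisTwo ^ 4 + (1463 / 8192 : ℚ) • (eisTwo ^ 2 * eisFour) + (-9977 / 32256 : ℚ) • (eisTwo *
      eisSix) + (130493 / 860160 : ℚ) • eisFour ^ 2 + (-209 / 32768 : ℚ) • eisTwo ^ 3 + (539 /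
      147456 : ℚ) • (eisTwo * eisFour) + (187 / 129024 : ℚ) • eisSix + (451 / 294912 : ℚ) • eisTwo
      ^ 2 + (-275 / 147456 : ℚ) • eisFour + (-1355 / 3833856 : ℚ) • eisTwo + (-25 / 1277952 : ℚ) •
      1) := by
  rw [rankMom_twelve]
  simp only [map_add, Derivation.leibniz, Derivation.leibniz_pow, Derivation.map_smul,
    Derivation.map_one_eq_zero, smul_eq_mul, euler_eisTwo, euler_eisFour, euler_eisSix,
    euler_partSeries, euler_rankDeriv, Nat.reduceAdd]
  algebra

set_option maxHeartbeats 1000000 in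
theorem rankMom_fourteen : rankMom 14 =
      (326592 : ℚ) • rankDeriv 6 + (-435456 : ℚ) • rankDeriv 5 + (163296 : ℚ) • rankDeriv 4 +
        (-25920 : ℚ) • rankDeriv 3 + (1980 : ℚ) • rankDeriv 2 + (-72 : ℚ) • rankDeriv 1 + (1 :
        ℚ) • rankDeriv 0 +
      partSeries * ((-31185 / 8192 : ℚ) • eisTwo ^ 7 + (150381 / 4096 : ℚ) • (eisTwo ^ 5 * eisFour) + (-33495 /
      512 : ℚ) • (eisTwo ^ 4 * eisSix) + (3003 / 2048 : ℚ) • (eisTwo ^ 3 * eisFour ^ 2) + (11137 /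
      128 : ℚ) • (eisTwo ^ 2 * eisFour * eisSix) + (-231399 / 5120 : ℚ) • (eisTwo * eisFour ^ 3) +
      (-1643 / 48 : ℚ) • (eisTwo * eisSix ^ 2) + (42809 / 1920 : ℚ) • (eisFour ^ 2 * eisSix) +
      (72765 / 8192 : ℚ) • eisTwo ^ 6 + (-250635 / 4096 : ℚ) • (eisTwo ^ 4 * eisFour) + (11165 /
      128 : ℚ) • (eisTwo ^ 3 * eisSix) + (-3003 / 2048 : ℚ) • (eisTwo ^ 2 * eisFour ^ 2) + (-11137
      / 192 : ℚ) • (eisTwo * eisFour * eisSix) + (77133 / 5120 : ℚ) • eisFour ^ 3 + (1643 / 144 :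
      ℚ) • eisSix ^ 2 + (-45227 / 8192 : ℚ) • eisTwo ^ 5 + (57967 / 2048 : ℚ) • (eisTwo ^ 3 *
      eisFour) + (-27937 / 768 : ℚ) • (eisTwo ^ 2 * eisSix) + (104923 / 10240 : ℚ) • (eisTwo *
      eisFour ^ 2) + (1547 / 640 : ℚ) • (eisFour * eisSix) + (12155 / 8192 : ℚ) • eisTwo ^ 4 +
      (-12441 / 2048 : ℚ) • (eisTwo ^ 2 * eisFour) + (2717 / 384 : ℚ) • (eisTwo * eisSix) +
      (-23023 / 10240 : ℚ) • eisFour ^ 2 + (-1859 / 8192 : ℚ) • eisTwo ^ 3 + (8723 / 12288 : ℚ) •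
      (eisTwo * eisFour) + (-2431 / 4608 : ℚ) • eisSix + (637 / 24576 : ℚ) • eisTwo ^ 2 + (-819 /
      20480 : ℚ) • eisFour + (-91 / 24576 : ℚ) • eisTwo + (-17 / 122880 : ℚ) • 1) := by
  have h := mom_heatFamily_rankSeries 14
  have e1 : (fun m : ℤ => ((m : ℚ) ^ 2 + m) / 2 * ((m - 1 : ℚ) ^ 14 - 2 * m ^ 14 + (m + 1) ^ 14) +
      m ^ (14 + 1) - m * (m + 1) ^ 14 + m ^ 14) =
      (78 : ℚ) • (fun m : ℤ => (m : ℚ) ^ 14) + (637 : ℚ) • (fun m : ℤ => (m : ℚ) ^ 12) + (1001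
        : ℚ) • (fun m : ℤ => (m : ℚ) ^ 10) + (-429 : ℚ) • (fun m : ℤ => (m : ℚ) ^ 8) + (-1001
        : ℚ) • (fun m : ℤ => (m : ℚ) ^ 6) + (-273 : ℚ) • (fun m : ℤ => (m : ℚ) ^ 4) + (-13 :
        ℚ) • (fun m : ℤ => (m : ℚ) ^ 2) := by
    funext m
    simp only [Pi.add_apply, Pi.smul_apply, Pi.zero_apply, smul_eq_mul]
    ring
  have e2 : (fun m : ℤ => (m - 1 : ℚ) ^ 14 - 2 * m ^ 14 + (m + 1) ^ 14) =
      (182 : ℚ) • (fun m : ℤ => (m : ℚ) ^ 12) + (2002 : ℚ) • (fun m : ℤ => (m : ℚ) ^ 10) +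
        (6006 : ℚ) • (fun m : ℤ => (m : ℚ) ^ 8) + (6006 : ℚ) • (fun m : ℤ => (m : ℚ) ^ 6) +
        (2002 : ℚ) • (fun m : ℤ => (m : ℚ) ^ 4) + (182 : ℚ) • (fun m : ℤ => (m : ℚ) ^ 2) + (2
        : ℚ) • (fun m : ℤ => (m : ℚ) ^ 0) := by
    funext m
    simp only [Pi.add_apply, Pi.smul_apply, smul_eq_mul]
    ring
  rw [e1, e2, binomConv_crankNorm_crankNorm_fourteen] at h
  simp only [map_add, map_smul, map_zero, Derivation.map_smul, ← rankMom_eq_integ] at h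
  simp only [euler_rankMom_four, euler_rankMom_six, euler_rankMom_eight, euler_rankMom_ten, euler_rankMom_twelve] at h
  simp only [rankMom_zero, rankMom_two, rankMom_four, rankMom_six, rankMom_eight, rankMom_ten, rankMom_twelve,
    euler_partSeries, euler_rankDeriv, Nat.reduceAdd] at h
  linear_combination (norm := algebra) (1 / 78 : ℚ) • h

/-! ### Rank moments through derivatives of crank moments. -/

theorem rankMom_four_eq : rankMom 4 =
      euler ((-2 : ℚ) • mom 0 2 crankSeries) + (-2 / 3 : ℚ) • mom 0 2 crankSeries + (8 / 3 :
        ℚ) • mom 0 4 crankSeries +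
      (-12 : ℚ) • rankDeriv 1 + (1 : ℚ) • rankDeriv 0 := by
  have h1 : (-2 : ℚ) • mom 0 2 crankSeries =
      partSeries * ((1 / 6 : ℚ) • eisTwo + (-1 / 6 : ℚ) • 1) := by
    simp only [mom_crankSeries, crankNorm_two,
      map_add, Derivation.leibniz, Derivation.leibniz_pow, Derivation.map_smul,
    Derivation.map_one_eq_zero, smul_eq_mul, euler_eisTwo, euler_eisFour, euler_eisSix,
      euler_partSeries]
    algebra
  have h0 : euler (partSeries * ((1 / 6 : ℚ) • eisTwo + (-1 / 6 : ℚ) • 1)) + (-2 / 3 : ℚ) • mom 0 2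
        crankSeries + (8 / 3 : ℚ) • mom 0 4 crankSeries =
      partSeries * ((1 / 16 : ℚ) • eisTwo ^ 2 + (1 / 120 : ℚ) • eisFour + (-1 / 24 : ℚ) • eisTwo + (-7 / 240 : ℚ)
      • 1) := by
    simp only [mom_crankSeries, crankNorm_two, crankNorm_four,
      map_add, Derivation.leibniz, Derivation.leibniz_pow, Derivation.map_smul,
    Derivation.map_one_eq_zero, smul_eq_mul, euler_eisTwo, euler_eisFour, euler_eisSix,
      euler_partSeries]
    algebra
  rw [h1, h0, rankMom_four]
  algebra

/-- The coefficient polynomials in n are arranged in Horner form: a crank moment lying under k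
applications of D carries the coefficient of n^k. Evaluating from the inside outwards, D is applied
at each stage to P times one explicit polynomial, and the last stage reproduces the polynomial part
of the rank moment. -/
theorem rankMom_six_eq : rankMom 6 =
      euler (euler ((216 / 11 : ℚ) • mom 0 2 crankSeries) + (46 / 11 : ℚ) • mom 0 2
        crankSeries + (-300 / 11 : ℚ) • mom 0 4 crankSeries) + (-20 / 33 : ℚ) • mom 0 2
        crankSeries + (80 / 33 : ℚ) • mom 0 4 crankSeries + (18 / 11 : ℚ) • mom 0 6
        crankSeries +
      (108 : ℚ) • rankDeriv 2 + (-24 : ℚ) • rankDeriv 1 + (1 : ℚ) • rankDeriv 0 := by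
  have h2 : (216 / 11 : ℚ) • mom 0 2 crankSeries =
      partSeries * ((-18 / 11 : ℚ) • eisTwo + (18 / 11 : ℚ) • 1) := by
    simp only [mom_crankSeries, crankNorm_two,
      map_add, Derivation.leibniz, Derivation.leibniz_pow, Derivation.map_smul,
    Derivation.map_one_eq_zero, smul_eq_mul, euler_eisTwo, euler_eisFour, euler_eisSix,
      euler_partSeries]
    algebra
  -- The next Horner stage: the argument of D is the value just found in `h2`, so that `rw` can
  -- collapse the nested expression layer by layer.
  have h1 : euler (partSeries * ((-18 / 11 : ℚ) • eisTwo + (18 / 11 : ℚ) • 1)) + (46 / 11 : ℚ) • mom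
        0 2 crankSeries + (-300 / 11 : ℚ) • mom 0 4 crankSeries =
      partSeries * ((-7 / 11 : ℚ) • eisTwo ^ 2 + (-1 / 11 : ℚ) • eisFour + (43 / 66 : ℚ) • eisTwo + (5 / 66 : ℚ)
      • 1) := by
    simp only [mom_crankSeries, crankNorm_two, crankNorm_four,
      map_add, Derivation.leibniz, Derivation.leibniz_pow, Derivation.map_smul,
    Derivation.map_one_eq_zero, smul_eq_mul, euler_eisTwo, euler_eisFour, euler_eisSix,
      euler_partSeries]
    algebra
  have h0 : euler (partSeries * ((-7 / 11 : ℚ) • eisTwo ^ 2 + (-1 / 11 : ℚ) • eisFour + (43 / 66 :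
        ℚ) • eisTwo + (5 / 66 : ℚ)       • 1)) + (-20 / 33 : ℚ) • mom 0 2 crankSeries + (80 /
        33 : ℚ) • mom 0 4 crankSeries + (18 / 11 : ℚ) • mom 0 6 crankSeries =
      partSeries * ((-3 / 32 : ℚ) • eisTwo ^ 3 + (1 / 16 : ℚ) • (eisTwo * eisFour) + (1 / 42 : ℚ) • eisSix + (3 /
      32 : ℚ) • eisTwo ^ 2 + (-1 / 48 : ℚ) • eisFour + (-5 / 96 : ℚ) • eisTwo + (-3 / 224 : ℚ) •
      1) := by
    simp only [mom_crankSeries, crankNorm_two, crankNorm_four, crankNorm_six,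
      map_add, Derivation.leibniz, Derivation.leibniz_pow, Derivation.map_smul,
    Derivation.map_one_eq_zero, smul_eq_mul, euler_eisTwo, euler_eisFour, euler_eisSix,
      euler_partSeries]
    algebra
  rw [h2, h1, h0, rankMom_six]
  algebra

theorem rankMom_eight_eq : rankMom 8 =
      euler (euler (euler ((-145944 / 913 : ℚ) • mom 0 2 crankSeries) + (-3456 / 913 : ℚ) •
        mom 0 2 crankSeries + (204960 / 913 : ℚ) • mom 0 4 crankSeries) + (11334 / 913 : ℚ) •
        mom 0 2 crankSeries + (-54600 / 913 : ℚ) • mom 0 4 crankSeries + (-16464 / 913 : ℚ) •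
        mom 0 6 crankSeries) + (-578 / 913 : ℚ) • mom 0 2 crankSeries + (2240 / 913 : ℚ) • mom
        0 4 crankSeries + (1260 / 913 : ℚ) • mom 0 6 crankSeries + (1248 / 913 : ℚ) • mom 0 8
        crankSeries +
      (-864 : ℚ) • rankDeriv 3 + (360 : ℚ) • rankDeriv 2 + (-36 : ℚ) • rankDeriv 1 + (1 : ℚ) •
        rankDeriv 0 := by
  have h3 : (-145944 / 913 : ℚ) • mom 0 2 crankSeries =
      partSeries * ((12162 / 913 : ℚ) • eisTwo + (-12162 / 913 : ℚ) • 1) := by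
    simp only [mom_crankSeries, crankNorm_two,
      map_add, Derivation.leibniz, Derivation.leibniz_pow, Derivation.map_smul,
    Derivation.map_one_eq_zero, smul_eq_mul, euler_eisTwo, euler_eisFour, euler_eisSix,
      euler_partSeries]
    algebra
  have h2 : euler (partSeries * ((12162 / 913 : ℚ) • eisTwo + (-12162 / 913 : ℚ) • 1)) + (-3456 /
        913 : ℚ) • mom 0 2 crankSeries + (204960 / 913 : ℚ) • mom 0 4 crankSeries =
      partSeries * ((1737 / 332 : ℚ) • eisTwo ^ 2 + (1389 / 1826 : ℚ) • eisFour + (-14477 / 1826 : ℚ) • eisTwo +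
      (7069 / 3652 : ℚ) • 1) := by
    simp only [mom_crankSeries, crankNorm_two, crankNorm_four,
      map_add, Derivation.leibniz, Derivation.leibniz_pow, Derivation.map_smul,
    Derivation.map_one_eq_zero, smul_eq_mul, euler_eisTwo, euler_eisFour, euler_eisSix,
      euler_partSeries]
    algebra
  have h1 : euler (partSeries * ((1737 / 332 : ℚ) • eisTwo ^ 2 + (1389 / 1826 : ℚ) • eisFour +
        (-14477 / 1826 : ℚ) • eisTwo +       (7069 / 3652 : ℚ) • 1)) + (11334 / 913 : ℚ) • mom
        0 2 crankSeries + (-54600 / 913 : ℚ) • mom 0 4 crankSeries + (-16464 / 913 : ℚ) • mom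
        0 6 crankSeries =
      partSeries * ((71041 / 87648 : ℚ) • eisTwo ^ 3 + (-6753 / 14608 : ℚ) • (eisTwo * eisFour) + (-997 / 5478 :
      ℚ) • eisSix + (-160207 / 87648 : ℚ) • eisTwo ^ 2 + (271 / 43824 : ℚ) • eisFour + (116401 /
      87648 : ℚ) • eisTwo + (28693 / 87648 : ℚ) • 1) := by
    simp only [mom_crankSeries, crankNorm_two, crankNorm_four, crankNorm_six,
      map_add, Derivation.leibniz, Derivation.leibniz_pow, Derivation.map_smul,
    Derivation.map_one_eq_zero, smul_eq_mul, euler_eisTwo, euler_eisFour, euler_eisSix,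
      euler_partSeries]
    algebra
  have h0 : euler (partSeries * ((71041 / 87648 : ℚ) • eisTwo ^ 3 + (-6753 / 14608 : ℚ) • (eisTwo *
        eisFour) + (-997 / 5478 :       ℚ) • eisSix + (-160207 / 87648 : ℚ) • eisTwo ^ 2 +
        (271 / 43824 : ℚ) • eisFour + (116401 /       87648 : ℚ) • eisTwo + (28693 / 87648 :
        ℚ) • 1)) + (-578 / 913 : ℚ) • mom 0 2 crankSeries + (2240 / 913 : ℚ) • mom 0 4
        crankSeries + (1260 / 913 : ℚ) • mom 0 6 crankSeries + (1248 / 913 : ℚ) • mom 0 8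
        crankSeries =
      partSeries * ((45 / 256 : ℚ) • eisTwo ^ 4 + (-23 / 64 : ℚ) • (eisTwo ^ 2 * eisFour) + (1 / 12 : ℚ) •
      (eisTwo * eisSix) + (133 / 960 : ℚ) • eisFour ^ 2 + (-15 / 64 : ℚ) • eisTwo ^ 3 + (23 / 96 :
      ℚ) • (eisTwo * eisFour) + (-1 / 36 : ℚ) • eisSix + (35 / 384 : ℚ) • eisTwo ^ 2 + (-21 / 320
      : ℚ) • eisFour + (-7 / 192 : ℚ) • eisTwo + (-11 / 2304 : ℚ) • 1) := by
    simp only [mom_crankSeries, crankNorm_two, crankNorm_four, crankNorm_six, crankNorm_eight,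
      map_add, Derivation.leibniz, Derivation.leibniz_pow, Derivation.map_smul,
    Derivation.map_one_eq_zero, smul_eq_mul, euler_eisTwo, euler_eisFour, euler_eisSix,
      euler_partSeries]
    algebra
  rw [h3, h2, h1, h0, rankMom_eight]
  algebra

set_option maxHeartbeats 4000000 in
theorem rankMom_ten_eq : rankMom 10 =
      euler (euler (euler (euler ((2392096320 / 1983949 : ℚ) • mom 0 2 crankSeries) +
        (-536972400 / 1983949 : ℚ) • mom 0 2 crankSeries + (-3372616800 / 1983949 : ℚ) • mom 0
        4 crankSeries) + (-265338072 / 1983949 : ℚ) • mom 0 2 crankSeries + (1718589600 /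
        1983949 : ℚ) • mom 0 4 crankSeries + (298524240 / 1983949 : ℚ) • mom 0 6 crankSeries)
        + (37505098 / 1983949 : ℚ) • mom 0 2 crankSeries + (-169178100 / 1983949 : ℚ) • mom 0
        4 crankSeries + (-79956240 / 1983949 : ℚ) • mom 0 6 crankSeries + (-33892200 / 1983949
        : ℚ) • mom 0 8 crankSeries) + (-3589184 / 5951847 : ℚ) • mom 0 2 crankSeries +
        (14560280 / 5951847 : ℚ) • mom 0 4 crankSeries + (258090 / 180359 : ℚ) • mom 0 6
        crankSeries + (2255520 / 1983949 : ℚ) • mom 0 8 crankSeries + (2724 / 2173 : ℚ) • mom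
        0 10 crankSeries +
      (6480 : ℚ) • rankDeriv 4 + (-4320 : ℚ) • rankDeriv 3 + (756 : ℚ) • rankDeriv 2 + (-48 :
        ℚ) • rankDeriv 1 + (1 : ℚ) • rankDeriv 0 := by
  have h4 : (2392096320 / 1983949 : ℚ) • mom 0 2 crankSeries =
      partSeries * ((-199341360 / 1983949 : ℚ) • eisTwo + (199341360 / 1983949 : ℚ) • 1) := by
    simp only [mom_crankSeries, crankNorm_two,
      map_add, Derivation.leibniz, Derivation.leibniz_pow, Derivation.map_smul,
    Derivation.map_one_eq_zero, smul_eq_mul, euler_eisTwo, euler_eisFour, euler_eisSix,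
      euler_partSeries]
    algebra
  have h3 : euler (partSeries * ((-199341360 / 1983949 : ℚ) • eisTwo + (199341360 / 1983949 : ℚ) •
        1)) + (-536972400 / 1983949 : ℚ) • mom 0 2 crankSeries + (-3372616800 / 1983949 : ℚ) •
        mom 0 4 crankSeries =
      partSeries * ((-78568740 / 1983949 : ℚ) • eisTwo ^ 2 + (-11493360 / 1983949 : ℚ) • eisFour + (168661620 /
      1983949 : ℚ) • eisTwo + (-78599520 / 1983949 : ℚ) • 1) := by
    simp only [mom_crankSeries, crankNorm_two, crankNorm_four,
      map_add, Derivation.leibniz, Derivation.leibniz_pow, Derivation.map_smul,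
    Derivation.map_one_eq_zero, smul_eq_mul, euler_eisTwo, euler_eisFour, euler_eisSix,
      euler_partSeries]
    algebra
  have h2 : euler (partSeries * ((-78568740 / 1983949 : ℚ) • eisTwo ^ 2 + (-11493360 / 1983949 : ℚ)
        • eisFour + (168661620 /       1983949 : ℚ) • eisTwo + (-78599520 / 1983949 : ℚ) • 1))
        + (-265338072 / 1983949 : ℚ) • mom 0 2 crankSeries + (1718589600 / 1983949 : ℚ) • mom
        0 4 crankSeries + (298524240 / 1983949 : ℚ) • mom 0 6 crankSeries =
      partSeries * ((-49649795 / 7935796 : ℚ) • eisTwo ^ 3 + (13265865 / 3967898 : ℚ) • (eisTwo * eisFour) +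
      (2646500 / 1983949 : ℚ) • eisSix + (189327555 / 7935796 : ℚ) • eisTwo ^ 2 + (5794365 /
      3967898 : ℚ) • eisFour + (-175433151 / 7935796 : ℚ) • eisTwo + (-12951069 / 7935796 : ℚ) •
      1) := by
    simp only [mom_crankSeries, crankNorm_two, crankNorm_four, crankNorm_six,
      map_add, Derivation.leibniz, Derivation.leibniz_pow, Derivation.map_smul,
    Derivation.map_one_eq_zero, smul_eq_mul, euler_eisTwo, euler_eisFour, euler_eisSix,
      euler_partSeries]
    algebra
  have h1 : euler (partSeries * ((-49649795 / 7935796 : ℚ) • eisTwo ^ 3 + (13265865 / 3967898 : ℚ) •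
        (eisTwo * eisFour) +       (2646500 / 1983949 : ℚ) • eisSix + (189327555 / 7935796 :
        ℚ) • eisTwo ^ 2 + (5794365 /       3967898 : ℚ) • eisFour + (-175433151 / 7935796 : ℚ)
        • eisTwo + (-12951069 / 7935796 : ℚ) •       1)) + (37505098 / 1983949 : ℚ) • mom 0 2
        crankSeries + (-169178100 / 1983949 : ℚ) • mom 0 4 crankSeries + (-79956240 / 1983949
        : ℚ) • mom 0 6 crankSeries + (-33892200 / 1983949 : ℚ) • mom 0 8 crankSeries =
      partSeries * ((-48325 / 34768 : ℚ) • eisTwo ^ 4 + (124785 / 47806 : ℚ) • (eisTwo ^ 2 * eisFour) + (-15805 /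
      23903 : ℚ) • (eisTwo * eisSix) + (-101185 / 95612 : ℚ) • eisFour ^ 2 + (325432285 / 95229552
      : ℚ) • eisTwo ^ 3 + (-40884945 / 15871592 : ℚ) • (eisTwo * eisFour) + (-673060 / 5951847 :
      ℚ) • eisSix + (-97277291 / 31743184 : ℚ) • eisTwo ^ 2 + (10285981 / 15871592 : ℚ) • eisFour
      + (15957727 / 8657232 : ℚ) • eisTwo + (16382585 / 47614776 : ℚ) • 1) := by
    simp only [mom_crankSeries, crankNorm_two, crankNorm_four, crankNorm_six, crankNorm_eight,
      map_add, Derivation.leibniz, Derivation.leibniz_pow, Derivation.map_smul,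
    Derivation.map_one_eq_zero, smul_eq_mul, euler_eisTwo, euler_eisFour, euler_eisSix,
      euler_partSeries]
    algebra
  have h0 : euler (partSeries * ((-48325 / 34768 : ℚ) • eisTwo ^ 4 + (124785 / 47806 : ℚ) • (eisTwo
        ^ 2 * eisFour) + (-15805 /       23903 : ℚ) • (eisTwo * eisSix) + (-101185 / 95612 :
        ℚ) • eisFour ^ 2 + (325432285 / 95229552       : ℚ) • eisTwo ^ 3 + (-40884945 /
        15871592 : ℚ) • (eisTwo * eisFour) + (-673060 / 5951847 :       ℚ) • eisSix +
        (-97277291 / 31743184 : ℚ) • eisTwo ^ 2 + (10285981 / 15871592 : ℚ) • eisFour       +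
        (15957727 / 8657232 : ℚ) • eisTwo + (16382585 / 47614776 : ℚ) • 1)) + (-3589184 /
        5951847 : ℚ) • mom 0 2 crankSeries + (14560280 / 5951847 : ℚ) • mom 0 4 crankSeries +
        (258090 / 180359 : ℚ) • mom 0 6 crankSeries + (2255520 / 1983949 : ℚ) • mom 0 8
        crankSeries + (2724 / 2173 : ℚ) • mom 0 10 crankSeries =
      partSeries * ((-105 / 256 : ℚ) • eisTwo ^ 5 + (105 / 64 : ℚ) • (eisTwo ^ 3 * eisFour) + (-5 / 4 : ℚ) •
      (eisTwo ^ 2 * eisSix) + (-51 / 64 : ℚ) • (eisTwo * eisFour ^ 2) + (49 / 66 : ℚ) • (eisFour *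
      eisSix) + (175 / 256 : ℚ) • eisTwo ^ 4 + (-105 / 64 : ℚ) • (eisTwo ^ 2 * eisFour) + (5 / 6 :
      ℚ) • (eisTwo * eisSix) + (17 / 64 : ℚ) • eisFour ^ 2 + (-39 / 128 : ℚ) • eisTwo ^ 3 + (33 /
      64 : ℚ) • (eisTwo * eisFour) + (-1 / 4 : ℚ) • eisSix + (9 / 128 : ℚ) • eisTwo ^ 2 + (-5 / 64
      : ℚ) • eisFour + (-5 / 256 : ℚ) • eisTwo + (-13 / 8448 : ℚ) • 1) := by
    simp only [mom_crankSeries, crankNorm_two, crankNorm_four, crankNorm_six, crankNorm_eight, crankNorm_ten,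
      map_add, Derivation.leibniz, Derivation.leibniz_pow, Derivation.map_smul,
    Derivation.map_one_eq_zero, smul_eq_mul, euler_eisTwo, euler_eisFour, euler_eisSix,
      euler_partSeries]
    algebra
  rw [h4, h3, h2, h1, h0, rankMom_ten]
  algebra

-- In the top weight the derivatives of crank moments miss one dimension, so the twelfth rank moment
-- and its derivative are admitted. Both bring their own derivatives of the second rank moment, and
-- so the coefficients of `rankDeriv` here differ from those in `rankMom_fourteen`.
set_option maxHeartbeats 4000000 in
theorem rankMom_fourteen_eq : rankMom 14 =
      euler (euler (euler (euler (euler (euler ((-72879871890750039360 / 500559258125833 : ℚ)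
        • mom 0 2 crankSeries) + (64900493307331491600 / 500559258125833 : ℚ) • mom 0 2
        crankSeries + (102891330298568185920 / 500559258125833 : ℚ) • mom 0 4 crankSeries) +
        (-9799323398632214496 / 500559258125833 : ℚ) • mom 0 2 crankSeries +
        (-120768322433172523200 / 500559258125833 : ℚ) • mom 0 4 crankSeries +
        (-9415008528045251040 / 500559258125833 : ℚ) • mom 0 6 crankSeries) +
        (-5695109521067368596 / 500559258125833 : ℚ) • mom 0 2 crankSeries +
        (49871380869659622000 / 500559258125833 : ℚ) • mom 0 4 crankSeries +
        (8576940079691343360 / 500559258125833 : ℚ) • mom 0 6 crankSeries +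
        (1211258897373601440 / 500559258125833 : ℚ) • mom 0 8 crankSeries) +
        (1432135520165390316 / 500559258125833 : ℚ) • mom 0 2 crankSeries +
        (-7500992511470050320 / 500559258125833 : ℚ) • mom 0 4 crankSeries +
        (-2665878605303670120 / 500559258125833 : ℚ) • mom 0 6 crankSeries +
        (-795180541856500800 / 500559258125833 : ℚ) • mom 0 8 crankSeries + (-1518747537683376
        / 6030834435251 : ℚ) • mom 0 10 crankSeries) + (-8403022829831869 / 36626287179939 :
        ℚ) • mom 0 2 crankSeries + (490379121972892880 / 500559258125833 : ℚ) • mom 0 4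
        crankSeries + (170521880815421408 / 500559258125833 : ℚ) • mom 0 6 crankSeries +
        (168999055196096580 / 500559258125833 : ℚ) • mom 0 8 crankSeries + (810210819337920 /
        6030834435251 : ℚ) • mom 0 10 crankSeries + (25388554464 / 2775349487 : ℚ) • mom 0 12
        crankSeries) + (23432656561492057 / 4505033323132497 : ℚ) • mom 0 2 crankSeries +
        (-83581209838279972 / 4505033323132497 : ℚ) • mom 0 4 crankSeries + (-5339231461876312
        / 500559258125833 : ℚ) • mom 0 6 crankSeries + (-202163113240088 / 21763446005471 : ℚ)
        • mom 0 8 crankSeries + (-48292251685678 / 6030834435251 : ℚ) • mom 0 10 crankSeries +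
        (-25388554464 / 2775349487 : ℚ) • mom 0 12 crankSeries + (139497552 / 120667369 : ℚ) •
        mom 0 14 crankSeries +
      (-17962560 / 23 : ℚ) • rankDeriv 6 + (23950080 / 23 : ℚ) • rankDeriv 5 + (-11792088 / 23
        : ℚ) • rankDeriv 4 + (2496384 / 23 : ℚ) • rankDeriv 3 + (-242748 / 23 : ℚ) • rankDeriv
        2 + (10720 / 23 : ℚ) • rankDeriv 1 + (-1045 / 138 : ℚ) • rankDeriv 0 +
      (-546 / 23 : ℚ) • euler (rankMom 12) + (1183 / 138 : ℚ) • rankMom 12 := by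
  have h6 : (-72879871890750039360 / 500559258125833 : ℚ) • mom 0 2 crankSeries =
      partSeries * ((6073322657562503280 / 500559258125833 : ℚ) • eisTwo + (-6073322657562503280 /
      500559258125833 : ℚ) • 1) := by
    simp only [mom_crankSeries, crankNorm_two,
      map_add, Derivation.leibniz, Derivation.leibniz_pow, Derivation.map_smul,
    Derivation.map_one_eq_zero, smul_eq_mul, euler_eisTwo, euler_eisFour, euler_eisSix,
      euler_partSeries]
    algebra
  have h5 : euler (partSeries * ((6073322657562503280 / 500559258125833 : ℚ) • eisTwo +
        (-6073322657562503280 /       500559258125833 : ℚ) • 1)) + (64900493307331491600 /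
        500559258125833 : ℚ) • mom 0 2 crankSeries + (102891330298568185920 / 500559258125833
        : ℚ) • mom 0 4 crankSeries =
      partSeries * ((2396624491951941510 / 500559258125833 : ℚ) • eisTwo ^ 2 + (351317531024526276 /
      500559258125833 : ℚ) • eisFour + (-9189402983254423440 / 500559258125833 : ℚ) • eisTwo +
      (6441460960277955654 / 500559258125833 : ℚ) • 1) := by
    simp only [mom_crankSeries, crankNorm_two, crankNorm_four,
      map_add, Derivation.leibniz, Derivation.leibniz_pow, Derivation.map_smul,
    Derivation.map_one_eq_zero, smul_eq_mul, euler_eisTwo, euler_eisFour, euler_eisSix,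
      euler_partSeries]
    algebra
  have h4 : euler (partSeries * ((2396624491951941510 / 500559258125833 : ℚ) • eisTwo ^ 2 +
        (351317531024526276 /       500559258125833 : ℚ) • eisFour + (-9189402983254423440 /
        500559258125833 : ℚ) • eisTwo +       (6441460960277955654 / 500559258125833 : ℚ) •
        1)) + (-9799323398632214496 / 500559258125833 : ℚ) • mom 0 2 crankSeries +
        (-120768322433172523200 / 500559258125833 : ℚ) • mom 0 4 crankSeries +
        (-9415008528045251040 / 500559258125833 : ℚ) • mom 0 6 crankSeries =
      partSeries * ((1525222264310875305 / 2002237032503332 : ℚ) • eisTwo ^ 3 + (-397793593218730779 /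
      1001118516251666 : ℚ) • (eisTwo * eisFour) + (-79744698722281572 / 500559258125833 : ℚ) •
      eisSix + (-12176886672986170905 / 2002237032503332 : ℚ) • eisTwo ^ 2 + (-648107760092703687
      / 1001118516251666 : ℚ) • eisFour + (21377788914153590373 / 2002237032503332 : ℚ) • eisTwo +
      (-8315343003966299553 / 2002237032503332 : ℚ) • 1) := by
    simp only [mom_crankSeries, crankNorm_two, crankNorm_four, crankNorm_six,
      map_add, Derivation.leibniz, Derivation.leibniz_pow, Derivation.map_smul,
    Derivation.map_one_eq_zero, smul_eq_mul, euler_eisTwo, euler_eisFour, euler_eisSix,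
      euler_partSeries]
    algebra
  have h3 : euler (partSeries * ((1525222264310875305 / 2002237032503332 : ℚ) • eisTwo ^ 3 +
        (-397793593218730779 /       1001118516251666 : ℚ) • (eisTwo * eisFour) +
        (-79744698722281572 / 500559258125833 : ℚ) •       eisSix + (-12176886672986170905 /
        2002237032503332 : ℚ) • eisTwo ^ 2 + (-648107760092703687       / 1001118516251666 :
        ℚ) • eisFour + (21377788914153590373 / 2002237032503332 : ℚ) • eisTwo +
        (-8315343003966299553 / 2002237032503332 : ℚ) • 1)) + (-5695109521067368596 /
        500559258125833 : ℚ) • mom 0 2 crankSeries + (49871380869659622000 / 500559258125833 :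
        ℚ) • mom 0 4 crankSeries + (8576940079691343360 / 500559258125833 : ℚ) • mom 0 6
        crankSeries + (1211258897373601440 / 500559258125833 : ℚ) • mom 0 8 crankSeries =
      partSeries * ((32991637469879025 / 192986701928032 : ℚ) • eisTwo ^ 4 + (-14958316148125707 / 48246675482008
      : ℚ) • (eisTwo ^ 2 * eisFour) + (493549864854732 / 6030834435251 : ℚ) • (eisTwo * eisSix) +
      (6210894123039879 / 48246675482008 : ℚ) • eisFour ^ 2 + (-7418018909139848835 /
      8008948130013328 : ℚ) • eisTwo ^ 3 + (2286270001998301977 / 4004474065006664 : ℚ) • (eisTwo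
      * eisFour) + (59444427567777189 / 500559258125833 : ℚ) • eisSix + (11042143104176568699 /
      4004474065006664 : ℚ) • eisTwo ^ 2 + (219588860628665577 / 2002237032503332 : ℚ) • eisFour +
      (-22950425826700577511 / 8008948130013328 : ℚ) • eisTwo + (2619274241057542953 /
      16017896260026656 : ℚ) • 1) := by
    simp only [mom_crankSeries, crankNorm_two, crankNorm_four, crankNorm_six, crankNorm_eight,
      map_add, Derivation.leibniz, Derivation.leibniz_pow, Derivation.map_smul,
    Derivation.map_one_eq_zero, smul_eq_mul, euler_eisTwo, euler_eisFour, euler_eisSix,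
      euler_partSeries]
    algebra
  have h2 : euler (partSeries * ((32991637469879025 / 192986701928032 : ℚ) • eisTwo ^ 4 +
        (-14958316148125707 / 48246675482008       : ℚ) • (eisTwo ^ 2 * eisFour) +
        (493549864854732 / 6030834435251 : ℚ) • (eisTwo * eisSix) +       (6210894123039879 /
        48246675482008 : ℚ) • eisFour ^ 2 + (-7418018909139848835 /       8008948130013328 :
        ℚ) • eisTwo ^ 3 + (2286270001998301977 / 4004474065006664 : ℚ) • (eisTwo       *
        eisFour) + (59444427567777189 / 500559258125833 : ℚ) • eisSix + (11042143104176568699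
        /       4004474065006664 : ℚ) • eisTwo ^ 2 + (219588860628665577 / 2002237032503332 :
        ℚ) • eisFour +       (-22950425826700577511 / 8008948130013328 : ℚ) • eisTwo +
        (2619274241057542953 /       16017896260026656 : ℚ) • 1)) + (1432135520165390316 /
        500559258125833 : ℚ) • mom 0 2 crankSeries + (-7500992511470050320 / 500559258125833 :
        ℚ) • mom 0 4 crankSeries + (-2665878605303670120 / 500559258125833 : ℚ) • mom 0 6
        crankSeries + (-795180541856500800 / 500559258125833 : ℚ) • mom 0 8 crankSeries +
        (-1518747537683376 / 6030834435251 : ℚ) • mom 0 10 crankSeries =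
      partSeries * ((36105406137045 / 710489468672 : ℚ) • eisTwo ^ 5 + (-34682477719113 / 177622367168 : ℚ) •
      (eisTwo ^ 3 * eisFour) + (146776818699 / 965338952 : ℚ) • (eisTwo ^ 2 * eisSix) +
      (17307860134383 / 177622367168 : ℚ) • (eisTwo * eisFour ^ 2) + (-987853004313 / 11101397948
      : ℚ) • (eisFour * eisSix) + (-306717145732352775 / 1543893615424256 : ℚ) • eisTwo ^ 4 +
      (155142710206969653 / 385973403856064 : ℚ) • (eisTwo ^ 2 * eisFour) + (-3761385846865059 /
      24123337741004 : ℚ) • (eisTwo * eisSix) + (-45661428680217441 / 385973403856064 : ℚ) •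
      eisFour ^ 2 + (75008829680613799579 / 192214755120319872 : ℚ) • eisTwo ^ 3 +
      (-9701221462363371003 / 32035792520053312 : ℚ) • (eisTwo * eisFour) + (82380705301709927 /
      12013422195019992 : ℚ) • eisSix + (-31190613242414666751 / 64071585040106624 : ℚ) • eisTwo ^
      2 + (1616154508726198879 / 32035792520053312 : ℚ) • eisFour + (45061265556700875647 /
      128143170080213248 : ℚ) • eisTwo + (5807562300478497463 / 128143170080213248 : ℚ) • 1) := by
    simp only [mom_crankSeries, crankNorm_two, crankNorm_four, crankNorm_six, crankNorm_eight, crankNorm_ten,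
      map_add, Derivation.leibniz, Derivation.leibniz_pow, Derivation.map_smul,
    Derivation.map_one_eq_zero, smul_eq_mul, euler_eisTwo, euler_eisFour, euler_eisSix,
      euler_partSeries]
    algebra
  have h1 : euler (partSeries * ((36105406137045 / 710489468672 : ℚ) • eisTwo ^ 5 + (-34682477719113
        / 177622367168 : ℚ) •       (eisTwo ^ 3 * eisFour) + (146776818699 / 965338952 : ℚ) •
        (eisTwo ^ 2 * eisSix) +       (17307860134383 / 177622367168 : ℚ) • (eisTwo * eisFour
        ^ 2) + (-987853004313 / 11101397948       : ℚ) • (eisFour * eisSix) +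
        (-306717145732352775 / 1543893615424256 : ℚ) • eisTwo ^ 4 +       (155142710206969653
        / 385973403856064 : ℚ) • (eisTwo ^ 2 * eisFour) + (-3761385846865059 /
        24123337741004 : ℚ) • (eisTwo * eisSix) + (-45661428680217441 / 385973403856064 : ℚ) •
        eisFour ^ 2 + (75008829680613799579 / 192214755120319872 : ℚ) • eisTwo ^ 3 +
        (-9701221462363371003 / 32035792520053312 : ℚ) • (eisTwo * eisFour) +
        (82380705301709927 /       12013422195019992 : ℚ) • eisSix + (-31190613242414666751 /
        64071585040106624 : ℚ) • eisTwo ^       2 + (1616154508726198879 / 32035792520053312 :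
        ℚ) • eisFour + (45061265556700875647 /       128143170080213248 : ℚ) • eisTwo +
        (5807562300478497463 / 128143170080213248 : ℚ) • 1)) + (-8403022829831869 /
        36626287179939 : ℚ) • mom 0 2 crankSeries + (490379121972892880 / 500559258125833 : ℚ)
        • mom 0 4 crankSeries + (170521880815421408 / 500559258125833 : ℚ) • mom 0 6
        crankSeries + (168999055196096580 / 500559258125833 : ℚ) • mom 0 8 crankSeries +
        (810210819337920 / 6030834435251 : ℚ) • mom 0 10 crankSeries + (25388554464 /
        2775349487 : ℚ) • mom 0 12 crankSeries =
      partSeries * ((108497229401295 / 5683915749376 : ℚ) • eisTwo ^ 6 + (-360214117490241 / 2841957874688 : ℚ) •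
      (eisTwo ^ 4 * eisFour) + (7122969370629 / 44405591792 : ℚ) • (eisTwo ^ 3 * eisSix) +
      (60299458951095 / 1420978937344 : ℚ) • (eisTwo ^ 2 * eisFour ^ 2) + (-3552846274355 /
      22202795896 : ℚ) • (eisTwo * eisFour * eisSix) + (130314666248151 / 3552447343360 : ℚ) •
      eisFour ^ 3 + (14382527893 / 482669476 : ℚ) • eisSix ^ 2 + (-20081185338795 / 355244734336 :
      ℚ) • eisTwo ^ 5 + (21271035594711 / 88811183584 : ℚ) • (eisTwo ^ 3 * eisFour) +
      (-19122190829147 / 88811183584 : ℚ) • (eisTwo ^ 2 * eisSix) + (-5637507758337 / 88811183584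
      : ℚ) • (eisTwo * eisFour ^ 2) + (3795462966911 / 44405591792 : ℚ) • (eisFour * eisSix) +
      (2874176710149799495 / 37053446770182144 : ℚ) • eisTwo ^ 4 + (-566474390493984231 /
      3087787230848512 : ℚ) • (eisTwo ^ 2 * eisFour) + (15328347911581901 / 144740026446024 : ℚ) •
      (eisTwo * eisSix) + (1056108262794935077 / 46316808462727680 : ℚ) • eisFour ^ 2 +
      (-66443112202321924015 / 1153288530721919232 : ℚ) • eisTwo ^ 3 + (4331661226826287973 /
      64071585040106624 : ℚ) • (eisTwo * eisFour) + (-3241123686269436139 / 144161066340239904 :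
      ℚ) • eisSix + (95820735670235660465 / 3075436081925117952 : ℚ) • eisTwo ^ 2 +
      (-6400272406525218075 / 512572680320852992 : ℚ) • eisFour + (-814383956875832687 /
      50142979596605184 : ℚ) • eisTwo + (-37510842398523905131 / 9226308245775353856 : ℚ) • 1) := by
    simp only [mom_crankSeries, crankNorm_two, crankNorm_four, crankNorm_six, crankNorm_eight, crankNorm_ten, crankNorm_twelve,
      map_add, Derivation.leibniz, Derivation.leibniz_pow, Derivation.map_smul,
    Derivation.map_one_eq_zero, smul_eq_mul, euler_eisTwo, euler_eisFour, euler_eisSix,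
      euler_partSeries]
    algebra
  have h0 : euler (partSeries * ((108497229401295 / 5683915749376 : ℚ) • eisTwo ^ 6 +
        (-360214117490241 / 2841957874688 : ℚ) •       (eisTwo ^ 4 * eisFour) + (7122969370629
        / 44405591792 : ℚ) • (eisTwo ^ 3 * eisSix) +       (60299458951095 / 1420978937344 :
        ℚ) • (eisTwo ^ 2 * eisFour ^ 2) + (-3552846274355 /       22202795896 : ℚ) • (eisTwo *
        eisFour * eisSix) + (130314666248151 / 3552447343360 : ℚ) •       eisFour ^ 3 +
        (14382527893 / 482669476 : ℚ) • eisSix ^ 2 + (-20081185338795 / 355244734336 :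
        ℚ) • eisTwo ^ 5 + (21271035594711 / 88811183584 : ℚ) • (eisTwo ^ 3 * eisFour) +
        (-19122190829147 / 88811183584 : ℚ) • (eisTwo ^ 2 * eisSix) + (-5637507758337 /
        88811183584       : ℚ) • (eisTwo * eisFour ^ 2) + (3795462966911 / 44405591792 : ℚ) •
        (eisFour * eisSix) +       (2874176710149799495 / 37053446770182144 : ℚ) • eisTwo ^ 4
        + (-566474390493984231 /       3087787230848512 : ℚ) • (eisTwo ^ 2 * eisFour) +
        (15328347911581901 / 144740026446024 : ℚ) •       (eisTwo * eisSix) +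
        (1056108262794935077 / 46316808462727680 : ℚ) • eisFour ^ 2 +
        (-66443112202321924015 / 1153288530721919232 : ℚ) • eisTwo ^ 3 + (4331661226826287973
        /       64071585040106624 : ℚ) • (eisTwo * eisFour) + (-3241123686269436139 /
        144161066340239904 :       ℚ) • eisSix + (95820735670235660465 / 3075436081925117952 :
        ℚ) • eisTwo ^ 2 +       (-6400272406525218075 / 512572680320852992 : ℚ) • eisFour +
        (-814383956875832687 /       50142979596605184 : ℚ) • eisTwo + (-37510842398523905131
        / 9226308245775353856 : ℚ) • 1)) + (23432656561492057 / 4505033323132497 : ℚ) • mom 0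
        2 crankSeries + (-83581209838279972 / 4505033323132497 : ℚ) • mom 0 4 crankSeries +
        (-5339231461876312 / 500559258125833 : ℚ) • mom 0 6 crankSeries + (-202163113240088 /
        21763446005471 : ℚ) • mom 0 8 crankSeries + (-48292251685678 / 6030834435251 : ℚ) •
        mom 0 10 crankSeries + (-25388554464 / 2775349487 : ℚ) • mom 0 12 crankSeries +
        (139497552 / 120667369 : ℚ) • mom 0 14 crankSeries =
      -- This polynomial is that of the fourteenth rank moment minus the contributions of the
      -- twelfth one and of its derivative.
      partSeries * ((3295215 / 376832 : ℚ) • eisTwo ^ 7 + (-16731099 / 188416 : ℚ) • (eisTwo ^ 5 * eisFour) +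
      (3669435 / 23552 : ℚ) • (eisTwo ^ 4 * eisSix) + (-429429 / 94208 : ℚ) • (eisTwo ^ 3 *
      eisFour ^ 2) + (-1229165 / 5888 : ℚ) • (eisTwo ^ 2 * eisFour * eisSix) + (5077485 / 47104 :
      ℚ) • (eisTwo * eisFour ^ 3) + (60179 / 736 : ℚ) • (eisTwo * eisSix ^ 2) + (-4716853 / 88320
      : ℚ) • (eisFour ^ 2 * eisSix) + (-7688835 / 376832 : ℚ) • eisTwo ^ 6 + (27885165 / 188416 :
      ℚ) • (eisTwo ^ 4 * eisFour) + (-1223145 / 5888 : ℚ) • (eisTwo ^ 3 * eisSix) + (429429 /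
      94208 : ℚ) • (eisTwo ^ 2 * eisFour ^ 2) + (1229165 / 8832 : ℚ) • (eisTwo * eisFour * eisSix)
      + (-1692495 / 47104 : ℚ) • eisFour ^ 3 + (-60179 / 2208 : ℚ) • eisSix ^ 2 + (7700693 /
      376832 : ℚ) • eisTwo ^ 5 + (-9354345 / 94208 : ℚ) • (eisTwo ^ 3 * eisFour) + (3896893 /
      35328 : ℚ) • (eisTwo ^ 2 * eisSix) + (-4561557 / 471040 : ℚ) • (eisTwo * eisFour ^ 2) +
      (-5253703 / 264960 : ℚ) • (eisFour * eisSix) + (-10419695 / 1130496 : ℚ) • eisTwo ^ 4 +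
      (2924207 / 94208 : ℚ) • (eisTwo ^ 2 * eisFour) + (-1549691 / 52992 : ℚ) • (eisTwo * eisSix)
      + (8444579 / 1413120 : ℚ) • eisFour ^ 2 + (794365 / 376832 : ℚ) • eisTwo ^ 3 + (-2985125 /
      565248 : ℚ) • (eisTwo * eisFour) + (743171 / 211968 : ℚ) • eisSix + (-124033 / 376832 : ℚ) •
      eisTwo ^ 2 + (3840109 / 8478720 : ℚ) • eisFour + (219247 / 3391488 : ℚ) • eisTwo + (841 /
      245760 : ℚ) • 1) := by
    simp only [mom_crankSeries, crankNorm_two, crankNorm_four, crankNorm_six, crankNorm_eight, crankNorm_ten, crankNorm_twelve, crankNorm_fourteen,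
      map_add, Derivation.leibniz, Derivation.leibniz_pow, Derivation.map_smul,
    Derivation.map_one_eq_zero, smul_eq_mul, euler_eisTwo, euler_eisFour, euler_eisSix,
      euler_partSeries]
    algebra
  rw [h6, h5, h4, h3, h2, h1, h0, rankMom_fourteen, euler_rankMom_twelve, rankMom_twelve]
  algebra

end RankCrank

theorem theorem5p1 (n : ℕ) :
    -- the relation for the fourth rank moment
    RankCrank.rankMoment 4 n =
        2 / 3 * (-3 * (n : ℚ) - 1) * RankCrank.crankMoment 2 n
        + 8 / 3 * RankCrank.crankMoment 4 n
        + (-12 * (n : ℚ) + 1) * RankCrank.rankMoment 2 n ∧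
    -- the relation for the sixth rank moment
    RankCrank.rankMoment 6 n =
        2 / 33 * (324 * (n : ℚ) ^ 2 + 69 * (n : ℚ) - 10) * RankCrank.crankMoment 2 n
        + 20 / 33 * (-45 * (n : ℚ) + 4) * RankCrank.crankMoment 4 n
        + 18 / 11 * RankCrank.crankMoment 6 n
        + (108 * (n : ℚ) ^ 2 - 24 * (n : ℚ) + 1) * RankCrank.rankMoment 2 n ∧
    -- the relation for the eighth rank moment
    RankCrank.rankMoment 8 n =
        2 / 913 * (-72972 * (n : ℚ) ^ 3 - 1728 * (n : ℚ) ^ 2 + 5667 * (n : ℚ) - 289)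
          * RankCrank.crankMoment 2 n
        + 280 / 913 * (732 * (n : ℚ) ^ 2 - 195 * (n : ℚ) + 8) * RankCrank.crankMoment 4 n
        + 84 / 913 * (-196 * (n : ℚ) + 15) * RankCrank.crankMoment 6 n
        + 1248 / 913 * RankCrank.crankMoment 8 n
        + (-864 * (n : ℚ) ^ 3 + 360 * (n : ℚ) ^ 2 - 36 * (n : ℚ) + 1)
          * RankCrank.rankMoment 2 n ∧
    -- the relation for the tenth rank moment
    RankCrank.rankMoment 10 n =
        2 / 5951847 * (3588144480 * (n : ℚ) ^ 4 - 805458600 * (n : ℚ) ^ 3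
            - 398007108 * (n : ℚ) ^ 2 + 56257647 * (n : ℚ) - 1794592)
          * RankCrank.crankMoment 2 n
        + 140 / 5951847 * (-72270360 * (n : ℚ) ^ 3 + 36826920 * (n : ℚ) ^ 2
            - 3625245 * (n : ℚ) + 104002) * RankCrank.crankMoment 4 n
        + 210 / 1983949 * (1421544 * (n : ℚ) ^ 2 - 380744 * (n : ℚ) + 13519)
          * RankCrank.crankMoment 6 n
        + 120 / 1983949 * (-282435 * (n : ℚ) + 18796) * RankCrank.crankMoment 8 n
        + 2724 / 2173 * RankCrank.crankMoment 10 n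
        + (6480 * (n : ℚ) ^ 4 - 4320 * (n : ℚ) ^ 3 + 756 * (n : ℚ) ^ 2 - 48 * (n : ℚ) + 1)
          * RankCrank.rankMoment 2 n ∧
    -- the relation for the fourteenth rank moment, which involves the twelfth one
    RankCrank.rankMoment 14 n =
        1 / 4505033323132497 * (-655918847016750354240 * (n : ℚ) ^ 6
            + 584104439765983424400 * (n : ℚ) ^ 5 - 88193910587689930464 * (n : ℚ) ^ 4
            - 51255985689606317364 * (n : ℚ) ^ 3 + 12889219681488512844 * (n : ℚ) ^ 2
            - 1033571808069319887 * (n : ℚ) + 23432656561492057)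
          * RankCrank.crankMoment 2 n
        + 364 / 4505033323132497 * (2544016408481081520 * (n : ℚ) ^ 5
            - 2986029950270749200 * (n : ℚ) ^ 4 + 1233083592931144500 * (n : ℚ) ^ 3
            - 185464100558325420 * (n : ℚ) ^ 2 + 12124758510318780 * (n : ℚ)
            - 229618708346923) * RankCrank.crankMoment 4 n
        + 728 / 500559258125833 * (-12932704022040180 * (n : ℚ) ^ 4
            + 11781511098477120 * (n : ℚ) ^ 3 - 3661921161131415 * (n : ℚ) ^ 2
            + 234233352768436 * (n : ℚ) - 7334109150929) * RankCrank.crankMoment 6 n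
        + 364 / 500559258125833 * (3327634333443960 * (n : ℚ) ^ 3
            - 2184561928177200 * (n : ℚ) ^ 2 + 464283118670595 * (n : ℚ)
            - 12774042869566) * RankCrank.crankMoment 8 n
        + 2002 / 6030834435251 * (-758615153688 * (n : ℚ) ^ 2 + 404700708960 * (n : ℚ)
            - 24122003839) * RankCrank.crankMoment 10 n
        + 25388554464 / 2775349487 * ((n : ℚ) - 1) * RankCrank.crankMoment 12 n
        + 139497552 / 120667369 * RankCrank.crankMoment 14 n
        + 1 / 138 * (-107775360 * (n : ℚ) ^ 6 + 143700480 * (n : ℚ) ^ 5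
            - 70752528 * (n : ℚ) ^ 4 + 14978304 * (n : ℚ) ^ 3 - 1456488 * (n : ℚ) ^ 2
            + 64320 * (n : ℚ) - 1045) * RankCrank.rankMoment 2 n
        + 91 / 138 * (-36 * (n : ℚ) + 13) * RankCrank.rankMoment 12 n := by
  refine ⟨?_, ?_, ?_, ?_, ?_⟩
  -- On n-th coefficients every D becomes a factor n, so the Horner form expands to the stated
  -- polynomial in n.
  · have h := congrArg (PowerSeries.coeff n) RankCrank.rankMom_four_eq
    simp only [map_add, PowerSeries.coeff_smul, RankCrank.coeff_euler, RankCrank.coeff_rankDeriv,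
      RankCrank.coeff_mom_crankSeries, RankCrank.rankMom, RankCrank.coeff_mom_rankSeries,
      smul_eq_mul] at h
    rw [h]
    ring
  · have h := congrArg (PowerSeries.coeff n) RankCrank.rankMom_six_eq
    simp only [map_add, PowerSeries.coeff_smul, RankCrank.coeff_euler, RankCrank.coeff_rankDeriv,
      RankCrank.coeff_mom_crankSeries, RankCrank.rankMom, RankCrank.coeff_mom_rankSeries,
      smul_eq_mul] at h
    rw [h]
    ring
  · have h := congrArg (PowerSeries.coeff n) RankCrank.rankMom_eight_eq
    simp only [map_add, PowerSeries.coeff_smul, RankCrank.coeff_euler, RankCrank.coeff_rankDeriv,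
      RankCrank.coeff_mom_crankSeries, RankCrank.rankMom, RankCrank.coeff_mom_rankSeries,
      smul_eq_mul] at h
    rw [h]
    ring
  · have h := congrArg (PowerSeries.coeff n) RankCrank.rankMom_ten_eq
    simp only [map_add, PowerSeries.coeff_smul, RankCrank.coeff_euler, RankCrank.coeff_rankDeriv,
      RankCrank.coeff_mom_crankSeries, RankCrank.rankMom, RankCrank.coeff_mom_rankSeries,
      smul_eq_mul] at h
    rw [h]
    ring
  · have h := congrArg (PowerSeries.coeff n) RankCrank.rankMom_fourteen_eq
    simp only [map_add, PowerSeries.coeff_smul, RankCrank.coeff_euler, RankCrank.coeff_rankDeriv,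
      RankCrank.coeff_mom_crankSeries, RankCrank.rankMom, RankCrank.coeff_mom_rankSeries,
      smul_eq_mul] at h
    rw [h]
    ring
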